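/- **Setting.** For every $\varepsilon\ge 0$ let $(\eta^{(\varepsilon)}_n,\kappa^{(\varepsilon)}_n)_{n\ge0}$ be a Markov renewal process with state space $X\times\{1,2,\dots\}$, $X=\{0,1,\dots,N\}$, and transition probabilities $Q^{(\varepsilon)}_{ij}(n)=p^{(\varepsilon)}_{ij}f^{(\varepsilon)}_{ij}(n)$, where $(p^{(\varepsilon)}_{ij})$ is a stochastic matrix and each $f^{(\varepsilon)}_{ij}$ is a probability distribution on $\{1,2,\dots\}$. Let $\tau_m=\kappa_1+\dots+\kappa_m$ and let $\xi^{(\varepsilon)}(n)=\eta_{\max\{m:\tau_m\le n\}}$ be the associated semi-Markov process; $\mathsf P_i$ denotes the law of the process given $\eta_0=i$. Let $\nu_j=\min\{n\ge1:\eta_n=j\}$, $\mu_j=\kappa_1+\dots+\kappa_{\nu_j}$ (both $\infty$ if $j$ is never hit), and $$g_{ij}(n)=\mathsf P_i\{\mu_j=n,\ \nu_0>\nu_j\},\quad g_{ij}=\mathsf P_i\{\nu_0>\nu_j\},\quad h_{ijs}(n)=\mathsf P_i\{\xi(n)=s,\ \mu_0\wedge\mu_j>n\},$$ $$p_{ij}(\rho,r)=\sum_{n\ge0}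 n^re^{\rho n}Q_{ij}(n),\quad \phi_{ij}(\rho,r)=\sum_{n\ge0} n^re^{\rho n}g_{ij}(n),\quad \omega_{ijs}(\rho,r)=\sum_{n\ge0} n^re^{\rho n}h_{ijs}(n)$$ (with $0^0=1$; the argument $r=0$ is omitted; a superscript $(\varepsilon)$ is understood everywhere). **Conditions.** * **A**: for $i\ne0$, $j\in X$, $n\ge1$: $p^{(\varepsilon)}_{ij}\to p^{(0)}_{ij}$ and $f^{(\varepsilon)}_{ij}(n)\to f^{(0)}_{ij}(n)$ as $\varepsilon\to0$. * **B**: $g^{(0)}_{ij}>0$ for $i,j\neq0$. * **C**: there is $\beta>0$ with $\limsup_{0\le\varepsilon\to0}p^{(\varepsilon)}_{ij}(\beta)<\infty$ for all $i\ne0$, $j\in X$, and $\phi^{(0)}_{ii}(\beta_i)\in(1,\infty)$ for some $i\neq0$ and some $\beta_i\le\beta$. * **D**: for some $i\ne0$, $\gcd\{n:g^{(0)}_{ii}(n)>0\}=1$. * **P$_{k+1}$**: for $r=0,\dots,k+1$, $i\neq0$, $j\in X$, $$p^{(\varepsilon)}_{ij}(\rho^{(0)},r)=\sum_{n=0}^{k+1-r}p_{ij}[r,n]\varepsilon^n+o(\varepsilon^{k+1-r}),\qquad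 p_{ij}[r,0]=p^{(0)}_{ij}(\rho^{(0)},r),$$ where $\rho^{(\varepsilon)}$ is the non-negative root of the characteristic equation $\phi^{(\varepsilon)}_{ii}(\rho)=1$. **Theorem.** Let $k\ge0$ and let A–D and P$_{k+1}$ hold. Then for all sufficiently small $\varepsilon\ge0$ the non-negative root $\rho^{(\varepsilon)}$ exists, is unique, and does not depend on $i\ne0$, and for all $i,j\ne0$ the quasi-stationary distribution $$\pi^{(\varepsilon)}_j=\lim_{n\to\infty}\mathsf P_i\{\xi^{(\varepsilon)}(n)=j\mid\mu^{(\varepsilon)}_0>n\}=\frac{\omega^{(\varepsilon)}_{iij}(\rho^{(\varepsilon)})}{\sum_{s\ne0}\omega^{(\varepsilon)}_{iis}(\rho^{(\varepsilon)})}$$ exists, does not depend on $i$, and has the expansion $$\pi_j^{(\varepsilon)}=\pi_j^{(0)}+\pi_j[1]\varepsilon+\dots+\pi_j[k]\varepsilon^k+o(\varepsilon^k),\qquad j\neq0.$$ The coefficients are given, for any choice of $i\ne0$, by the following algorithm. (0) For $r=0,\dots,k$ and $j\ne 0$ the functionals at $\rho^{(0)}$ are finite for small $\varepsilon$ and $$\phi^{(\varepsilon)}_{ii}(\rho^{(0)},r)=\sum_{n=0}^{k-r}b_i[r,n]\varepsilon^n+o(\varepsilon^{k-r}),\qquad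 \omega^{(\varepsilon)}_{iij}(\rho^{(0)},r)=\sum_{n=0}^{k-r}a_{ij}[r,n]\varepsilon^n+o(\varepsilon^{k-r}).$$ Here $b_i[r,n]=x_i[r,n]$ for the data $\theta_l[r,n]=p_{li}[r,n]$, and $a_{ij}[r,n]=x_i[r,n]$ for the data $\theta_l[r,n]=\mathbf 1_{\{l=j\}}\psi_l[r,n]$, where the vectors $x[r,n]$ are computed recursively as follows. Let $M[r,n]$ be the matrix with entries $p_{lm}[r,n]$ for $l\ne0$, $m\ne0,i$ and zeros elsewhere; $I-M[0,0]$ is invertible. Put $U[0]=(I-M[0,0])^{-1}$, $U[n]=U[0]\sum_{q=0}^{n-1}M[0,n-q]U[q]$, and $$x[r,n]=\sum_{q=0}^nU[n-q]\Big(\theta[r,q]+\sum_{m=0}^{r-1}\binom rm\sum_{s=0}^qM[r-m,q-s]\,x[m,s]\Big).$$ The $\psi_l[r,n]$ are the coefficients of $\sum_{n\ge0}n^re^{\rho^{(0)}n}\mathsf P_l\{\kappa_1>n\}$: if $\rho^{(0)}=0$, with the Bernoulli numbers $B_t$ ($B_1=-\tfrac12$), $$\psi_l[r,n]=\frac1{r+1}\sum_{t=0}^rB_t\binom{r+1}t\sum_{j\in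 X}p_{lj}[r+1-t,n],$$ and if $\rho^{(0)}\neq0$, $$\psi_l[r,n]=\frac1{e^{\rho^{(0)}}-1}\Big(\sum_{j\in X}p_{lj}[r,n]-\mathbf 1_{\{r=n=0\}}-e^{\rho^{(0)}}\sum_{m=0}^{r-1}\binom rm\psi_l[m,n]\Big).$$ (1) $\rho^{(\varepsilon)}=\rho^{(0)}+c_1\varepsilon+\dots+c_k\varepsilon^k+o(\varepsilon^k)$, where $b_i[1,0]\ne0$ and, for $n=1,\dots,k$, $$c_n=-\frac1{b_i[1,0]}\Big(b_i[0,n]+\sum_{q=1}^{n-1}b_i[1,n-q]c_q+\sum_{m=2}^n\sum_{q=m}^nb_i[m,n-q]\sum_{D_{m,q}}\prod_{p=1}^{q-1}\frac{c_p^{n_p}}{n_p!}\Big),$$ $D_{m,q}$ being the set of non-negative integer solutions of $n_1+\dots+n_{q-1}=m$, $n_1+2n_2+\dots+(q-1)n_{q-1}=q$. (2) For $j\ne0$, $\omega^{(\varepsilon)}_{iij}(\rho^{(\varepsilon)})$ is finite for small $\varepsilon$ and equals $d_{ij}[0]+d_{ij}[1]\varepsilon+\dots+d_{ij}[k]\varepsilon^k+o(\varepsilon^k)$,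 where $d_{ij}[0]=\omega^{(0)}_{iij}(\rho^{(0)})=a_{ij}[0,0]$ and, for $n=1,\dots,k$, $$d_{ij}[n]=a_{ij}[0,n]+\sum_{q=1}^na_{ij}[1,n-q]c_q+\sum_{m=2}^n\sum_{q=m}^na_{ij}[m,n-q]\sum_{D_{m,q}}\prod_{p=1}^{q-1}\frac{c_p^{n_p}}{n_p!}.$$ (3) With $e_i[n]=\sum_{j\ne0}d_{ij}[n]$ one has $e_i[0]\ne0$, $\pi_j[0]=\pi_j^{(0)}$, and, for $n=0,\dots,k$, $$\pi_j[n]=\frac1{e_i[0]}\Big(d_{ij}[n]-\sum_{q=0}^{n-1}e_i[n-q]\pi_j[q]\Big).$$ -/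

import Mathlib

open Filter Topology MeasureTheory
open scoped NNReal ENNReal Matrix

universe u

namespace QSD

/-- Transition characteristics of a discrete time semi-Markov process on `{0, …, N}`:
transition probabilities `p i j` of the embedded Markov chain and the distributions `f i j`
on `{1, 2, …}` of the transition times. The distribution `f i j` is part of the
data even when `p i j = 0`. -/
structure TransitionLaw (N : ℕ) where
  p : Fin (N + 1) → Fin (N + 1) → ℝ
  f : Fin (N + 1) → Fin (N + 1) → ℕ → ℝ
  p_nonneg : ∀ i j, 0 ≤ p i j
  p_sum : ∀ i, ∑ j, p i j = 1
  f_nonneg : ∀ i j n, 0 ≤ f i j n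
  f_zero : ∀ i j, f i j 0 = 0
  f_hasSum : ∀ i j, HasSum (f i j) 1

/-- Transition probabilities `Q i j n = p i j * f i j n` of the Markov renewal process. -/
def TransitionLaw.Q {N : ℕ} (T : TransitionLaw N) (i j : Fin (N + 1)) (n : ℕ) : ℝ :=
  T.p i j * T.f i j n

/-- A Markov renewal process `(η n, κ n)` with state space `{0, …, N} × {1, 2, …}` and transition
probabilities `Q`, under the family of laws `P i` of the process started from `η 0 = i`. -/
structure MarkovRenewalProcess {N : ℕ} (T : TransitionLaw N) where
  Ω : Type u
  mΩ : MeasurableSpace Ω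
  P : Fin (N + 1) → Measure Ω
  isProb : ∀ i, IsProbabilityMeasure (P i)
  η : ℕ → Ω → Fin (N + 1)
  κ : ℕ → Ω → ℕ
  measurable_η : ∀ n, Measurable (η n)
  measurable_κ : ∀ n, Measurable (κ n)
  one_le_κ : ∀ n ω, 1 ≤ κ n ω
  initial : ∀ i, P i {ω | η 0 ω = i} = 1
  markov : ∀ (i : Fin (N + 1)) (n : ℕ) (x : ℕ → Fin (N + 1)) (t : ℕ → ℕ),
    P i {ω | ∀ m ≤ n + 1, η m ω = x m ∧ κ m ω = t m} =
      P i {ω | ∀ m ≤ n, η m ω = x m ∧ κ m ω = t m} *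
        ENNReal.ofReal (T.Q (x n) (x (n + 1)) (t (n + 1)))

attribute [instance] MarkovRenewalProcess.mΩ MarkovRenewalProcess.isProb

/-- Mixed power-exponential moment `∑ n, n ^ r * exp (ρ * n) * a n`, with value `∞` allowed. -/
noncomputable def expMoment (a : ℕ → ℝ≥0∞) (ρ : ℝ) (r : ℕ) : ℝ≥0∞ :=
  ∑' n : ℕ, ENNReal.ofReal ((n : ℝ) ^ r * Real.exp (ρ * n)) * a n

/-- The moment functional `p_{ij}(ρ, r)`. -/
noncomputable def TransitionLaw.pMoment {N : ℕ} (T : TransitionLaw N) (i j : Fin (N + 1))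
    (ρ : ℝ) (r : ℕ) : ℝ≥0∞ :=
  expMoment (fun n => ENNReal.ofReal (T.Q i j n)) ρ r

namespace MarkovRenewalProcess

variable {N : ℕ} {T : TransitionLaw N} (X : MarkovRenewalProcess.{u} T)

/-- The time `κ 1 + ⋯ + κ m` of the `m`-th transition. -/
def τ (m : ℕ) (ω : X.Ω) : ℕ := ∑ r ∈ Finset.range m, X.κ (r + 1) ω

/-- The semi-Markov process `ξ(n) = η_{max {m : τ_m ≤ n}}`. As `τ_m ≥ m`, the
maximum is attained at some `m ≤ n`. -/
def ξ (n : ℕ) (ω : X.Ω) : Fin (N + 1) :=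
  X.η (Nat.findGreatest (fun m => X.τ m ω ≤ n) n) ω

/-- First hitting time `min {n ≥ 1 : η n = j}` of the embedded chain (`⊤` if there is none). -/
noncomputable def ν (j : Fin (N + 1)) (ω : X.Ω) : ℕ∞ :=
  sInf {m : ℕ∞ | ∃ n : ℕ, m = n ∧ 1 ≤ n ∧ X.η n ω = j}

open Classical in
/-- First hitting time `κ 1 + ⋯ + κ (ν j)` of the semi-Markov process. -/
noncomputable def μ (j : Fin (N + 1)) (ω : X.Ω) : ℕ∞ :=
  if X.ν j ω = ⊤ then ⊤ else (X.τ (X.ν j ω).toNat ω : ℕ∞)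

/-- `g_{ij}(n) = P_i {μ_j = n, ν_0 > ν_j}`. -/
noncomputable def g (i j : Fin (N + 1)) (n : ℕ) : ℝ≥0∞ :=
  X.P i {ω | X.μ j ω = n ∧ X.ν j ω < X.ν 0 ω}

/-- `g_{ij} = P_i {ν_0 > ν_j}`. -/
noncomputable def gTotal (i j : Fin (N + 1)) : ℝ≥0∞ :=
  X.P i {ω | X.ν j ω < X.ν 0 ω}

/-- `h_{ijs}(n) = P_i {ξ(n) = s, min(μ_0, μ_j) > n}`. -/
noncomputable def h (i j s : Fin (N + 1)) (n : ℕ) : ℝ≥0∞ :=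
  X.P i {ω | X.ξ n ω = s ∧ (n : ℕ∞) < min (X.μ 0 ω) (X.μ j ω)}

/-- The functional `φ_{ij}(ρ, r)`. -/
noncomputable def φ (i j : Fin (N + 1)) (ρ : ℝ) (r : ℕ) : ℝ≥0∞ :=
  expMoment (X.g i j) ρ r

/-- The functional `ω_{ijs}(ρ, r)`. -/
noncomputable def omega (i j s : Fin (N + 1)) (ρ : ℝ) (r : ℕ) : ℝ≥0∞ :=
  expMoment (X.h i j s) ρ r

/-- `ρ` is a non-negative solution of the characteristic equation `φ_{ii}(ρ) = 1` for
every `i ≠ 0`. -/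
def IsCharRoot (ρ : ℝ) : Prop :=
  0 ≤ ρ ∧ ∀ i : Fin (N + 1), i ≠ 0 → X.φ i i ρ 0 = 1

/-- The root of the characteristic equation. -/
noncomputable def charRoot : ℝ := sInf {ρ : ℝ | X.IsCharRoot ρ}

/-- `P_i {ξ(n) = j | μ_0 > n}`. -/
noncomputable def condProb (i j : Fin (N + 1)) (n : ℕ) : ℝ :=
  (ProbabilityTheory.cond (X.P i) {ω | (n : ℕ∞) < X.μ 0 ω}).real {ω | X.ξ n ω = j}

/-- `π` is the quasi-stationary distribution: the limit of the
conditional probabilities, whatever the initial state `i ≠ 0`. The conditioning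
events are required to have positive probability. -/
def IsQuasiStationary (π : Fin (N + 1) → ℝ) : Prop :=
  ∀ i : Fin (N + 1), i ≠ 0 →
    (∀ n : ℕ, X.P i {ω | (n : ℕ∞) < X.μ 0 ω} ≠ 0) ∧
      ∀ j : Fin (N + 1), j ≠ 0 → Tendsto (X.condProb i j) atTop (𝓝 (π j))

end MarkovRenewalProcess

/-- `x ε = c 0 + c 1 ε + ⋯ + c m ε ^ m + o(ε ^ m)` as `0 < ε → 0`, with `c 0 = x 0`. -/
def HasExpansion (x : ℝ≥0 → ℝ) (c : ℕ → ℝ) (m : ℕ) : Prop :=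
  x 0 = c 0 ∧
    (fun ε : ℝ≥0 => x ε - ∑ n ∈ Finset.range (m + 1), c n * (ε : ℝ) ^ n)
      =o[𝓝[>] (0 : ℝ≥0)] fun ε : ℝ≥0 => (ε : ℝ) ^ m

/-- A distribution on `ℕ` (possibly improper) is non-periodic. -/
def NonPeriodic (a : ℕ → ℝ≥0∞) : Prop :=
  ∀ d : ℕ, (∀ n : ℕ, a n ≠ 0 → d ∣ n) → d = 1

section Conditions

variable {N : ℕ} (T : ℝ≥0 → TransitionLaw N) (X : ∀ ε : ℝ≥0, MarkovRenewalProcess.{u} (T ε))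

/-- Convergence of the transition probabilities and of the transition time distributions. -/
def CondA : Prop :=
  (∀ i j : Fin (N + 1), i ≠ 0 →
    Tendsto (fun ε => (T ε).p i j) (𝓝 0) (𝓝 ((T 0).p i j))) ∧
  (∀ (i j : Fin (N + 1)) (n : ℕ), i ≠ 0 →
    Tendsto (fun ε => (T ε).f i j n) (𝓝 0) (𝓝 ((T 0).f i j n)))

/-- The states `1, …, N` of the limiting process communicate. -/
def CondB : Prop :=
  ∀ i j : Fin (N + 1), i ≠ 0 → j ≠ 0 → 0 < (X 0).gTotal i j

/-- Exponential moments. -/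
def CondC : Prop :=
  ∃ β : ℝ, 0 < β ∧
    (∀ i j : Fin (N + 1), i ≠ 0 →
      limsup (fun ε => (T ε).pMoment i j β 0) (𝓝 (0 : ℝ≥0)) < ⊤) ∧
    (∃ i : Fin (N + 1), i ≠ 0 ∧ ∃ βi : ℝ, βi ≤ β ∧
      1 < (X 0).φ i i βi 0 ∧ (X 0).φ i i βi 0 < ⊤)

/-- Non-periodicity of the limiting process. -/
def CondD : Prop :=
  ∃ i : Fin (N + 1), i ≠ 0 ∧ NonPeriodic ((X 0).g i i)

/-- Perturbation condition of order `K` at `ρ`: for `r = 0, …, K` the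
moment functional `p_{ij}(ρ, r)` has an expansion of order `K - r` with coefficients
`pc i j r n`, `n = 0, …, K - r`. -/
def CondP (ρ : ℝ) (K : ℕ) (pc : Fin (N + 1) → Fin (N + 1) → ℕ → ℕ → ℝ) : Prop :=
  ∀ r : ℕ, r ≤ K → ∀ i j : Fin (N + 1), i ≠ 0 →
    HasExpansion (fun ε => ((T ε).pMoment i j ρ r).toReal) (pc i j r) (K - r)

end Conditions

section Algorithm

variable {N : ℕ}

/-- `n`-th coefficient of the matrix of the moments `p_{il}(ρ, r)`, `i ≠ 0`, `l ≠ 0, j`; the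
remaining entries are zero. -/
def tabooCoeff (pc : Fin (N + 1) → Fin (N + 1) → ℕ → ℕ → ℝ) (j : Fin (N + 1)) (r n : ℕ) :
    Matrix (Fin (N + 1)) (Fin (N + 1)) ℝ :=
  Matrix.of fun i l => if i = 0 ∨ l = 0 ∨ l = j then 0 else pc i l r n

/-- Coefficients of the expansion of `(1 - M)⁻¹`, from the coefficients `M n` of `M`. -/
noncomputable def inverseCoeff (M : ℕ → Matrix (Fin (N + 1)) (Fin (N + 1)) ℝ) :
    ℕ → Matrix (Fin (N + 1)) (Fin (N + 1)) ℝ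
  | 0 => (1 - M 0)⁻¹
  | n + 1 => (1 - M 0)⁻¹ * ∑ q : Fin (n + 1), M (n + 1 - q) * inverseCoeff M q

/-- Coefficients of the expansions of the vectors `x r`, `r = 0, 1, …`, that solve the linear systems
`x r = θ r + ∑ m ∈ {0, …, r}, (r choose m) M (r - m) x m`. -/
noncomputable def solutionCoeff (M : ℕ → ℕ → Matrix (Fin (N + 1)) (Fin (N + 1)) ℝ)
    (θ : ℕ → ℕ → Fin (N + 1) → ℝ) (r : ℕ) (n : ℕ) : Fin (N + 1) → ℝ :=
  ∑ q ∈ Finset.range (n + 1), inverseCoeff (M 0) (n - q) *ᵥ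
    (θ r q + ∑ m : Fin r, (r.choose m : ℝ) •
      ∑ s ∈ Finset.range (q + 1), M (r - m) (q - s) *ᵥ solutionCoeff M θ m s)
termination_by r
decreasing_by exact m.2

/-- Coefficients of the expansion of `∑ n, n ^ r * exp (ρ * n) * P_i {κ_1 > n}`. -/
noncomputable def sojournCoeff (pc : Fin (N + 1) → Fin (N + 1) → ℕ → ℕ → ℝ) (ρ : ℝ)
    (i : Fin (N + 1)) (r n : ℕ) : ℝ :=
  if ρ = 0 then
    ∑ t ∈ Finset.range (r + 1),
      (bernoulli t : ℝ) * ((r + 1).choose t : ℝ) / (r + 1 : ℝ) * ∑ j, pc i j (r + 1 - t) n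
  else
    ((∑ j, pc i j r n) - (if r = 0 ∧ n = 0 then 1 else 0)
      - Real.exp ρ * ∑ m : Fin r, (r.choose m : ℝ) * sojournCoeff pc ρ i m n)
      / (Real.exp ρ - 1)
termination_by r
decreasing_by exact m.2

/-- The coefficients `b_i[r, n]` of `φ_{ii}(ρ, r)`. -/
noncomputable def phiCoeff (pc : Fin (N + 1) → Fin (N + 1) → ℕ → ℕ → ℝ)
    (i : Fin (N + 1)) (r n : ℕ) : ℝ :=
  solutionCoeff (tabooCoeff pc i) (fun r n l => pc l i r n) r n i

/-- The coefficients `a_{ij}[r, n]` of `ω_{iij}(ρ, r)`. -/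
noncomputable def omegaCoeff (pc : Fin (N + 1) → Fin (N + 1) → ℕ → ℕ → ℝ) (ρ : ℝ)
    (i j : Fin (N + 1)) (r n : ℕ) : ℝ :=
  solutionCoeff (tabooCoeff pc i)
    (fun r n l => if l = j then sojournCoeff pc ρ l r n else 0) r n i

/-- The sum over `D_{m,q}` of the products of `c_p ^ n_p / n_p!`, `p = 1, …, q - 1`. -/
noncomputable def sumD (c : ℕ → ℝ) (m q : ℕ) : ℝ :=
  ∑ ν ∈ (Finset.piAntidiag (Finset.Icc 1 (q - 1)) m).filter
      (fun ν : ℕ → ℕ => ∑ p ∈ Finset.Icc 1 (q - 1), p * ν p = q),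
    ∏ p ∈ Finset.Icc 1 (q - 1), c p ^ ν p / ((ν p).factorial : ℝ)

/-- The right-hand side of the recursion for `c_n`; it involves `c_1, …, c_{n-1}` only. -/
noncomputable def rootStep (b : ℕ → ℕ → ℝ) (c : ℕ → ℝ) (n : ℕ) : ℝ :=
  -(1 / b 1 0) *
    (b 0 n + ∑ q ∈ Finset.Icc 1 (n - 1), b 1 (n - q) * c q
      + ∑ m ∈ Finset.Icc 2 n, ∑ q ∈ Finset.Icc m n, b m (n - q) * sumD c m q)

/-- The right-hand side of the formula for `d_{ij}[n]`, `n ≥ 1`. -/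
noncomputable def omegaStep (a : ℕ → ℕ → ℝ) (c : ℕ → ℝ) (n : ℕ) : ℝ :=
  a 0 n + ∑ q ∈ Finset.Icc 1 n, a 1 (n - q) * c q
    + ∑ m ∈ Finset.Icc 2 n, ∑ q ∈ Finset.Icc m n, a m (n - q) * sumD c m q

end Algorithm

end QSD

namespace QSD

open PowerSeries Finset

/-! All sequences are encoded as power series with coefficients in [0,∞]. The exponential moment of
order 0 is a semiring homomorphism and the moments of order r obey a Leibniz rule, so identities
between generating series pass to moments without any convergence condition. Sorting paths by their
number of transitions identifies g and h with resolvents ∑ K^m B of a taboo kernel (`g_eq`, `h_eq`),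
and decomposing at the first visit to i gives the renewal equation `hSeries_zero_eq`.

For a fixed ε the root ρ comes from the intermediate value theorem. At the root the Green function
of the taboo kernel of i is an invariant measure; its minimality makes the root the same for every
state and makes the functionals ω for two reference states proportional (`Communicates.solidarity`).
Multiplying by exp(ρn) turns g_ii into a proper, non-periodic distribution with an exponential
moment. The renewal theorem `renewal_tendsto` then gives the limit of exp(ρn) P_l{ξ(n)=j, μ_0>n} as
a product in which only the factor ω_iij(ρ) depends on j (`tendsto_tilt`), and dividing by the sum
over j yields the quasi-stationary distribution.

Uniformity in ε is the second ingredient. Condition A is only pointwise, but the bounds at β control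
the tails, so the entries of the kernels grow by little when ε is small and ρ moves slightly to the
right of the limiting root. A strictly superharmonic vector of the limiting kernel survives this
change and bounds all perturbed Green functions (`CondA.exists_green_le`). The outcome is
`RegularPerturbation`: uniform exponential moments beyond the limiting root, hence finite moments of
every order at it and uniform Taylor remainders.

Expansions in ε are handled through formal power series (`Expands`), compatibly with sums, products,
inverses and linear systems, so each recursion of the algorithm is a comparison of coefficients in a
formal identity. The moments of a resolvent solve triangular linear systems (`expands_solution`,
`hasExpansion_mom_resolvent`), whose data come from the perturbation condition and from the sojourn
time tails (`CondP.hasExpansion_survival`). The equation φ(ρ^(ε)) = 1, Taylor expanded at the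
limiting root, is bootstrapped order by order to an expansion of the root (`exists_expands_root`,
`eq_rootStep`). Taylor expansion of ω along the root (`expands_taylor`) and a quotient
(`HasExpansion.quotient_recursion`) finish the proof. -/

/-! ### Mixed moments of power series with extended non-negative coefficients -/

/-- The mixed power-exponential moment of the sequence of coefficients of a power series. -/
noncomputable def mom (ρ : ℝ) (r : ℕ) (a : PowerSeries ℝ≥0∞) : ℝ≥0∞ :=
  expMoment (fun n => coeff n a) ρ r

/-- The weight `n ^ r * exp (ρ * n)`. -/
noncomputable def weight (ρ : ℝ) (r n : ℕ) : ℝ≥0∞ :=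
  ENNReal.ofReal ((n : ℝ) ^ r * Real.exp (ρ * n))

lemma mom_eq (ρ : ℝ) (r : ℕ) (a : PowerSeries ℝ≥0∞) :
    mom ρ r a = ∑' n, weight ρ r n * coeff n a := rfl

/-- Binomial theorem for the power, multiplicativity for the exponential. This is the source of the
Leibniz rule for moments of products. -/
lemma weight_add (ρ : ℝ) (r m n : ℕ) :
    weight ρ r (m + n) =
      ∑ s ∈ range (r + 1), (r.choose s : ℝ≥0∞) * (weight ρ (r - s) m * weight ρ s n) := by
  unfold weight
  have h : ((m + n : ℕ) : ℝ) ^ r * Real.exp (ρ * (m + n : ℕ)) =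
      ∑ s ∈ range (r + 1), (r.choose s : ℝ) * (((m : ℝ) ^ (r - s) * Real.exp (ρ * m)) *
        ((n : ℝ) ^ s * Real.exp (ρ * n))) := by
    push_cast
    rw [mul_add, Real.exp_add, add_comm (m : ℝ) n, add_pow, sum_mul]
    refine sum_congr rfl fun s _ => ?_
    ring
  rw [h, ENNReal.ofReal_sum_of_nonneg (fun s _ => by positivity)]
  refine sum_congr rfl fun s _ => ?_
  rw [ENNReal.ofReal_mul (by positivity), ENNReal.ofReal_mul (by positivity),
    ENNReal.ofReal_natCast]

lemma weight_ne_top (ρ : ℝ) (r n : ℕ) : weight ρ r n ≠ ⊤ := ENNReal.ofReal_ne_top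

lemma weight_zero_pos (ρ : ℝ) (n : ℕ) : weight ρ 0 n ≠ 0 := by
  simp [weight, Real.exp_pos]

lemma mom_add (ρ : ℝ) (r : ℕ) (a b : PowerSeries ℝ≥0∞) :
    mom ρ r (a + b) = mom ρ r a + mom ρ r b := by
  simp only [mom_eq, map_add, mul_add, ENNReal.tsum_add]

lemma mom_zero (ρ : ℝ) (r : ℕ) : mom ρ r 0 = 0 := by
  simp [mom_eq]

lemma mom_sum {ι : Type*} (ρ : ℝ) (r : ℕ) (s : Finset ι) (a : ι → PowerSeries ℝ≥0∞) :
    mom ρ r (∑ i ∈ s, a i) = ∑ i ∈ s, mom ρ r (a i) := by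
  classical
  induction s using Finset.induction_on with
  | empty => simp [mom_zero]
  | insert i s hi ih => rw [sum_insert hi, sum_insert hi, mom_add, ih]

lemma tsum_antidiagonal (c : ℕ → ℕ → ℝ≥0∞) :
    ∑' n, ∑ p ∈ antidiagonal n, c p.1 p.2 = ∑' m, ∑' n, c m n := by
  rw [← ENNReal.tsum_prod, ← Finset.HasAntidiagonal.sigmaAntidiagonalEquivProd.tsum_eq,
    ENNReal.tsum_sigma']
  refine tsum_congr fun n => ?_
  rw [tsum_fintype, ← Finset.sum_coe_sort (antidiagonal n)]
  rfl

/-- Formally the r-th derivative in ρ of a product. Infinite values are harmless, since all sums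
have terms in [0,∞] and may be rearranged. -/
lemma mom_mul (ρ : ℝ) (r : ℕ) (a b : PowerSeries ℝ≥0∞) :
    mom ρ r (a * b) =
      ∑ s ∈ range (r + 1), (r.choose s : ℝ≥0∞) * (mom ρ (r - s) a * mom ρ s b) := by
  have h1 : ∀ n, weight ρ r n * coeff n (a * b) = ∑ p ∈ antidiagonal n,
      ∑ s ∈ range (r + 1), (r.choose s : ℝ≥0∞) * ((weight ρ (r - s) p.1 * coeff p.1 a) *
        (weight ρ s p.2 * coeff p.2 b)) := by
    intro n
    rw [coeff_mul, mul_sum]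
    refine sum_congr rfl fun p hp => ?_
    rw [← mem_antidiagonal.1 hp, weight_add, sum_mul]
    refine sum_congr rfl fun s _ => ?_
    ring
  simp only [mom_eq, h1]
  rw [tsum_antidiagonal (fun m n => ∑ s ∈ range (r + 1), (r.choose s : ℝ≥0∞) *
    ((weight ρ (r - s) m * coeff m a) * (weight ρ s n * coeff n b)))]
  have h2 : ∀ m, ∑' n, ∑ s ∈ range (r + 1), (r.choose s : ℝ≥0∞) *
      ((weight ρ (r - s) m * coeff m a) * (weight ρ s n * coeff n b)) =
      ∑ s ∈ range (r + 1), (r.choose s : ℝ≥0∞) *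
        ((weight ρ (r - s) m * coeff m a) * ∑' n, (weight ρ s n * coeff n b)) := by
    intro m
    rw [Summable.tsum_finsetSum (fun _ _ => ENNReal.summable)]
    refine sum_congr rfl fun s _ => ?_
    rw [ENNReal.tsum_mul_left, ENNReal.tsum_mul_left]
  simp only [h2]
  rw [Summable.tsum_finsetSum (fun _ _ => ENNReal.summable)]
  refine sum_congr rfl fun s _ => ?_
  rw [ENNReal.tsum_mul_left, ENNReal.tsum_mul_right]

lemma mom_zero_mul (ρ : ℝ) (a b : PowerSeries ℝ≥0∞) :
    mom ρ 0 (a * b) = mom ρ 0 a * mom ρ 0 b := by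
  simp [mom_mul]

lemma mom_zero_one (ρ : ℝ) : mom ρ 0 1 = 1 := by
  rw [mom_eq, tsum_eq_single 0]
  · simp [weight]
  · intro n hn
    simp [coeff_one, hn]

/-- Exponential moments as a homomorphism of semirings. -/
noncomputable def momHom (ρ : ℝ) : PowerSeries ℝ≥0∞ →+* ℝ≥0∞ where
  toFun := mom ρ 0
  map_one' := mom_zero_one ρ
  map_mul' := mom_zero_mul ρ
  map_zero' := mom_zero ρ 0
  map_add' := mom_add ρ 0

lemma mom_eq_zero_iff (ρ : ℝ) (a : PowerSeries ℝ≥0∞) : mom ρ 0 a = 0 ↔ a = 0 := by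
  rw [mom_eq, ENNReal.tsum_eq_zero, PowerSeries.ext_iff]
  refine forall_congr' fun n => ?_
  simp [weight_zero_pos]

lemma mom_mono {ρ ρ' : ℝ} (h : ρ ≤ ρ') (r : ℕ) (a : PowerSeries ℝ≥0∞) :
    mom ρ r a ≤ mom ρ' r a := by
  rw [mom_eq, mom_eq]
  refine ENNReal.tsum_le_tsum fun n => ?_
  unfold weight
  gcongr

/-- Polynomial moments are controlled by exponential moments with a larger exponent. -/
lemma exists_mom_le {ρ ρ' : ℝ} (h : ρ < ρ') (r : ℕ) :
    ∃ C : ℝ≥0, ∀ a : PowerSeries ℝ≥0∞, mom ρ r a ≤ C * mom ρ' 0 a := by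
  -- The constant is a bound of this null sequence, hence independent of the series.
  have hb : Tendsto (fun n : ℕ => (n : ℝ) ^ r * Real.exp (-(ρ' - ρ) * n)) atTop (𝓝 0) := by
    have h1 := tendsto_pow_const_mul_const_pow_of_lt_one r (Real.exp_pos (-(ρ' - ρ))).le
      (by rw [← Real.exp_zero]; exact Real.exp_lt_exp.2 (by linarith))
    refine h1.congr fun n => ?_
    rw [← Real.exp_nat_mul, mul_comm (n : ℝ) (-(ρ' - ρ))]
  obtain ⟨C, hC⟩ := hb.bddAbove_range
  refine ⟨C.toNNReal, fun a => ?_⟩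
  rw [mom_eq, mom_eq, ← ENNReal.tsum_mul_left]
  refine ENNReal.tsum_le_tsum fun n => ?_
  rw [← mul_assoc]
  gcongr
  have h2 : (n : ℝ) ^ r * Real.exp (-(ρ' - ρ) * n) ≤ C := hC ⟨n, rfl⟩
  have hC0 : 0 ≤ C := le_trans (by positivity) h2
  change _ ≤ ENNReal.ofReal C * _
  unfold weight
  rw [← ENNReal.ofReal_mul hC0]
  refine ENNReal.ofReal_le_ofReal ?_
  calc (n : ℝ) ^ r * Real.exp (ρ * n) =
      ((n : ℝ) ^ r * Real.exp (-(ρ' - ρ) * n)) * Real.exp (ρ' * n) := by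
        rw [mul_assoc, ← Real.exp_add]; ring_nf
    _ ≤ C * ((n : ℝ) ^ 0 * Real.exp (ρ' * n)) := by
        rw [pow_zero, one_mul]; gcongr

lemma coeff_ne_top_of_mom {ρ : ℝ} {a : PowerSeries ℝ≥0∞} (h : mom ρ 0 a ≠ ⊤) (n : ℕ) :
    coeff n a ≠ ⊤ := by
  intro hn
  rw [mom_eq] at h
  have := ENNReal.ne_top_of_tsum_ne_top h n
  rw [hn, ENNReal.mul_top (weight_zero_pos ρ n)] at this
  exact this rfl

/-! ### Kernels and resolvents -/

section Resolvent

variable {ι : Type*} [Fintype ι]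

lemma coeff_mulVec (K : Matrix ι ι (PowerSeries ℝ≥0∞)) (B : ι → PowerSeries ℝ≥0∞)
    (i : ι) (n : ℕ) : coeff n ((K *ᵥ B) i) =
      ∑ l, ∑ p ∈ antidiagonal n, coeff p.1 (K i l) * coeff p.2 (B l) := by
  simp [Matrix.mulVec, dotProduct, coeff_mul]

lemma mom_mulVec (ρ : ℝ) (r : ℕ) (K : Matrix ι ι (PowerSeries ℝ≥0∞))
    (B : ι → PowerSeries ℝ≥0∞) (i : ι) : mom ρ r ((K *ᵥ B) i) =
      ∑ l, ∑ s ∈ range (r + 1),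
        (r.choose s : ℝ≥0∞) * (mom ρ (r - s) (K i l) * mom ρ s (B l)) := by
  simp only [Matrix.mulVec, dotProduct, mom_sum, mom_mul]

/-- A kernel without constant term makes the n-th coefficient of K V depend on lower coefficients of
V only. This replaces inverting 1 - K, which is unavailable over [0,∞]. -/
lemma eq_of_eq_add_mulVec {K : Matrix ι ι (PowerSeries ℝ≥0∞)}
    (hK : ∀ i l, coeff 0 (K i l) = 0) {B V W : ι → PowerSeries ℝ≥0∞}
    (hV : V = B + K *ᵥ V) (hW : W = B + K *ᵥ W) : V = W := by
  suffices h : ∀ n i, coeff n (V i) = coeff n (W i) by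
    ext i n; exact h n i
  intro n
  induction n using Nat.strong_induction_on with
  | _ n ih =>
    intro i
    rw [hV, hW, Pi.add_apply, Pi.add_apply, map_add, map_add, coeff_mulVec, coeff_mulVec]
    congr 1
    refine sum_congr rfl fun l _ => sum_congr rfl fun p hp => ?_
    rcases Nat.eq_zero_or_pos p.1 with h0 | h0
    · rw [h0, hK, zero_mul, zero_mul]
    · rw [ih p.2 (by have := HasAntidiagonal.mem_antidiagonal.1 hp; omega)]

variable [DecidableEq ι]

/-- The sum of `K ^ m *ᵥ B` over all `m`. -/
noncomputable def resolvent (K : Matrix ι ι (PowerSeries ℝ≥0∞)) (B : ι → PowerSeries ℝ≥0∞)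
    (i : ι) : PowerSeries ℝ≥0∞ :=
  mk fun n => ∑' m : ℕ, coeff n (((K ^ m) *ᵥ B) i)

lemma coeff_resolvent (K : Matrix ι ι (PowerSeries ℝ≥0∞)) (B : ι → PowerSeries ℝ≥0∞)
    (i : ι) (n : ℕ) : coeff n (resolvent K B i) = ∑' m : ℕ, coeff n (((K ^ m) *ᵥ B) i) := by
  simp [resolvent]

/-- Split off the term m = 0 and pull one factor K out of the others. All renewal equations and
linear systems below are instances. -/
lemma resolvent_eq (K : Matrix ι ι (PowerSeries ℝ≥0∞)) (B : ι → PowerSeries ℝ≥0∞) :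
    resolvent K B = B + K *ᵥ resolvent K B := by
  ext i n
  rw [coeff_resolvent, tsum_eq_zero_add' ENNReal.summable, Pi.add_apply, map_add]
  congr 1
  · simp
  · rw [coeff_mulVec]
    simp only [coeff_resolvent, pow_succ', ← Matrix.mulVec_mulVec]
    simp only [coeff_mulVec K, ← ENNReal.tsum_mul_left]
    rw [Summable.tsum_finsetSum (fun _ _ => ENNReal.summable)]
    refine sum_congr rfl fun l _ => ?_
    rw [Summable.tsum_finsetSum (fun _ _ => ENNReal.summable)]

/-- Being a semiring homomorphism, the moment commutes with matrix powers; the two infinite sums are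
exchanged by Tonelli. -/
lemma mom_resolvent (ρ : ℝ) (K : Matrix ι ι (PowerSeries ℝ≥0∞)) (B : ι → PowerSeries ℝ≥0∞)
    (i : ι) : mom ρ 0 (resolvent K B i) =
      ∑' m : ℕ, ((K.map (mom ρ 0)) ^ m *ᵥ fun l => mom ρ 0 (B l)) i := by
  have h : ∀ m, ((K.map (mom ρ 0)) ^ m *ᵥ fun l => mom ρ 0 (B l)) i =
      mom ρ 0 (((K ^ m) *ᵥ B) i) := by
    intro m
    have h1 : (K.map (mom ρ 0)) ^ m = (K ^ m).map (mom ρ 0) := by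
      have := map_pow (momHom ρ).mapMatrix K m
      exact this.symm
    rw [h1]
    simp only [Matrix.mulVec, dotProduct, Matrix.map_apply, mom_sum, mom_zero_mul]
  simp only [h]
  simp only [mom_eq, coeff_resolvent, ← ENNReal.tsum_mul_left]
  rw [ENNReal.tsum_comm]

end Resolvent

/-! ### Taboo kernels and generating series of a transition law -/

section Kernels

variable {N : ℕ} (T : TransitionLaw N)

/-- Generating series of the transition probabilities. -/
noncomputable def qSeries (i j : Fin (N + 1)) : PowerSeries ℝ≥0∞ :=
  mk fun n => ENNReal.ofReal (T.Q i j n)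

/-- Generating series of the transition probabilities between states other than `0`, where
transitions into `j` are suppressed. -/
noncomputable def tabooKernel (j : Fin (N + 1)) :
    Matrix (Fin (N + 1)) (Fin (N + 1)) (PowerSeries ℝ≥0∞) :=
  Matrix.of fun i l => if i = 0 ∨ l = 0 ∨ l = j then 0 else qSeries T i l

/-- Generating series of the probabilities that the sojourn time in `i` exceeds `n`. -/
noncomputable def survival (i : Fin (N + 1)) : PowerSeries ℝ≥0∞ :=
  mk fun n => ∑' t : ℕ, ∑ l, ENNReal.ofReal (T.Q i l (n + 1 + t))

/-- Generating series of the transitions into `j` from states other than `0`. -/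
noncomputable def entrance (j l : Fin (N + 1)) : PowerSeries ℝ≥0∞ :=
  if l = 0 then 0 else qSeries T l j

/-- Generating series of the sojourn time tails in the state `s`, as a vector. -/
noncomputable def sojourn (s l : Fin (N + 1)) : PowerSeries ℝ≥0∞ :=
  if l = s then survival T s else 0

/-- Generating series of `g_{lj}`. -/
noncomputable def gSeries (j l : Fin (N + 1)) : PowerSeries ℝ≥0∞ :=
  resolvent (tabooKernel T j) (entrance T j) l

/-- Generating series of `h_{ljs}`. -/
noncomputable def hSeries (j s l : Fin (N + 1)) : PowerSeries ℝ≥0∞ :=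
  resolvent (tabooKernel T j) (sojourn T s) l

lemma mom_qSeries (i j : Fin (N + 1)) (ρ : ℝ) (r : ℕ) :
    mom ρ r (qSeries T i j) = T.pMoment i j ρ r := by
  simp [mom, qSeries, TransitionLaw.pMoment]

lemma coeff_zero_qSeries (i j : Fin (N + 1)) : coeff 0 (qSeries T i j) = 0 := by
  simp [qSeries, TransitionLaw.Q, T.f_zero]

lemma coeff_zero_tabooKernel (j i l : Fin (N + 1)) : coeff 0 (tabooKernel T j i l) = 0 := by
  unfold tabooKernel
  rw [Matrix.of_apply]
  split_ifs
  · simp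
  · exact coeff_zero_qSeries T i l

/-- The two kernels differ in the column i only, and that column is `entrance T i`. -/
lemma tabooKernel_zero_eq {i : Fin (N + 1)} (hi : i ≠ 0) (B : Fin (N + 1) → PowerSeries ℝ≥0∞)
    (l : Fin (N + 1)) :
    (tabooKernel T 0 *ᵥ B) l = (tabooKernel T i *ᵥ B) l + entrance T i l * B i := by
  simp only [Matrix.mulVec, dotProduct, tabooKernel, entrance, Matrix.of_apply, or_self]
  have : ∀ x, (if l = 0 ∨ x = 0 then 0 else qSeries T l x) * B x =
      (if l = 0 ∨ x = 0 ∨ x = i then 0 else qSeries T l x) * B x +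
        if x = i then (if l = 0 then 0 else qSeries T l i) * B i else 0 := by
    intro x
    by_cases hx : x = i
    · subst hx
      by_cases hl : l = 0 <;> simp [hl, hi]
    · simp [hx]
  rw [sum_congr rfl fun x _ => this x, sum_add_distrib]
  simp

/-- Decomposition at the first visit to `i`. -/
lemma hSeries_zero_eq {i : Fin (N + 1)} (hi : i ≠ 0) (s l : Fin (N + 1)) :
    hSeries T 0 s l = hSeries T i s l + gSeries T i l * hSeries T 0 s i := by
  have key : hSeries T 0 s = fun l => hSeries T i s l + gSeries T i l * hSeries T 0 s i := by
    -- Both sides solve the equation of the taboo kernel of i, in which the visit to i enters as a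
    -- source term with the fixed factor `hSeries T 0 s i`.
    refine eq_of_eq_add_mulVec (coeff_zero_tabooKernel T i)
      (B := fun l => sojourn T s l + entrance T i l * hSeries T 0 s i) ?_ ?_
    · funext l
      have := congrFun (resolvent_eq (tabooKernel T 0) (sojourn T s)) l
      rw [Pi.add_apply, tabooKernel_zero_eq T hi] at this
      rw [Pi.add_apply, hSeries, hSeries, this]
      unfold hSeries
      ring
    · funext l
      have h1 := congrFun (resolvent_eq (tabooKernel T i) (sojourn T s)) l
      have h2 := congrFun (resolvent_eq (tabooKernel T i) (entrance T i)) l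
      have h3 : (tabooKernel T i *ᵥ fun l => hSeries T i s l + gSeries T i l * hSeries T 0 s i) l =
          (tabooKernel T i *ᵥ hSeries T i s) l
            + (tabooKernel T i *ᵥ gSeries T i) l * hSeries T 0 s i := by
        simp only [Matrix.mulVec, dotProduct, mul_add, sum_add_distrib, sum_mul, mul_assoc]
      rw [Pi.add_apply, h3]
      have h1' : hSeries T i s l = sojourn T s l + (tabooKernel T i *ᵥ hSeries T i s) l := h1
      have h2' : gSeries T i l = entrance T i l + (tabooKernel T i *ᵥ gSeries T i) l := h2
      nth_rw 1 [h1']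
      nth_rw 1 [h2']
      ring
  exact congrFun key l

end Kernels

end QSD

namespace QSD

open PowerSeries Finset

/-! ### Path probabilities of a Markov renewal process -/

namespace MarkovRenewalProcess

variable {N : ℕ} {T : TransitionLaw N} (X : MarkovRenewalProcess.{u} T)

/-- The history up to the `m`-th transition. -/
def history (m : ℕ) (ω : X.Ω) : Fin (m + 1) → Fin (N + 1) × ℕ := fun r => (X.η r ω, X.κ r ω)

/-- The event `A` is determined by the history up to the `m`-th transition. -/
def DeterminedBy (m : ℕ) (A : Set X.Ω) : Prop :=
  ∀ ω ω', (∀ r ≤ m, X.η r ω = X.η r ω' ∧ X.κ r ω = X.κ r ω') → ω ∈ A → ω' ∈ A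

lemma measurable_history (m : ℕ) : Measurable (X.history m) :=
  measurable_pi_lambda _ fun r => (X.measurable_η r).prodMk (X.measurable_κ r)

lemma history_eq_iff (m : ℕ) (ω : X.Ω) (z : Fin (m + 1) → Fin (N + 1) × ℕ) :
    X.history m ω = z ↔ ∀ r : Fin (m + 1), X.η r ω = (z r).1 ∧ X.κ r ω = (z r).2 := by
  simp [history, funext_iff, Prod.ext_iff]

variable {X}

lemma DeterminedBy.preimage_image {m : ℕ} {A : Set X.Ω} (hA : X.DeterminedBy m A) :
    X.history m ⁻¹' (X.history m '' A) = A := by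
  refine Set.Subset.antisymm ?_ (Set.subset_preimage_image _ _)
  rintro ω ⟨ω', hω', h⟩
  refine hA ω' ω (fun r hr => ?_) hω'
  have := congrFun h ⟨r, by omega⟩
  simpa [history, Prod.ext_iff] using this

/-- Histories take values in a countable discrete space, so every preimage under the history map is
measurable. -/
lemma DeterminedBy.measurableSet {m : ℕ} {A : Set X.Ω} (hA : X.DeterminedBy m A) :
    MeasurableSet A := by
  rw [← hA.preimage_image]
  exact X.measurable_history m (Set.to_countable _).measurableSet

/-- The Markov property for events determined by the past. -/
lemma DeterminedBy.measure_inter {m : ℕ} {A : Set X.Ω} (hA : X.DeterminedBy m A)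
    (i l y : Fin (N + 1)) (t : ℕ) (hl : ∀ ω ∈ A, X.η m ω = l) :
    X.P i (A ∩ {ω | X.η (m + 1) ω = y ∧ X.κ (m + 1) ω = t}) =
      X.P i A * ENNReal.ofReal (T.Q l y t) := by
  set S := X.history m '' A with hS
  set E := {ω | X.η (m + 1) ω = y ∧ X.κ (m + 1) ω = t} with hE
  have hEm : MeasurableSet E :=
    (X.measurable_η (m + 1) (measurableSet_singleton y)).inter
      (X.measurable_κ (m + 1) (measurableSet_singleton t))
  have hmeas : ∀ z ∈ S, MeasurableSet (X.history m ⁻¹' {z}) := fun z _ =>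
    X.measurable_history m (measurableSet_singleton z)
  -- The Markov axiom concerns single histories, so A is cut into its countably many atoms.
  have h1 : X.P i A = ∑' z : S, X.P i (X.history m ⁻¹' {(z : Fin (m + 1) → Fin (N + 1) × ℕ)}) := by
    rw [tsum_measure_preimage_singleton (Set.to_countable S) hmeas, hS, hA.preimage_image]
  have h2 : X.P i (A ∩ E) =
      ∑' z : S, X.P i (X.history m ⁻¹' {(z : Fin (m + 1) → Fin (N + 1) × ℕ)} ∩ E) := by
    have := tsum_measure_preimage_singleton (μ := (X.P i).restrict E) (Set.to_countable S) hmeas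
    rw [hS, hA.preimage_image, ← hS, Measure.restrict_apply hA.measurableSet] at this
    rw [← this]
    refine tsum_congr fun z => ?_
    rw [Measure.restrict_apply (hmeas z z.2)]
  rw [h1, h2, ← ENNReal.tsum_mul_right]
  refine tsum_congr fun z => ?_
  obtain ⟨z, ω₀, hω₀, rfl⟩ := z
  -- The axiom is applied to the history of a sample point of the atom, prolonged by (y, t) at the
  -- index m + 1.
  have hmk := X.markov i m (fun r => if r ≤ m then X.η r ω₀ else y)
    (fun r => if r ≤ m then X.κ r ω₀ else t)
  simp only [le_refl, if_true, Nat.not_succ_le_self, if_false] at hmk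
  rw [hl ω₀ hω₀] at hmk
  convert hmk using 2
  · ext ω
    simp only [Set.mem_inter_iff, Set.mem_preimage, Set.mem_singleton_iff, history_eq_iff,
      Set.mem_ofPred_eq, hE]
    constructor
    · rintro ⟨h, hy, ht⟩ r hr
      rcases Nat.lt_or_ge m r with h' | h'
      · obtain rfl : r = m + 1 := by omega
        simp [hy, ht]
      · simpa [h', history] using h ⟨r, by omega⟩
    · intro h
      refine ⟨fun r => ?_, ?_⟩
      · have hr : (r : ℕ) ≤ m := by omega
        simpa [hr, history] using h r (by omega)
      · simpa using h (m + 1) le_rfl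
  · congr 1
    ext ω
    simp only [Set.mem_preimage, Set.mem_singleton_iff, history_eq_iff, Set.mem_ofPred_eq]
    constructor
    · intro h r hr
      simpa [hr, history] using h ⟨r, by omega⟩
    · intro h r
      have hr : (r : ℕ) ≤ m := by omega
      simpa [hr, history] using h r hr

variable (X)

lemma measure_initial (i y : Fin (N + 1)) : X.P i {ω | X.η 0 ω = y} = if i = y then 1 else 0 := by
  split_ifs with h
  · rw [← h]; exact X.initial i
  · have hm : MeasurableSet {ω | X.η 0 ω = i} := X.measurable_η 0 (measurableSet_singleton i)
    refine measure_mono_null (fun ω hω => ?_) ((prob_compl_eq_zero_iff hm).2 (X.initial i))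
    simp only [Set.mem_compl_iff, Set.mem_ofPred_eq] at hω ⊢
    rw [hω]
    exact fun h' => h h'.symm

/-- Up to the `m`-th transition, the chain does not return to `0` or `j`. -/
def Avoids (j : Fin (N + 1)) (m : ℕ) (ω : X.Ω) : Prop :=
  ∀ r, 1 ≤ r → r ≤ m → X.η r ω ≠ 0 ∧ X.η r ω ≠ j

/-- The event that the `m`-th transition leads to `y` at time `t`, without previous visits to
`0` and `j`. -/
def pathEvent (j : Fin (N + 1)) (m : ℕ) (y : Fin (N + 1)) (t : ℕ) : Set X.Ω :=
  {ω | X.Avoids j m ω ∧ X.η m ω = y ∧ X.τ m ω = t}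

lemma τ_succ (m : ℕ) (ω : X.Ω) : X.τ (m + 1) ω = X.τ m ω + X.κ (m + 1) ω := by
  simp [τ, sum_range_succ]

lemma τ_strictMono (ω : X.Ω) : StrictMono fun m => X.τ m ω := by
  refine strictMono_nat_of_lt_succ fun m => ?_
  rw [τ_succ]
  have := X.one_le_κ (m + 1) ω
  omega

lemma determinedBy_pathEvent (j : Fin (N + 1)) (m : ℕ) (y : Fin (N + 1)) (t : ℕ) :
    X.DeterminedBy m (X.pathEvent j m y t) := by
  rintro ω ω' h ⟨h1, h2, h3⟩
  refine ⟨fun r hr hr' => ?_, ?_, ?_⟩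
  · rw [← (h r hr').1]; exact h1 r hr hr'
  · rw [← (h m le_rfl).1, h2]
  · rw [← h3]
    refine sum_congr rfl fun r hr => ?_
    rw [Finset.mem_range] at hr
    exact ((h (r + 1) hr).2).symm

lemma measurableSet_step (j y : Fin (N + 1)) (t m : ℕ) :
    MeasurableSet {ω | X.Avoids j m ω ∧ X.η (m + 1) ω = y ∧ X.τ (m + 1) ω = t} := by
  refine DeterminedBy.measurableSet (m := m + 1) ?_
  rintro ω ω' h ⟨h1, h2, h3⟩
  refine ⟨fun r hr hr' => ?_, ?_, ?_⟩
  · rw [← (h r (by omega)).1]; exact h1 r hr hr'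
  · rw [← (h (m + 1) le_rfl).1, h2]
  · rw [← h3]
    refine sum_congr rfl fun r hr => ?_
    rw [Finset.mem_range] at hr
    exact ((h (r + 1) hr).2).symm

lemma measurableSet_occupation (j s : Fin (N + 1)) (n m : ℕ) :
    MeasurableSet {ω | X.Avoids j m ω ∧ X.η m ω = s ∧ X.τ m ω ≤ n ∧ n < X.τ (m + 1) ω} := by
  refine DeterminedBy.measurableSet (m := m + 1) ?_
  rintro ω ω' h ⟨h1, h2, h3⟩
  have hτ : ∀ q ≤ m + 1, X.τ q ω = X.τ q ω' := fun q hq => by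
    refine sum_congr rfl fun r hr => ?_
    rw [Finset.mem_range] at hr
    exact (h (r + 1) (by omega)).2
  refine ⟨fun r hr hr' => ?_, ?_, ?_⟩
  · rw [← (h r (by omega)).1]; exact h1 r hr hr'
  · rw [← (h m (by omega)).1, h2]
  · rwa [← hτ m (by omega), ← hτ (m + 1) le_rfl]

/-- Condition on the state and the time before the last transition. The target y is unrestricted, so
the formula serves both for continuing a taboo path and for hitting j. -/
lemma measure_step (i j y : Fin (N + 1)) (m t : ℕ) :
    X.P i {ω | X.Avoids j m ω ∧ X.η (m + 1) ω = y ∧ X.τ (m + 1) ω = t} =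
      ∑ l, ∑ p ∈ antidiagonal t,
        X.P i (X.pathEvent j m l p.1) * ENNReal.ofReal (T.Q l y p.2) := by
  have hset : {ω | X.Avoids j m ω ∧ X.η (m + 1) ω = y ∧ X.τ (m + 1) ω = t} =
      ⋃ lp ∈ (univ : Finset (Fin (N + 1))) ×ˢ antidiagonal t,
        (X.pathEvent j m lp.1 lp.2.1 ∩ {ω | X.η (m + 1) ω = y ∧ X.κ (m + 1) ω = lp.2.2}) := by
    ext ω
    simp only [Set.mem_ofPred_eq, Set.mem_iUnion, Set.mem_inter_iff, Finset.mem_product,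
      Finset.mem_univ, true_and, HasAntidiagonal.mem_antidiagonal, pathEvent, τ_succ]
    constructor
    · rintro ⟨h1, h2, h3⟩
      exact ⟨(X.η m ω, X.τ m ω, X.κ (m + 1) ω), h3, ⟨h1, rfl, rfl⟩, h2, rfl⟩
    · rintro ⟨⟨l, a, b⟩, hab, ⟨h1, h2, h3⟩, h4, h5⟩
      exact ⟨h1, h4, by simp only at hab h3 h5; omega⟩
  rw [hset, measure_biUnion_finset, Finset.sum_product]
  · refine sum_congr rfl fun l _ => sum_congr rfl fun p _ => ?_
    exact (X.determinedBy_pathEvent j m l p.1).measure_inter i l y p.2 fun ω hω => hω.2.1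
  · rintro ⟨l, a, b⟩ - ⟨l', a', b'⟩ - hne
    refine Set.disjoint_left.2 ?_
    rintro ω ⟨⟨h1, h2, h3⟩, h4, h5⟩ ⟨⟨h1', h2', h3'⟩, h4', h5'⟩
    simp only at *
    exact hne (by rw [← h2, ← h3, ← h5, h2', h3', h5'])
  · intro lp _
    refine (X.determinedBy_pathEvent j m _ _).measurableSet.inter ?_
    exact (X.measurable_η (m + 1) (measurableSet_singleton y)).inter
      (X.measurable_κ (m + 1) (measurableSet_singleton _))

/-- The kernel discards transitions out of 0, whereas Q does not. The discrepancy is harmless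
because paths started at i ≠ 0 never contribute at the state 0. -/
lemma _root_.QSD.tabooKernel_pow_apply_zero (T : TransitionLaw N) {i : Fin (N + 1)} (hi : i ≠ 0)
    (j : Fin (N + 1)) (m : ℕ) : (tabooKernel T j ^ m) i 0 = 0 := by
  cases m with
  | zero => simp [hi]
  | succ m => simp [pow_succ, Matrix.mul_apply, tabooKernel]

/-- Each transition multiplies by the kernel, the product of power series being the convolution of
the times. If y is 0 or j and m ≥ 1, both sides vanish. -/
lemma measure_pathEvent {i : Fin (N + 1)} (hi : i ≠ 0) (j : Fin (N + 1)) (m : ℕ)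
    (y : Fin (N + 1)) (t : ℕ) :
    X.P i (X.pathEvent j m y t) = coeff t ((tabooKernel T j ^ m) i y) := by
  induction m generalizing y t with
  | zero =>
    by_cases ht : t = 0
    · subst ht
      have : X.pathEvent j 0 y 0 = {ω | X.η 0 ω = y} := by
        ext ω
        simp only [pathEvent, Avoids, τ, Set.mem_ofPred_eq, range_zero, sum_empty, and_true,
          and_iff_right_iff_imp]
        intros; omega
      rw [this, measure_initial, pow_zero, Matrix.one_apply]
      split_ifs <;> simp
    · have : X.pathEvent j 0 y t = ∅ := by
        ext ω
        simp [pathEvent, τ, Ne.symm ht]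
      rw [this, measure_empty, pow_zero, Matrix.one_apply]
      split_ifs <;> simp [coeff_one, ht]
  | succ m ih =>
    by_cases hy : y = 0 ∨ y = j
    · have h1 : X.pathEvent j (m + 1) y t = ∅ := by
        ext ω
        simp only [pathEvent, Set.mem_ofPred_eq, Set.mem_empty_iff_false, iff_false]
        rintro ⟨h1, h2, -⟩
        have := h1 (m + 1) (by omega) le_rfl
        rw [h2] at this
        tauto
      rw [h1, measure_empty, pow_succ, Matrix.mul_apply, sum_eq_zero, map_zero]
      intro l _
      simp [tabooKernel, hy]
    · have h1 : X.pathEvent j (m + 1) y t =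
          {ω | X.Avoids j m ω ∧ X.η (m + 1) ω = y ∧ X.τ (m + 1) ω = t} := by
        ext ω
        simp only [pathEvent, Set.mem_ofPred_eq, and_congr_left_iff, and_imp]
        intro h2 _
        constructor
        · exact fun h r hr hr' => h r hr (by omega)
        · intro h r hr hr'
          rcases Nat.lt_or_ge m r with h' | h'
          · obtain rfl : r = m + 1 := by omega
            rw [h2]; tauto
          · exact h r hr h'
      rw [h1, measure_step, pow_succ, Matrix.mul_apply, map_sum]
      refine sum_congr rfl fun l _ => ?_
      rw [coeff_mul]
      refine sum_congr rfl fun p _ => ?_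
      rw [ih]
      by_cases hl : l = 0
      · rw [hl, tabooKernel_pow_apply_zero T hi]; simp
      · congr 1
        simp [tabooKernel, hl, hy, qSeries]

/-! ### Hitting times -/

lemma lt_ν_iff (j : Fin (N + 1)) (m : ℕ) (ω : X.Ω) :
    (m : ℕ∞) < X.ν j ω ↔ ∀ r, 1 ≤ r → r ≤ m → X.η r ω ≠ j := by
  constructor
  · intro h r hr hrm hj
    have : X.ν j ω ≤ (r : ℕ∞) := sInf_le ⟨r, rfl, hr, hj⟩
    exact absurd (lt_of_lt_of_le h this) (by simpa using hrm)
  · intro h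
    rw [← ENat.add_one_le_iff (ENat.natCast_ne_top m)]
    refine le_sInf ?_
    rintro _ ⟨n, rfl, hn, hj⟩
    by_contra hlt
    have hlt' : n ≤ m := by
      have : n < m + 1 := by exact_mod_cast not_le.1 hlt
      omega
    exact h n hn hlt' hj

lemma ν_eq_iff (j : Fin (N + 1)) (m : ℕ) (ω : X.Ω) :
    X.ν j ω = ((m + 1 : ℕ) : ℕ∞) ↔
      X.η (m + 1) ω = j ∧ ∀ r, 1 ≤ r → r ≤ m → X.η r ω ≠ j := by
  have h0 : X.ν j ω = ((m + 1 : ℕ) : ℕ∞) ↔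
      (m : ℕ∞) < X.ν j ω ∧ ¬ ((m + 1 : ℕ) : ℕ∞) < X.ν j ω := by
    rw [not_lt, ← ENat.add_one_le_iff (ENat.natCast_ne_top m)]
    push_cast
    exact ⟨fun h => ⟨h.ge, h.le⟩, fun h => le_antisymm h.2 h.1⟩
  rw [h0, lt_ν_iff, lt_ν_iff]
  constructor
  · rintro ⟨h1, h2⟩
    refine ⟨?_, h1⟩
    by_contra h3
    refine h2 fun r hr hr' => ?_
    rcases Nat.lt_or_ge m r with h' | h'
    · obtain rfl : r = m + 1 := by omega
      exact h3
    · exact h1 r hr h'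
  · rintro ⟨h1, h2⟩
    exact ⟨h2, fun h => h (m + 1) (by omega) le_rfl h1⟩

lemma exists_ν_eq {j : Fin (N + 1)} {ω : X.Ω} (h : X.ν j ω ≠ ⊤) :
    ∃ m : ℕ, X.ν j ω = ((m + 1 : ℕ) : ℕ∞) := by
  obtain ⟨n, hn⟩ := ENat.ne_top_iff_exists.1 h
  have h0 : ((0 : ℕ) : ℕ∞) < X.ν j ω := (X.lt_ν_iff j 0 ω).2 fun r hr hr' => by omega
  rw [← hn] at h0
  have : 0 < n := by exact_mod_cast h0
  exact ⟨n - 1, by rw [← hn]; congr 1; omega⟩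

lemma μ_eq {j : Fin (N + 1)} {ω : X.Ω} {m : ℕ} (h : X.ν j ω = (m : ℕ∞)) :
    X.μ j ω = (X.τ m ω : ℕ∞) := by
  unfold μ
  rw [if_neg (by rw [h]; exact ENat.natCast_ne_top m), h, ENat.toNat_natCast]

/-- Transition times increase strictly, so the first visit decides. The right-hand side removes the
case distinction on an infinite hitting time. -/
lemma lt_μ_iff (j : Fin (N + 1)) (n : ℕ) (ω : X.Ω) :
    (n : ℕ∞) < X.μ j ω ↔ ∀ r, 1 ≤ r → X.η r ω = j → n < X.τ r ω := by
  by_cases h : X.ν j ω = ⊤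
  · simp only [μ, h, if_true, ENat.natCast_lt_top, true_iff]
    intro r hr hj
    have : (r : ℕ∞) < X.ν j ω := by rw [h]; exact ENat.natCast_lt_top r
    exact absurd hj ((X.lt_ν_iff j r ω).1 this r hr le_rfl)
  · obtain ⟨m, hm⟩ := X.exists_ν_eq h
    rw [X.μ_eq hm]
    have hm' := (X.ν_eq_iff j m ω).1 hm
    constructor
    · intro hn r hr hj
      have hn' : n < X.τ (m + 1) ω := by exact_mod_cast hn
      refine lt_of_lt_of_le hn' ((X.τ_strictMono ω).monotone ?_)
      by_contra hlt
      exact hm'.2 r hr (by omega) hj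
    · intro hn
      exact_mod_cast hn (m + 1) (by omega) hm'.1

/-- Here m + 1 is the number of transitions up to the hit, and the events for distinct m are
disjoint. For j = 0 the left side could never hold. -/
lemma hit_iff {j : Fin (N + 1)} (hj : j ≠ 0) (n : ℕ) (ω : X.Ω) :
    (X.μ j ω = n ∧ X.ν j ω < X.ν 0 ω) ↔
      ∃ m, X.Avoids j m ω ∧ X.η (m + 1) ω = j ∧ X.τ (m + 1) ω = n := by
  constructor
  · rintro ⟨h1, h2⟩
    obtain ⟨m, hm⟩ := X.exists_ν_eq (ne_top_of_lt h2)
    rw [X.μ_eq hm] at h1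
    have hm' := (X.ν_eq_iff j m ω).1 hm
    rw [hm, lt_ν_iff] at h2
    exact ⟨m, fun r hr hr' => ⟨h2 r hr (by omega), hm'.2 r hr hr'⟩, hm'.1, by exact_mod_cast h1⟩
  · rintro ⟨m, h1, h2, h3⟩
    have hm := (X.ν_eq_iff j m ω).2 ⟨h2, fun r hr hr' => (h1 r hr hr').2⟩
    rw [X.μ_eq hm, hm, lt_ν_iff, h3]
    refine ⟨rfl, fun r hr hr' => ?_⟩
    rcases Nat.lt_or_ge m r with h' | h'
    · obtain rfl : r = m + 1 := by omega
      rw [h2]; exact hj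
    · exact (h1 r hr h').1

lemma g_eq {i j : Fin (N + 1)} (hi : i ≠ 0) (hj : j ≠ 0) (n : ℕ) :
    X.g i j n = coeff n (gSeries T j i) := by
  have hset : {ω | X.μ j ω = n ∧ X.ν j ω < X.ν 0 ω} =
      ⋃ m, {ω | X.Avoids j m ω ∧ X.η (m + 1) ω = j ∧ X.τ (m + 1) ω = n} := by
    ext ω
    rw [Set.mem_iUnion]
    exact X.hit_iff hj n ω
  unfold g gSeries
  rw [hset, measure_iUnion, coeff_resolvent]
  · refine tsum_congr fun m => ?_
    rw [measure_step, coeff_mulVec]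
    refine sum_congr rfl fun l _ => sum_congr rfl fun p _ => ?_
    rw [X.measure_pathEvent hi]
    by_cases hl : l = 0
    · rw [hl, tabooKernel_pow_apply_zero T hi]; simp
    · simp [entrance, hl, qSeries]
  · intro m m' hne
    refine Set.disjoint_left.2 ?_
    rintro ω ⟨-, -, h3⟩ ⟨-, -, h3'⟩
    have := (X.τ_strictMono ω).injective (h3.trans h3'.symm)
    exact hne (by omega)
  · exact X.measurableSet_step j j n

lemma ξ_eq_iff (n m : ℕ) (ω : X.Ω) :
    Nat.findGreatest (fun m => X.τ m ω ≤ n) n = m ↔ X.τ m ω ≤ n ∧ n < X.τ (m + 1) ω := by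
  have hle : ∀ m, m ≤ X.τ m ω := fun m => (X.τ_strictMono ω).le_apply
  rw [Nat.findGreatest_eq_iff]
  constructor
  · rintro ⟨h1, h2, h3⟩
    constructor
    · by_cases hm : m = 0
      · subst hm; simp [τ]
      · exact h2 hm
    · by_contra hlt
      have h4 := hle (m + 1)
      exact h3 (n := m + 1) (by omega) (by omega) (by omega)
  · rintro ⟨h1, h2⟩
    refine ⟨(hle m).trans h1, fun _ => h1, fun {r} hr _ h => ?_⟩
    have : X.τ (m + 1) ω ≤ X.τ r ω := (X.τ_strictMono ω).monotone hr
    omega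

/-- The index m is the number of transitions up to time n. The choice j = 0 is allowed and describes
plain survival. -/
lemma occupation_iff (j s : Fin (N + 1)) (n : ℕ) (ω : X.Ω) :
    (X.ξ n ω = s ∧ (n : ℕ∞) < min (X.μ 0 ω) (X.μ j ω)) ↔
      ∃ m, X.Avoids j m ω ∧ X.η m ω = s ∧ X.τ m ω ≤ n ∧ n < X.τ (m + 1) ω := by
  rw [lt_min_iff, lt_μ_iff, lt_μ_iff]
  constructor
  · rintro ⟨h1, h2, h3⟩
    obtain ⟨h4, h5⟩ := (X.ξ_eq_iff n _ ω).1 rfl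
    refine ⟨_, fun r hr hr' => ⟨fun h => ?_, fun h => ?_⟩, h1, h4, h5⟩
    · have := h2 r hr h
      have := (X.τ_strictMono ω).monotone hr'
      omega
    · have := h3 r hr h
      have := (X.τ_strictMono ω).monotone hr'
      omega
  · rintro ⟨m, h1, h2, h3, h4⟩
    have key : ∀ r, m < r → n < X.τ r ω := fun r hr =>
      lt_of_lt_of_le h4 ((X.τ_strictMono ω).monotone hr)
    refine ⟨?_, fun r hr h => ?_, fun r hr h => ?_⟩
    · unfold ξ
      rw [(X.ξ_eq_iff n m ω).2 ⟨h3, h4⟩, h2]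
    · refine key r ?_
      by_contra hlt
      exact (h1 r hr (by omega)).1 h
    · refine key r ?_
      by_contra hlt
      exact (h1 r hr (by omega)).2 h

/-- The tail event of the next sojourn time is a countable disjoint union over its value and the
next state, to each of which the Markov property applies. -/
lemma measure_path_survival (i j s : Fin (N + 1)) (m a b : ℕ) :
    X.P i (X.pathEvent j m s a ∩ {ω | b < X.κ (m + 1) ω}) =
      X.P i (X.pathEvent j m s a) * coeff b (survival T s) := by
  have hset : X.pathEvent j m s a ∩ {ω | b < X.κ (m + 1) ω} = ⋃ ty : ℕ × Fin (N + 1),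
      (X.pathEvent j m s a ∩ {ω | X.η (m + 1) ω = ty.2 ∧ X.κ (m + 1) ω = b + 1 + ty.1}) := by
    ext ω
    simp only [Set.mem_inter_iff, Set.mem_iUnion, Set.mem_ofPred_eq, Prod.exists,
      exists_and_left, and_congr_right_iff]
    intro _
    constructor
    · intro h
      exact ⟨X.κ (m + 1) ω - (b + 1), X.η (m + 1) ω, rfl, by omega⟩
    · rintro ⟨t, y, -, h⟩
      omega
  have hE : ∀ ty : ℕ × Fin (N + 1),
      MeasurableSet {ω | X.η (m + 1) ω = ty.2 ∧ X.κ (m + 1) ω = b + 1 + ty.1} := fun ty =>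
    (X.measurable_η (m + 1) (measurableSet_singleton _)).inter
      (X.measurable_κ (m + 1) (measurableSet_singleton _))
  rw [hset, measure_iUnion, survival, coeff_mk, ← ENNReal.tsum_mul_left, ENNReal.tsum_prod']
  · refine tsum_congr fun t => ?_
    rw [tsum_fintype, mul_sum]
    refine sum_congr rfl fun y _ => ?_
    exact (X.determinedBy_pathEvent j m s a).measure_inter i s y _ fun ω hω => hω.2.1
  · rintro ⟨t, y⟩ ⟨t', y'⟩ hne
    refine Set.disjoint_left.2 ?_
    rintro ω ⟨-, h1, h2⟩ ⟨-, h1', h2'⟩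
    simp only at *
    exact hne (by rw [← h1, ← h1']; congr 1; omega)
  · exact fun ty => (X.determinedBy_pathEvent j m s a).measurableSet.inter (hE ty)

lemma measure_occupation (i j s : Fin (N + 1)) (m n : ℕ) :
    X.P i {ω | X.Avoids j m ω ∧ X.η m ω = s ∧ X.τ m ω ≤ n ∧ n < X.τ (m + 1) ω} =
      ∑ p ∈ antidiagonal n, X.P i (X.pathEvent j m s p.1) * coeff p.2 (survival T s) := by
  have hset : {ω | X.Avoids j m ω ∧ X.η m ω = s ∧ X.τ m ω ≤ n ∧ n < X.τ (m + 1) ω} =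
      ⋃ p ∈ antidiagonal n, (X.pathEvent j m s p.1 ∩ {ω | p.2 < X.κ (m + 1) ω}) := by
    ext ω
    simp only [Set.mem_ofPred_eq, Set.mem_iUnion, Set.mem_inter_iff,
      HasAntidiagonal.mem_antidiagonal, pathEvent, τ_succ]
    constructor
    · rintro ⟨h1, h2, h3, h4⟩
      exact ⟨(X.τ m ω, n - X.τ m ω), by simp only; omega, ⟨h1, h2, rfl⟩, by simp only; omega⟩
    · rintro ⟨⟨a, b⟩, hab, ⟨h1, h2, h3⟩, h4⟩
      simp only at *
      exact ⟨h1, h2, by omega, by omega⟩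
  rw [hset, measure_biUnion_finset]
  · exact sum_congr rfl fun p _ => X.measure_path_survival i j s m p.1 p.2
  · rintro ⟨a, b⟩ hab ⟨a', b'⟩ hab' hne
    refine Set.disjoint_left.2 ?_
    rintro ω ⟨⟨-, -, h3⟩, -⟩ ⟨⟨-, -, h3'⟩, -⟩
    simp only [Finset.mem_coe, HasAntidiagonal.mem_antidiagonal] at *
    refine hne ?_
    rw [Prod.mk.injEq]
    omega
  · intro p _
    exact (X.determinedBy_pathEvent j m s p.1).measurableSet.inter
      (X.measurable_κ (m + 1) measurableSet_Ioi)

lemma h_eq {i : Fin (N + 1)} (hi : i ≠ 0) (j s : Fin (N + 1)) (n : ℕ) :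
    X.h i j s n = coeff n (hSeries T j s i) := by
  have hset : {ω | X.ξ n ω = s ∧ (n : ℕ∞) < min (X.μ 0 ω) (X.μ j ω)} =
      ⋃ m, {ω | X.Avoids j m ω ∧ X.η m ω = s ∧ X.τ m ω ≤ n ∧ n < X.τ (m + 1) ω} := by
    ext ω
    rw [Set.mem_iUnion]
    exact X.occupation_iff j s n ω
  unfold h hSeries
  rw [hset, measure_iUnion, coeff_resolvent]
  · refine tsum_congr fun m => ?_
    rw [measure_occupation, coeff_mulVec, sum_eq_single s]
    · refine sum_congr rfl fun p _ => ?_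
      rw [X.measure_pathEvent hi]
      simp [sojourn]
    · intro l _ hl
      simp [sojourn, hl]
    · simp
  · intro m m' hne
    refine Set.disjoint_left.2 ?_
    rintro ω ⟨-, -, h3⟩ ⟨-, -, h3'⟩
    exact hne (((X.ξ_eq_iff n m ω).2 h3).symm.trans ((X.ξ_eq_iff n m' ω).2 h3'))
  · exact X.measurableSet_occupation j s n

lemma φ_eq {i j : Fin (N + 1)} (hi : i ≠ 0) (hj : j ≠ 0) (ρ : ℝ) (r : ℕ) :
    X.φ i j ρ r = mom ρ r (gSeries T j i) := by
  unfold φ mom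
  congr 1
  funext n
  exact X.g_eq hi hj n

lemma omega_eq {i : Fin (N + 1)} (hi : i ≠ 0) (j s : Fin (N + 1)) (ρ : ℝ) (r : ℕ) :
    X.omega i j s ρ r = mom ρ r (hSeries T j s i) := by
  unfold omega mom
  congr 1
  funext n
  exact X.h_eq hi j s n

lemma gSeries_ne_zero_of_gTotal_pos {i j : Fin (N + 1)} (hi : i ≠ 0) (hj : j ≠ 0)
    (h : 0 < X.gTotal i j) : gSeries T j i ≠ 0 := by
  intro h0
  refine h.ne' (measure_mono_null (t := ⋃ n : ℕ, {ω | X.μ j ω = n ∧ X.ν j ω < X.ν 0 ω}) ?_ ?_)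
  · intro ω hω
    obtain ⟨m, hm⟩ := X.exists_ν_eq (ne_top_of_lt (Set.mem_ofPred.1 hω))
    exact Set.mem_iUnion.2 ⟨X.τ (m + 1) ω, X.μ_eq hm, hω⟩
  · refine measure_iUnion_null fun n => ?_
    have := X.g_eq hi hj n
    rw [h0, map_zero] at this
    exact this

/-- A sum of probabilities of disjoint events. This puts the root of the characteristic equation at
a non-negative exponent. -/
lemma mom_gSeries_zero_le_one (X : MarkovRenewalProcess.{u} T) {i j : Fin (N + 1)} (hi : i ≠ 0) (hj : j ≠ 0) :
    mom 0 0 (gSeries T j i) ≤ 1 := by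
  have hm : ∀ n : ℕ, MeasurableSet {ω | X.μ j ω = n ∧ X.ν j ω < X.ν 0 ω} := by
    intro n
    have : {ω | X.μ j ω = n ∧ X.ν j ω < X.ν 0 ω} =
        ⋃ m, ({ω | X.Avoids j m ω ∧ X.η (m + 1) ω = j ∧ X.τ (m + 1) ω = n}) := by
      ext ω
      rw [Set.mem_iUnion]
      exact X.hit_iff hj n ω
    rw [this]
    exact MeasurableSet.iUnion (X.measurableSet_step j j n)
  have h1 : mom 0 0 (gSeries T j i) = ∑' n : ℕ, X.P i {ω | X.μ j ω = n ∧ X.ν j ω < X.ν 0 ω} := by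
    rw [mom_eq]
    refine tsum_congr fun n => ?_
    rw [← X.g_eq hi hj n]
    simp [weight, g]
  rw [h1, ← measure_iUnion]
  · exact prob_le_one
  · intro n n' hne
    refine Set.disjoint_left.2 ?_
    rintro ω ⟨h, -⟩ ⟨h', -⟩
    exact hne (by exact_mod_cast h.symm.trans h')
  · exact hm

end MarkovRenewalProcess

end QSD

namespace QSD

open PowerSeries Finset

/-! ### Green functions of matrices with extended non-negative entries -/

section Green

variable {ι : Type*} [Fintype ι] [DecidableEq ι]

/-- The Green function of a matrix. -/
noncomputable def green (K : Matrix ι ι ℝ≥0∞) (l l' : ι) : ℝ≥0∞ := ∑' m : ℕ, (K ^ m) l l'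

lemma green_eq_left (K : Matrix ι ι ℝ≥0∞) (l l' : ι) :
    green K l l' = (1 : Matrix ι ι ℝ≥0∞) l l' + ∑ a, K l a * green K a l' := by
  unfold green
  rw [tsum_eq_zero_add' ENNReal.summable, pow_zero]
  congr 1
  simp only [pow_succ', Matrix.mul_apply, ← ENNReal.tsum_mul_left]
  rw [Summable.tsum_finsetSum (fun _ _ => ENNReal.summable)]

lemma green_eq_right (K : Matrix ι ι ℝ≥0∞) (l l' : ι) :
    green K l l' = (1 : Matrix ι ι ℝ≥0∞) l l' + ∑ a, green K l a * K a l' := by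
  unfold green
  rw [tsum_eq_zero_add' ENNReal.summable, pow_zero]
  congr 1
  simp only [pow_succ, Matrix.mul_apply, ← ENNReal.tsum_mul_right]
  rw [Summable.tsum_finsetSum (fun _ _ => ENNReal.summable)]

lemma tsum_pow_mulVec (K : Matrix ι ι ℝ≥0∞) (v : ι → ℝ≥0∞) (l : ι) :
    ∑' m : ℕ, (K ^ m *ᵥ v) l = ∑ a, green K l a * v a := by
  simp only [Matrix.mulVec, dotProduct, green, ← ENNReal.tsum_mul_right]
  rw [Summable.tsum_finsetSum (fun _ _ => ENNReal.summable)]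

/-- A strictly superharmonic vector bounds the Green function. -/
lemma green_le_of_superharmonic {K : Matrix ι ι ℝ≥0∞} {v : ι → ℝ≥0∞} {c : ℝ≥0∞}
    (h : ∀ l, c + (K *ᵥ v) l ≤ v l) (l l' : ι) : c * green K l l' ≤ v l := by
  have key : ∀ n l, c * ∑ m ∈ range n, (K ^ m) l l' ≤ v l := by
    intro n
    induction n with
    | zero => simp
    | succ n ih =>
      intro l
      refine le_trans ?_ (h l)
      rw [sum_range_succ', mul_add, add_comm, pow_zero]
      refine add_le_add ?_ ?_
      · rw [Matrix.one_apply]; split_ifs <;> simp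
      · simp only [pow_succ', Matrix.mul_apply, Matrix.mulVec, dotProduct]
        rw [sum_comm, mul_sum]
        refine sum_le_sum fun a _ => ?_
        rw [← mul_sum, mul_left_comm]
        gcongr
        exact ih a
  unfold green
  rw [← ENNReal.tsum_mul_left]
  refine ENNReal.tsum_le_of_sum_range_le fun n => ?_
  rw [← mul_sum]
  exact key n l

/-- Substitute the equation for y into itself n times. -/
lemma vecMul_iterate {K : Matrix ι ι ℝ≥0∞} {y : ι → ℝ≥0∞} {i : ι}
    (hy : ∀ l, y l = (if l = i then y i else 0) + ∑ a, y a * K a l) (n : ℕ) (l : ι) :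
    y l = y i * ∑ m ∈ range n, (K ^ m) i l + ∑ a, y a * (K ^ n) a l := by
  induction n generalizing l with
  | zero => simp [Matrix.one_apply]
  | succ n ih =>
    have h1 : ∑ a, y a * (K ^ n) a l = y i * (K ^ n) i l + ∑ a, y a * (K ^ (n + 1)) a l := by
      conv_lhs => rw [sum_congr rfl fun a _ => by rw [hy a]]
      simp only [add_mul, sum_add_distrib, ite_mul, zero_mul, sum_ite_eq', mem_univ, if_true]
      congr 1
      simp only [pow_succ', Matrix.mul_apply, mul_sum, sum_mul]
      rw [sum_comm]
      simp only [mul_assoc]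
    rw [ih l, h1, sum_range_succ, mul_add, add_assoc]

/-- Minimality of the Green function: drop the non-negative remainder y K^n. -/
lemma mul_green_le {K : Matrix ι ι ℝ≥0∞} {y : ι → ℝ≥0∞} {i : ι}
    (hy : ∀ l, y l = (if l = i then y i else 0) + ∑ a, y a * K a l) (l : ι) :
    y i * green K i l ≤ y l := by
  unfold green
  rw [← ENNReal.tsum_mul_left]
  refine ENNReal.tsum_le_of_sum_range_le fun n => ?_
  rw [← mul_sum, vecMul_iterate hy n l]
  exact le_self_add

/-- With a finite Green function the powers K^n tend to zero, so the remainder y K^n disappears and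
minimality becomes equality. -/
lemma eq_mul_green {K : Matrix ι ι ℝ≥0∞} {y : ι → ℝ≥0∞} {i : ι}
    (hy : ∀ l, y l = (if l = i then y i else 0) + ∑ a, y a * K a l)
    (hfin : ∀ l, y l ≠ ⊤) (hK : ∀ l l', green K l l' ≠ ⊤) (l : ι) :
    y l = y i * green K i l := by
  have h1 : Tendsto (fun n => y i * ∑ m ∈ range n, (K ^ m) i l) atTop
      (𝓝 (y i * green K i l)) :=
    ENNReal.Tendsto.const_mul (ENNReal.tendsto_nat_tsum _) (Or.inr (hfin i))
  have h2 : Tendsto (fun n => ∑ a, y a * (K ^ n) a l) atTop (𝓝 (∑ a : ι, y a * 0)) := by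
    refine tendsto_finsetSum _ fun a _ => ?_
    exact ENNReal.Tendsto.const_mul (ENNReal.tendsto_atTop_zero_of_tsum_ne_top (hK a l))
      (Or.inr (hfin a))
  have h3 := h1.add h2
  simp only [mul_zero, sum_const_zero, add_zero] at h3
  refine tendsto_nhds_unique (tendsto_const_nhds.congr fun n => ?_) h3
  exact vecMul_iterate hy n l

/-- If enough paths have positive weight, the Green function is finite as soon as one
of its combinations is finite. -/
lemma green_ne_top {K : Matrix ι ι ℝ≥0∞} {v : ι → ℝ≥0∞} {i l l' : ι} {a b : ℕ}
    (ha : (K ^ a) i l ≠ 0) (hb : (K ^ b *ᵥ v) l' ≠ 0)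
    (hfin : ∑' m : ℕ, (K ^ m *ᵥ v) i ≠ ⊤) : green K l l' ≠ ⊤ := by
  -- Concatenate a path from i to l, a path of m steps from l to l', and a path leading from l' to
  -- v. Distinct m give distinct lengths, so the sum over m stays below the finite total.
  have hle : ∀ m, (K ^ a) i l * ((K ^ m) l l' * (K ^ b *ᵥ v) l') ≤
      (K ^ (m + (a + b)) *ᵥ v) i := by
    intro m
    have : K ^ (m + (a + b)) *ᵥ v = K ^ a *ᵥ (K ^ m *ᵥ (K ^ b *ᵥ v)) := by
      rw [Matrix.mulVec_mulVec, Matrix.mulVec_mulVec, ← pow_add, ← pow_add]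
      congr 2; ring
    rw [this]
    calc _ ≤ (K ^ a) i l * (K ^ m *ᵥ (K ^ b *ᵥ v)) l := by
          gcongr
          exact single_le_sum (f := fun x => (K ^ m) l x * (K ^ b *ᵥ v) x)
            (fun _ _ => zero_le) (mem_univ l')
      _ ≤ _ := single_le_sum (f := fun x => (K ^ a) i x * (K ^ m *ᵥ (K ^ b *ᵥ v)) x)
            (fun _ _ => zero_le) (mem_univ l)
  have h1 : (K ^ a) i l * (green K l l' * (K ^ b *ᵥ v) l') ≤ ∑' m : ℕ, (K ^ m *ᵥ v) i := by
    unfold green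
    rw [← ENNReal.tsum_mul_right, ← ENNReal.tsum_mul_left]
    refine (ENNReal.tsum_le_tsum hle).trans ?_
    exact ENNReal.tsum_comp_le_tsum_of_injective (add_left_injective (a + b))
      (fun m => (K ^ m *ᵥ v) i)
  intro htop
  rw [htop, ENNReal.top_mul hb, ENNReal.mul_top ha] at h1
  exact hfin (top_le_iff.1 h1)

end Green

/-! ### Communicating states -/

section Communication

variable {N : ℕ} (T : TransitionLaw N)

/-- A transition between states other than `0` has positive probability. -/
def Edge (a b : Fin (N + 1)) : Prop := a ≠ 0 ∧ b ≠ 0 ∧ T.p a b ≠ 0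

/-- All states other than `0` can be reached from each other without visiting `0`. -/
def Communicates : Prop :=
  ∀ i j : Fin (N + 1), i ≠ 0 → j ≠ 0 → Relation.TransGen (Edge T) i j

/-- The matrix of exponential moments of the taboo kernel. -/
noncomputable def tabooMom (ρ : ℝ) (i : Fin (N + 1)) :
    Matrix (Fin (N + 1)) (Fin (N + 1)) ℝ≥0∞ := (tabooKernel T i).map (mom ρ 0)

/-- The exponential moments of the transitions into `i`. -/
noncomputable def entranceMom (ρ : ℝ) (i l : Fin (N + 1)) : ℝ≥0∞ := mom ρ 0 (entrance T i l)

variable {T}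

lemma tabooMom_apply (ρ : ℝ) (i a b : Fin (N + 1)) : tabooMom T ρ i a b =
    if a = 0 ∨ b = 0 ∨ b = i then 0 else mom ρ 0 (qSeries T a b) := by
  unfold tabooMom tabooKernel
  rw [Matrix.map_apply, Matrix.of_apply]
  split_ifs
  · exact mom_zero ρ 0
  · rfl

lemma entranceMom_apply (ρ : ℝ) (i l : Fin (N + 1)) : entranceMom T ρ i l =
    if l = 0 then 0 else mom ρ 0 (qSeries T l i) := by
  unfold entranceMom entrance
  split_ifs
  · exact mom_zero ρ 0
  · rfl

lemma qSeries_ne_zero_iff (a b : Fin (N + 1)) : qSeries T a b ≠ 0 ↔ T.p a b ≠ 0 := by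
  constructor
  · intro h hp
    refine h ?_
    ext n
    simp [qSeries, TransitionLaw.Q, hp]
  · intro hp h
    have h1 : ∀ n, T.f a b n = 0 := by
      intro n
      have := congrArg (coeff n) h
      simp only [qSeries, coeff_mk, TransitionLaw.Q, map_zero, ENNReal.ofReal_eq_zero] at this
      by_contra hne
      have h2 : 0 < T.p a b := lt_of_le_of_ne (T.p_nonneg a b) (Ne.symm hp)
      have h3 : 0 < T.f a b n := lt_of_le_of_ne (T.f_nonneg a b n) (Ne.symm hne)
      exact absurd this (not_le.2 (mul_pos h2 h3))
    have h2 := T.f_hasSum a b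
    rw [funext h1] at h2
    exact zero_ne_one (hasSum_zero.unique h2)

lemma mom_gSeries (ρ : ℝ) (j l : Fin (N + 1)) : mom ρ 0 (gSeries T j l) =
    ∑ a, green (tabooMom T ρ j) l a * entranceMom T ρ j a := by
  unfold gSeries
  rw [mom_resolvent, ← tsum_pow_mulVec]
  rfl

lemma mom_hSeries (ρ : ℝ) (j s l : Fin (N + 1)) : mom ρ 0 (hSeries T j s l) =
    green (tabooMom T ρ j) l s * mom ρ 0 (survival T s) := by
  unfold hSeries
  rw [mom_resolvent]
  have := tsum_pow_mulVec (tabooMom T ρ j) (fun a => mom ρ 0 (sojourn T s a)) l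
  rw [tabooMom] at this
  rw [this, sum_eq_single s]
  · simp [sojourn, tabooMom]
  · intro a _ ha
    simp [sojourn, ha, mom_zero]
  · simp

lemma Edge.mom_ne_zero {a b : Fin (N + 1)} (h : Edge T a b) (ρ : ℝ) :
    mom ρ 0 (qSeries T a b) ≠ 0 := by
  rw [Ne, mom_eq_zero_iff]
  exact (qSeries_ne_zero_iff a b).2 h.2.2

/-- Cut the path at its first arrival in i; before that it is a taboo path. -/
lemma exists_path_to (ρ : ℝ) {i l : Fin (N + 1)} (h : Relation.TransGen (Edge T) l i) :
    ∃ b, (tabooMom T ρ i ^ b *ᵥ entranceMom T ρ i) l ≠ 0 := by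
  induction h using Relation.TransGen.head_induction_on with
  | @single a ha =>
    refine ⟨0, ?_⟩
    rw [pow_zero, Matrix.one_mulVec, entranceMom_apply, if_neg ha.1]
    exact ha.mom_ne_zero ρ
  | @head a c ha _ ih =>
    by_cases hc : c = i
    · refine ⟨0, ?_⟩
      rw [pow_zero, Matrix.one_mulVec, entranceMom_apply, if_neg ha.1, ← hc]
      exact ha.mom_ne_zero ρ
    · obtain ⟨b, hb⟩ := ih
      refine ⟨b + 1, ?_⟩
      rw [pow_succ', ← Matrix.mulVec_mulVec]
      intro h0
      simp only [Matrix.mulVec, dotProduct] at h0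
      have := (Finset.sum_eq_zero_iff.1 h0) c (mem_univ c)
      refine mul_ne_zero ?_ hb this
      rw [tabooMom_apply, if_neg (by simp [ha.1, ha.2.1, hc])]
      exact ha.mom_ne_zero ρ

/-- Keep only the part after the last visit to i: whenever the path meets i, it is restarted with
length 0. -/
lemma exists_path_from (ρ : ℝ) {i l : Fin (N + 1)} (h : Relation.TransGen (Edge T) i l) :
    ∃ a, (tabooMom T ρ i ^ a) i l ≠ 0 := by
  have h' := h.to_reflTransGen
  clear h
  induction h' with
  | refl => exact ⟨0, by simp⟩
  | @tail b c _ hbc ih =>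
    by_cases hc : c = i
    · exact ⟨0, by simp [hc]⟩
    · obtain ⟨a, ha⟩ := ih
      refine ⟨a + 1, ?_⟩
      rw [pow_succ, Matrix.mul_apply]
      intro h0
      have := (Finset.sum_eq_zero_iff.1 h0) b (mem_univ b)
      refine mul_ne_zero ha ?_ this
      rw [tabooMom_apply, if_neg (by simp [hbc.1, hbc.2.1, hc])]
      exact hbc.mom_ne_zero ρ

lemma Communicates.green_ne_top (hT : Communicates T) {ρ : ℝ} {i : Fin (N + 1)} (hi : i ≠ 0)
    (hφ : mom ρ 0 (gSeries T i i) ≠ ⊤) (l l' : Fin (N + 1)) :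
    green (tabooMom T ρ i) l l' ≠ ⊤ := by
  by_cases hl : l = 0
  · subst hl
    rw [green_eq_left]
    simp only [tabooMom_apply, true_or, if_true, zero_mul, sum_const_zero, add_zero]
    rw [Matrix.one_apply]; split_ifs <;> simp
  by_cases hl' : l' = 0
  · subst hl'
    rw [green_eq_right]
    simp only [tabooMom_apply, true_or, or_true, if_true, mul_zero, sum_const_zero, add_zero]
    simp [hl]
  obtain ⟨a, ha⟩ := exists_path_from ρ (hT i l hi hl)
  obtain ⟨b, hb⟩ := exists_path_to ρ (hT l' i hl' hi)
  refine QSD.green_ne_top ha hb ?_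
  rwa [tsum_pow_mulVec, ← mom_gSeries]

lemma Communicates.green_pos (hT : Communicates T) (ρ : ℝ) {i l : Fin (N + 1)} (hi : i ≠ 0)
    (hl : l ≠ 0) : green (tabooMom T ρ i) i l ≠ 0 := by
  obtain ⟨a, ha⟩ := exists_path_from ρ (hT i l hi hl)
  exact fun h => ha (ENNReal.tsum_eq_zero.1 h a)

lemma Communicates.gSeries_pos (hT : Communicates T) (ρ : ℝ) {i l : Fin (N + 1)} (hi : i ≠ 0)
    (hl : l ≠ 0) : mom ρ 0 (gSeries T i l) ≠ 0 := by
  obtain ⟨b, hb⟩ := exists_path_to ρ (hT l i hl hi)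
  rw [mom_gSeries, ← tsum_pow_mulVec]
  exact fun h => hb (ENNReal.tsum_eq_zero.1 h b)

lemma green_self (ρ : ℝ) (i : Fin (N + 1)) : green (tabooMom T ρ i) i i = 1 := by
  rw [green_eq_right]
  simp [tabooMom_apply]

/-- The Green function of the taboo kernel at a root of the characteristic equation is an
invariant measure. -/
lemma green_invariant {ρ : ℝ} {i : Fin (N + 1)} (hi : i ≠ 0) (hφ : mom ρ 0 (gSeries T i i) = 1)
    (i' l : Fin (N + 1)) : green (tabooMom T ρ i) i l =
      (if l = i' then green (tabooMom T ρ i) i i' else 0) +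
        ∑ a, green (tabooMom T ρ i) i a * tabooMom T ρ i' a l := by
  by_cases hl : l = i'
  · subst hl
    simp [tabooMom_apply]
  rw [if_neg hl, zero_add]
  -- The column i is where the characteristic equation enters; in the other columns invariance is
  -- the Green equation itself.
  by_cases hli : l = i
  · subst hli
    rw [green_self, ← hφ, mom_gSeries]
    refine sum_congr rfl fun a _ => ?_
    rw [entranceMom_apply, tabooMom_apply]
    by_cases ha : a = 0
    · simp [ha]
    · simp [ha, hl, hi]
  · conv_lhs => rw [green_eq_right, Matrix.one_apply_ne (Ne.symm hli), zero_add]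
    refine sum_congr rfl fun a _ => ?_
    rw [tabooMom_apply, tabooMom_apply]
    simp [hl, hli]

/-- The root of the characteristic equation does not depend on the state. -/
lemma Communicates.solidarity (hT : Communicates T) {ρ : ℝ} {i i' : Fin (N + 1)} (hi : i ≠ 0)
    (hi' : i' ≠ 0) (hφ : mom ρ 0 (gSeries T i i) = 1) :
    mom ρ 0 (gSeries T i' i') = 1 ∧ ∀ l, green (tabooMom T ρ i) i l =
      green (tabooMom T ρ i) i i' * green (tabooMom T ρ i') i' l := by
  set y := green (tabooMom T ρ i) i with hy
  have hfin : ∀ l, y l ≠ ⊤ := fun l => hT.green_ne_top hi (by rw [hφ]; simp) i l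
  have hpos : y i' ≠ 0 := hT.green_pos ρ hi hi'
  have hinv := green_invariant hi hφ i'
  have hsum : ∑ a, y a * entranceMom T ρ i' a = y i' := by
    by_cases hii : i' = i
    · subst hii
      rw [← mom_gSeries, hφ, hy, green_self]
    · rw [hy, green_eq_right (tabooMom T ρ i) i i', Matrix.one_apply_ne (Ne.symm hii), zero_add]
      refine sum_congr rfl fun a _ => ?_
      rw [entranceMom_apply, tabooMom_apply]
      simp [hii, hi']
  -- Minimality gives one inequality. It already forces finiteness of the moment, hence of the Green
  -- function for i', after which minimality is upgraded to equality.
  have hle : y i' * mom ρ 0 (gSeries T i' i') ≤ y i' := by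
    calc _ = ∑ a, (y i' * green (tabooMom T ρ i') i' a) * entranceMom T ρ i' a := by
          rw [mom_gSeries, mul_sum]; simp only [mul_assoc]
      _ ≤ ∑ a, y a * entranceMom T ρ i' a := by
          gcongr with a
          exact mul_green_le hinv a
      _ = y i' := hsum
  have hne : mom ρ 0 (gSeries T i' i') ≠ ⊤ := by
    intro h
    rw [h, ENNReal.mul_top hpos] at hle
    exact hfin i' (top_le_iff.1 hle)
  have hgreen := eq_mul_green hinv hfin (hT.green_ne_top hi' hne)
  refine ⟨?_, hgreen⟩
  have : y i' * mom ρ 0 (gSeries T i' i') = y i' * 1 := by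
    rw [mul_one, mom_gSeries, mul_sum, ← hsum]
    conv_lhs => rw [hsum]
    refine sum_congr rfl fun a _ => ?_
    rw [hy, hgreen a, mul_assoc]
  exact (ENNReal.mul_right_inj hpos (hfin i')).1 this

lemma transGen_of_gSeries_ne_zero {i j : Fin (N + 1)} (hi : i ≠ 0) (hj : j ≠ 0)
    (h : gSeries T j i ≠ 0) : Relation.TransGen (Edge T) i j := by
  obtain ⟨m, hm⟩ : ∃ m, ((tabooKernel T j ^ m) *ᵥ entrance T j) i ≠ 0 := by
    by_contra! hall
    refine h ?_
    ext n
    rw [gSeries, coeff_resolvent]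
    simp [hall]
  clear h
  induction m generalizing i with
  | zero =>
    rw [pow_zero, Matrix.one_mulVec, entrance, if_neg hi] at hm
    exact Relation.TransGen.single ⟨hi, hj, (qSeries_ne_zero_iff i j).1 hm⟩
  | succ m ih =>
    rw [pow_succ', ← Matrix.mulVec_mulVec] at hm
    simp only [Matrix.mulVec, dotProduct] at hm
    obtain ⟨l, -, hl⟩ := Finset.exists_ne_zero_of_sum_ne_zero hm
    have h1 := left_ne_zero_of_mul hl
    have h2 := right_ne_zero_of_mul hl
    simp only [tabooKernel, Matrix.of_apply, ne_eq, ite_eq_left_iff, not_forall] at h1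
    obtain ⟨h3, h4⟩ := h1
    push Not at h3
    exact Relation.TransGen.head ⟨hi, h3.2.1, (qSeries_ne_zero_iff i l).1 h4⟩ (ih h3.2.1 h2)

lemma coeff_zero_gSeries (j l : Fin (N + 1)) : coeff 0 (gSeries T j l) = 0 := by
  have h := congrFun (resolvent_eq (tabooKernel T j) (entrance T j)) l
  rw [gSeries, h, Pi.add_apply, map_add, coeff_mulVec]
  have h1 : coeff 0 (entrance T j l) = 0 := by
    unfold entrance
    split_ifs
    · simp
    · exact coeff_zero_qSeries T l j
  simp [h1, coeff_zero_tabooKernel]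

end Communication

/-! ### Characteristic roots -/

section Roots

/-- Quantitative monotonicity of exponential moments. -/
lemma exp_mul_mom_le {ρ ρ' : ℝ} (h : ρ ≤ ρ') {a : PowerSeries ℝ≥0∞} (ha : coeff 0 a = 0) :
    ENNReal.ofReal (Real.exp (ρ' - ρ)) * mom ρ 0 a ≤ mom ρ' 0 a := by
  rw [mom_eq, mom_eq, ← ENNReal.tsum_mul_left]
  refine ENNReal.tsum_le_tsum fun n => ?_
  rcases Nat.eq_zero_or_pos n with hn | hn
  · simp [hn, ha]
  · rw [← mul_assoc]
    gcongr
    unfold weight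
    rw [← ENNReal.ofReal_mul (Real.exp_pos _).le, pow_zero, one_mul, one_mul, ← Real.exp_add]
    refine ENNReal.ofReal_le_ofReal (Real.exp_le_exp.2 ?_)
    have : (1 : ℝ) ≤ n := by exact_mod_cast hn
    nlinarith

lemma lt_of_mom_eq_one {ρ ρ' : ℝ} {a : PowerSeries ℝ≥0∞} (h1 : mom ρ 0 a = 1)
    (h2 : 1 < mom ρ' 0 a) : ρ < ρ' := by
  by_contra h
  exact absurd (mom_mono (not_lt.1 h) 0 a) (not_le.2 (by rwa [h1]))

lemma one_lt_mom {ρ ρ' : ℝ} (h : ρ < ρ') {a : PowerSeries ℝ≥0∞} (ha : coeff 0 a = 0)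
    (h1 : mom ρ 0 a = 1) : 1 < mom ρ' 0 a := by
  refine lt_of_lt_of_le ?_ (exp_mul_mom_le h.le ha)
  rw [h1, mul_one, ← ENNReal.ofReal_one]
  refine (ENNReal.ofReal_lt_ofReal_iff (Real.exp_pos _)).2 ?_
  exact Real.one_lt_exp_iff.2 (by linarith)

lemma eq_of_mom_eq_one {ρ ρ' : ℝ} {a : PowerSeries ℝ≥0∞} (ha : coeff 0 a = 0)
    (h : mom ρ 0 a = 1) (h' : mom ρ' 0 a = 1) : ρ = ρ' := by
  rcases lt_trichotomy ρ ρ' with hlt | heq | hlt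
  · exact absurd (one_lt_mom hlt ha h) (by rw [h']; simp)
  · exact heq
  · exact absurd (one_lt_mom hlt ha h') (by rw [h]; simp)

lemma toReal_mom_zero {ρ : ℝ} {a : PowerSeries ℝ≥0∞} (h : mom ρ 0 a ≠ ⊤) :
    (mom ρ 0 a).toReal = ∑' n : ℕ, Real.exp (ρ * n) * (coeff n a).toReal := by
  rw [mom_eq] at h ⊢
  rw [ENNReal.tsum_toReal_eq (ENNReal.ne_top_of_tsum_ne_top h)]
  refine tsum_congr fun n => ?_
  rw [ENNReal.toReal_mul, weight, ENNReal.toReal_ofReal (by positivity), pow_zero, one_mul]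

lemma summable_toReal_mom {ρ : ℝ} {r : ℕ} {a : PowerSeries ℝ≥0∞} (h : mom ρ r a ≠ ⊤) :
    Summable fun n : ℕ => (n : ℝ) ^ r * Real.exp (ρ * n) * (coeff n a).toReal := by
  have := ENNReal.summable_toReal h
  refine this.congr fun n => ?_
  rw [ENNReal.toReal_mul, ENNReal.toReal_ofReal (by positivity)]

/-- Intermediate value theorem on [0, b]; continuity follows from domination by the convergent
series at b. -/
lemma exists_mom_eq_one {b : ℝ} {a : PowerSeries ℝ≥0∞} (h0 : mom 0 0 a ≤ 1)
    (h1 : 1 < mom b 0 a) (htop : mom b 0 a ≠ ⊤) : ∃ ρ, 0 ≤ ρ ∧ ρ < b ∧ mom ρ 0 a = 1 := by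
  have hb : 0 < b := by
    by_contra h
    exact absurd ((mom_mono (not_lt.1 h) 0 a).trans h0) (not_le.2 h1)
  have hfin : ∀ ρ ∈ Set.Icc 0 b, mom ρ 0 a ≠ ⊤ := fun ρ hρ =>
    ne_top_of_le_ne_top htop (mom_mono hρ.2 0 a)
  have hcont : ContinuousOn (fun ρ : ℝ => ∑' n : ℕ, Real.exp (ρ * n) * (coeff n a).toReal)
      (Set.Icc 0 b) := by
    refine continuousOn_tsum (u := fun n : ℕ => Real.exp (b * n) * (coeff n a).toReal)
      (fun n => by fun_prop) ?_ ?_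
    · simpa using summable_toReal_mom (r := 0) htop
    · intro n ρ hρ
      rw [Real.norm_of_nonneg (by positivity)]
      have := hρ.2
      gcongr
  have hcont' : ContinuousOn (fun ρ : ℝ => (mom ρ 0 a).toReal) (Set.Icc 0 b) :=
    hcont.congr fun ρ hρ => toReal_mom_zero (hfin ρ hρ)
  have hmem : (1 : ℝ) ∈ Set.Icc (mom 0 0 a).toReal (mom b 0 a).toReal := by
    constructor
    · exact ENNReal.toReal_mono ENNReal.one_ne_top h0
    · exact (ENNReal.toReal_mono htop h1.le)
  obtain ⟨ρ, hρ, h⟩ := intermediate_value_Icc hb.le hcont' hmem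
  have hρ1 : mom ρ 0 a = 1 := by
    rw [← ENNReal.toReal_eq_one_iff]; exact h
  exact ⟨ρ, hρ.1, lt_of_mom_eq_one hρ1 h1, hρ1⟩

variable {N : ℕ} {T : TransitionLaw N} (X : MarkovRenewalProcess.{u} T)

/-- Solidarity transports the root to all states and strict monotonicity makes it unique, so the
infimum defining `charRoot` runs over a singleton. -/
lemma Communicates.charRoot_spec (hT : Communicates T) {i : Fin (N + 1)} (hi : i ≠ 0) {ρ : ℝ}
    (hρ : 0 ≤ ρ) (hφ : mom ρ 0 (gSeries T i i) = 1) :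
    X.IsCharRoot ρ ∧ X.charRoot = ρ ∧
      ∀ i' : Fin (N + 1), i' ≠ 0 → ∀ ρ' : ℝ, 0 ≤ ρ' → X.φ i' i' ρ' 0 = 1 → ρ' = ρ := by
  have huniq : ∀ i' : Fin (N + 1), i' ≠ 0 → ∀ ρ' : ℝ, X.φ i' i' ρ' 0 = 1 → ρ' = ρ := by
    intro i' hi' ρ' h
    rw [X.φ_eq hi' hi'] at h
    exact eq_of_mom_eq_one (coeff_zero_gSeries i' i') h (hT.solidarity hi hi' hφ).1
  have hroot : X.IsCharRoot ρ := by
    refine ⟨hρ, fun i' hi' => ?_⟩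
    rw [X.φ_eq hi' hi']
    exact (hT.solidarity hi hi' hφ).1
  refine ⟨hroot, ?_, fun i' hi' ρ' _ h => huniq i' hi' ρ' h⟩
  have : {ρ : ℝ | X.IsCharRoot ρ} = {ρ} := by
    ext ρ'
    rw [Set.mem_singleton_iff]
    constructor
    · intro h
      exact huniq i hi ρ' (h.2 i hi)
    · rintro rfl
      exact hroot
  rw [MarkovRenewalProcess.charRoot, this, csInf_singleton]

end Roots

end QSD

namespace QSD

open PowerSeries Finset

/-! ### The renewal theorem for distributions with exponential tails -/

section Renewal

variable {f : ℕ → ℝ}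

/-- The tail of a summable sequence. -/
noncomputable def tailSum (f : ℕ → ℝ) (n : ℕ) : ℝ := ∑' k, f (n + 1 + k)

lemma tailSum_succ (hf : Summable f) (n : ℕ) : tailSum f n = f (n + 1) + tailSum f (n + 1) := by
  unfold tailSum
  have h : Summable fun k => f (n + 1 + k) := by
    simpa [add_comm] using (summable_nat_add_iff (n + 1)).2 hf
  rw [h.tsum_eq_zero_add]
  simp only [add_zero]
  congr 1
  refine tsum_congr fun k => ?_
  congr 1; ring

lemma tailSum_zero (hf : HasSum f 1) (h0 : f 0 = 0) : tailSum f 0 = 1 := by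
  have := hf.summable.tsum_eq_zero_add
  rw [hf.tsum_eq, h0, zero_add] at this
  rw [this]
  unfold tailSum
  refine tsum_congr fun k => ?_
  congr 1; ring

lemma tailSum_nonneg (hf : ∀ n, 0 ≤ f n) (n : ℕ) : 0 ≤ tailSum f n := tsum_nonneg fun _ => hf _

/-- Markov's inequality: the tail beyond n is at most a constant times R^(-n). -/
lemma summable_tailSum (hf : ∀ n, 0 ≤ f n) {R s : ℝ} (hR : 1 < R)
    (hfR : Summable fun n => f n * R ^ n) (hs : 0 ≤ s) (hsR : s < R) :
    Summable fun n => tailSum f n * s ^ n := by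
  have hR0 : 0 < R := by linarith
  have hbound : ∀ n, tailSum f n ≤ (∑' n, f n * R ^ n) * (1 / R) ^ n := by
    intro n
    have h1 : Summable fun k => f (n + 1 + k) * R ^ (n + 1 + k) := by
      simpa [add_comm] using (summable_nat_add_iff (n + 1)).2 hfR
    have h2 : ∑' k, f (n + 1 + k) * R ^ (n + 1 + k) ≤ ∑' n, f n * R ^ n :=
      tsum_comp_le_tsum_of_inj hfR (fun n => by have := hf n; positivity)
        (add_right_injective (n + 1))
    have h3 : ∀ k, f (n + 1 + k) ≤ f (n + 1 + k) * R ^ (n + 1 + k) * (1 / R) ^ n := by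
      intro k
      have : f (n + 1 + k) * R ^ (n + 1 + k) * (1 / R) ^ n = f (n + 1 + k) * R ^ (k + 1) := by
        rw [show n + 1 + k = (k + 1) + n by ring, pow_add R (k + 1) n, one_div, inv_pow]
        field_simp
      rw [this]
      exact le_mul_of_one_le_right (hf _) (one_le_pow₀ hR.le)
    calc tailSum f n ≤ ∑' k, f (n + 1 + k) * R ^ (n + 1 + k) * (1 / R) ^ n := by
          unfold tailSum
          exact Summable.tsum_le_tsum h3 (Summable.of_nonneg_of_le (fun k => hf _) h3
            (h1.mul_right _)) (h1.mul_right _)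
      _ = (∑' k, f (n + 1 + k) * R ^ (n + 1 + k)) * (1 / R) ^ n := tsum_mul_right
      _ ≤ _ := by gcongr
  refine Summable.of_nonneg_of_le (f := fun n => (∑' n, f n * R ^ n) * (s / R) ^ n)
    (fun n => mul_nonneg (tailSum_nonneg hf n) (by positivity)) (fun n => ?_) ?_
  · calc tailSum f n * s ^ n ≤ (∑' n, f n * R ^ n) * (1 / R) ^ n * s ^ n := by
          gcongr; exact hbound n
      _ = _ := by rw [mul_assoc, ← mul_pow]; congr 2; ring
  · refine (summable_geometric_of_lt_one (by positivity) ?_).mul_left _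
    rwa [div_lt_one hR0]

/-- A power series that represents the constant `1` near `0` is `1`. -/
lemma eq_one_of_hasSum {w : PowerSeries ℂ}
    (h : ∀ᶠ z : ℂ in 𝓝 0, HasSum (fun n => coeff n w * z ^ n) 1) : w = 1 := by
  have h1 : HasFPowerSeriesAt (fun _ : ℂ => (1 : ℂ))
      (FormalMultilinearSeries.ofScalars ℂ fun n => coeff n w) 0 := by
    rw [hasFPowerSeriesAt_iff]
    filter_upwards [h] with z hz
    simpa [FormalMultilinearSeries.coeff_ofScalars, mul_comm] using hz
  have h2 : HasFPowerSeriesAt (fun _ : ℂ => (1 : ℂ))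
      (FormalMultilinearSeries.ofScalars ℂ fun n => coeff n (1 : PowerSeries ℂ)) 0 := by
    rw [hasFPowerSeriesAt_iff]
    refine Filter.Eventually.of_forall fun z => ?_
    have : HasSum (fun n => if n = 0 then (1 : ℂ) else 0) 1 := hasSum_ite_eq 0 1
    refine this.congr_fun fun n => ?_
    by_cases hn : n = 0 <;> simp [FormalMultilinearSeries.coeff_ofScalars, coeff_one, hn]
  have h3 := h1.eq_formalMultilinearSeries h2
  ext n
  have := congrArg (fun p => FormalMultilinearSeries.coeff p n) h3
  simpa [FormalMultilinearSeries.coeff_ofScalars] using this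

lemma hasSum_coeff_mul {a b : PowerSeries ℂ} {z : ℂ}
    (ha : Summable fun n => ‖coeff n a * z ^ n‖) (hb : Summable fun n => ‖coeff n b * z ^ n‖) :
    Summable (fun n => ‖coeff n (a * b) * z ^ n‖) ∧
    HasSum (fun n => coeff n (a * b) * z ^ n)
      ((∑' n, coeff n a * z ^ n) * ∑' n, coeff n b * z ^ n) := by
  have h1 : ∀ n, coeff n (a * b) * z ^ n =
      ∑ p ∈ antidiagonal n, (coeff p.1 a * z ^ p.1) * (coeff p.2 b * z ^ p.2) := by
    intro n
    rw [coeff_mul, sum_mul]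
    refine sum_congr rfl fun p hp => ?_
    rw [← HasAntidiagonal.mem_antidiagonal.1 hp, pow_add]
    ring
  have h2 := summable_norm_sum_mul_antidiagonal_of_summable_norm ha hb
  simp only [h1]
  refine ⟨h2, ?_⟩
  rw [tsum_mul_tsum_eq_tsum_sum_antidiagonal_of_summable_norm ha hb]
  exact h2.of_norm.hasSum

variable (hf : ∀ n, 0 ≤ f n) (h0 : f 0 = 0) (h1 : HasSum f 1)
  (hper : ∀ d : ℕ, (∀ n, f n ≠ 0 → d ∣ n) → d = 1)

include hf hper in
-- An average of numbers Re z^n ≤ 1 equals 1 only if z^n = 1 on the whole support of f. The order of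
-- z then divides the support and must be 1; infinite order is covered by the divisor d = 0.
lemma eq_one_of_tsum_eq_one (h1 : HasSum f 1) {z : ℂ} (hz : ‖z‖ ≤ 1)
    (h : HasSum (fun n => (f n : ℂ) * z ^ n) 1) : z = 1 := by
  have hre : HasSum (fun n => f n * (z ^ n).re) 1 := by
    have := Complex.hasSum_re h
    simpa using this
  have hle : ∀ n, (z ^ n).re ≤ 1 := fun n =>
    (Complex.re_le_norm _).trans (by rw [norm_pow]; exact pow_le_one₀ (norm_nonneg _) hz)
  have hdiff : HasSum (fun n => f n * (1 - (z ^ n).re)) 0 := by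
    have := h1.sub hre
    simpa [mul_sub] using this
  have hzero := (hasSum_zero_iff_of_nonneg
    (fun n => mul_nonneg (hf n) (by linarith [hle n]))).1 hdiff
  have hpow : ∀ n, f n ≠ 0 → z ^ n = 1 := by
    intro n hn
    have h2 : (z ^ n).re = 1 := by
      have := congrFun hzero n
      simp only [Pi.zero_apply, mul_eq_zero, hn, false_or] at this
      linarith
    have h3 : ‖z ^ n‖ ≤ 1 := by rw [norm_pow]; exact pow_le_one₀ (norm_nonneg _) hz
    have h4 : (z ^ n).im = 0 := by
      have h5 : ‖z ^ n‖ ^ 2 = (z ^ n).re ^ 2 + (z ^ n).im ^ 2 := by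
        rw [Complex.sq_norm, Complex.normSq_apply]; ring
      have h6 : ‖z ^ n‖ ^ 2 ≤ 1 := pow_le_one₀ (norm_nonneg _) h3
      rw [h2] at h5
      have : (z ^ n).im ^ 2 ≤ 0 := by linarith
      exact pow_eq_zero_iff (two_ne_zero) |>.1 (le_antisymm this (sq_nonneg _))
    exact Complex.ext (by simpa using h2) (by simpa using h4)
  have := hper (orderOf z) fun n hn => orderOf_dvd_of_pow_eq_one (hpow n hn)
  exact orderOf_eq_one_iff.1 this

include hf h0 h1 hper in
-- With F and G the generating functions of f and of its tails, (1 - z) G(z) = 1 - F(z). A zero of G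
-- would give F(z) = 1, hence z = 1, but G(1) is at least the tail at 0, which is 1.
lemma tsum_tailSum_ne_zero {z : ℂ} (hz : ‖z‖ ≤ 1)
    (hs : Summable fun n => (tailSum f n : ℂ) * z ^ n) (hs1 : Summable (tailSum f)) :
    ∑' n, (tailSum f n : ℂ) * z ^ n ≠ 0 := by
  intro hG
  have hz1 : z = 1 := by
    refine eq_one_of_tsum_eq_one hf hper h1 hz ?_
    have hfz : Summable fun n => (f n : ℂ) * z ^ n := by
      refine Summable.of_norm_bounded h1.summable fun n => ?_
      rw [norm_mul, norm_pow, Complex.norm_real, Real.norm_of_nonneg (hf n)]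
      exact mul_le_of_le_one_right (hf n) (pow_le_one₀ (norm_nonneg _) hz)
    have hs' : Summable fun n => (tailSum f (n + 1) : ℂ) * z ^ (n + 1) :=
      (summable_nat_add_iff (f := fun n => (tailSum f n : ℂ) * z ^ n) 1).2 hs
    have hfz' : Summable fun n => (f (n + 1) : ℂ) * z ^ (n + 1) :=
      (summable_nat_add_iff (f := fun n => (f n : ℂ) * z ^ n) 1).2 hfz
    have e1 := hs.tsum_eq_zero_add
    have e2 := hfz.tsum_eq_zero_add
    have e3 : ∑' n, (tailSum f n : ℂ) * z ^ (n + 1) =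
        ∑' n, (f (n + 1) : ℂ) * z ^ (n + 1) + ∑' n, (tailSum f (n + 1) : ℂ) * z ^ (n + 1) := by
      rw [← hfz'.tsum_add hs']
      refine tsum_congr fun n => ?_
      rw [tailSum_succ h1.summable n]
      push_cast; ring
    have e4 : ∑' n, (tailSum f n : ℂ) * z ^ (n + 1) = 0 := by
      have : ∀ n, (tailSum f n : ℂ) * z ^ (n + 1) = z * ((tailSum f n : ℂ) * z ^ n) := by
        intro n; ring
      rw [tsum_congr this, tsum_mul_left, hG, mul_zero]
    rw [hG, tailSum_zero h1 h0] at e1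
    rw [h0] at e2
    rw [hfz.hasSum_iff, e2]
    simp only [pow_zero, Complex.ofReal_one, Complex.ofReal_zero, mul_one, zero_add] at e1 ⊢
    linear_combination e1 - e3 + e4
  subst hz1
  simp only [one_pow, mul_one] at hG
  have hG' : ((∑' n, tailSum f n : ℝ) : ℂ) = 0 := by rw [Complex.ofReal_tsum]; exact hG
  have h2 : (tailSum f 0) ≤ ∑' n, tailSum f n :=
    hs1.le_tsum 0 fun n _ => tailSum_nonneg hf n
  rw [tailSum_zero h1 h0, Complex.ofReal_eq_zero.1 hG'] at h2
  linarith

include hf h0 h1 hper in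
-- The tail generating function is analytic beyond the unit disc and has no zero on the closed disc.
-- By compactness it has none on a slightly larger disc either, so the Taylor coefficients of its
-- reciprocal are absolutely summable.
lemma exists_inverse_tailSum {R : ℝ} (hR : 1 < R) (hfR : Summable fun n => f n * R ^ n) :
    ∃ v : PowerSeries ℂ, (mk fun n => (tailSum f n : ℂ)) * v = 1 ∧
      Summable fun n => ‖coeff n v‖ := by
  have hsum : ∀ z : ℂ, ‖z‖ < R → Summable fun n => ‖(tailSum f n : ℂ) * z ^ n‖ := by
    intro z hz
    refine (summable_tailSum hf hR hfR (norm_nonneg z) hz).congr fun n => ?_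
    rw [norm_mul, norm_pow, Complex.norm_real, Real.norm_of_nonneg (tailSum_nonneg hf n)]
  have hs1 : Summable (tailSum f) := by
    simpa using summable_tailSum hf hR hfR zero_le_one hR
  set G : ℂ → ℂ := fun z => ∑' n, (tailSum f n : ℂ) * z ^ n with hGdef
  have hGdiff : DifferentiableOn ℂ G (Metric.ball 0 R) := by
    intro z hz
    rw [mem_ball_zero_iff] at hz
    obtain ⟨s, hs1, hs2⟩ := exists_between hz
    have hs0 : 0 ≤ s := (norm_nonneg z).trans hs1.le
    have : DifferentiableOn ℂ G (Metric.ball 0 s) := by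
      refine Complex.differentiableOn_tsum_of_summable_norm
        (summable_tailSum hf hR hfR hs0 hs2) (fun n => by fun_prop) Metric.isOpen_ball ?_
      intro n w hw
      rw [mem_ball_zero_iff] at hw
      rw [norm_mul, norm_pow, Complex.norm_real, Real.norm_of_nonneg (tailSum_nonneg hf n)]
      have := tailSum_nonneg hf n
      gcongr
    exact (this.differentiableAt (Metric.isOpen_ball.mem_nhds
      (by rwa [mem_ball_zero_iff]))).differentiableWithinAt
  obtain ⟨δ, hδ, hδU⟩ : ∃ δ, 0 < δ ∧ Metric.thickening δ (Metric.closedBall (0 : ℂ) 1) ⊆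
      Metric.ball 0 R ∩ G ⁻¹' {0}ᶜ := by
    refine (isCompact_closedBall 0 1).exists_thickening_subset_open ?_ ?_
    · exact hGdiff.continuousOn.isOpen_inter_preimage Metric.isOpen_ball isOpen_compl_singleton
    · intro z hz
      rw [mem_closedBall_zero_iff] at hz
      have hzR : ‖z‖ < R := by linarith
      exact ⟨by rwa [mem_ball_zero_iff],
        tsum_tailSum_ne_zero hf h0 h1 hper hz (hsum z hzR).of_norm hs1⟩
  rw [thickening_closedBall hδ zero_le_one] at hδU
  have hsub : Metric.closedBall (0 : ℂ) (1 + δ / 2) ⊆ Metric.ball 0 R ∩ G ⁻¹' {0}ᶜ :=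
    (Metric.closedBall_subset_ball (by linarith)).trans hδU
  set r : ℝ≥0 := ⟨1 + δ / 2, by linarith⟩ with hr
  have hinv : DifferentiableOn ℂ (fun z => (G z)⁻¹) (Metric.closedBall 0 r) :=
    (hGdiff.mono fun z hz => (hsub hz).1).inv fun z hz => (hsub hz).2
  have hr1 : (1 : ℝ≥0) < r := by
    change (1 : ℝ) < 1 + δ / 2; linarith
  have hps := hinv.hasFPowerSeriesOnBall (zero_lt_one.trans hr1)
  set p := cauchyPowerSeries (fun z => (G z)⁻¹) 0 r with hp
  have hvsum : ∀ z : ℂ, ‖z‖ ≤ 1 → Summable fun n => ‖p.coeff n * z ^ n‖ := by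
    intro z hz
    have hz' : z ∈ Metric.eball (0 : ℂ) p.radius := by
      refine Metric.eball_subset_eball hps.r_le ?_
      rw [Metric.eball_coe, mem_ball_zero_iff]
      exact lt_of_le_of_lt hz (by exact_mod_cast hr1)
    have := p.summable_norm_apply hz'
    refine this.congr fun n => ?_
    rw [FormalMultilinearSeries.apply_eq_pow_smul_coeff, smul_eq_mul, mul_comm]
  refine ⟨mk fun n => p.coeff n, ?_, ?_⟩
  · refine eq_one_of_hasSum ?_
    filter_upwards [Metric.ball_mem_nhds (0 : ℂ) one_pos] with z hz
    rw [mem_ball_zero_iff] at hz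
    have hzr : z ∈ Metric.closedBall (0 : ℂ) (1 + δ / 2) := by
      rw [mem_closedBall_zero_iff]; linarith
    have h2 := (hasSum_coeff_mul (a := mk fun n => (tailSum f n : ℂ))
      (b := mk fun n => p.coeff n) (z := z) (by simpa using hsum z (by linarith))
      (by simpa using hvsum z hz.le)).2
    convert h2 using 1
    simp only [coeff_mk]
    have h3 : ∑' n, p.coeff n * z ^ n = (G z)⁻¹ := by
      have hz' : z ∈ Metric.eball (0 : ℂ) r := by
        rw [Metric.eball_coe, mem_ball_zero_iff]
        exact lt_trans hz (by exact_mod_cast hr1)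
      have := (hps.hasSum hz').tsum_eq
      rw [zero_add] at this
      rw [← this]
      refine tsum_congr fun n => ?_
      rw [FormalMultilinearSeries.apply_eq_pow_smul_coeff, smul_eq_mul, mul_comm]
    rw [h3]
    exact (mul_inv_cancel₀ (hsub hzr).2).symm
  · simpa using hvsum 1 (by simp)

include hf h0 h1 hper in
/-- The renewal theorem. -/
theorem renewal_tendsto {R : ℝ} (hR : 1 < R) (hfR : Summable fun n => f n * R ^ n) :
    0 < ∑' n, tailSum f n ∧ ∀ (b u : ℕ → ℝ), Summable (fun n => ‖b n‖) →
      (∀ n, u n = b n + ∑ p ∈ antidiagonal n, f p.1 * u p.2) →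
      Tendsto u atTop (𝓝 ((∑' n, b n) / ∑' n, tailSum f n)) := by
  have hs1 : Summable (tailSum f) := by
    simpa using summable_tailSum hf hR hfR zero_le_one hR
  have hpos : 0 < ∑' n, tailSum f n := by
    have h2 : (tailSum f 0) ≤ ∑' n, tailSum f n :=
      hs1.le_tsum 0 fun n _ => tailSum_nonneg hf n
    rw [tailSum_zero h1 h0] at h2
    linarith
  refine ⟨hpos, fun b u hb hu => ?_⟩
  obtain ⟨v, hv, hvs⟩ := exists_inverse_tailSum hf h0 h1 hper hR hfR
  set t : PowerSeries ℂ := mk fun n => (tailSum f n : ℂ) with ht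
  set B : PowerSeries ℂ := mk fun n => (b n : ℂ) with hB
  set U : PowerSeries ℂ := mk fun n => (u n : ℂ) with hU
  set F : PowerSeries ℂ := mk fun n => (f n : ℂ) with hF
  have e1 : (1 - PowerSeries.X) * t = 1 - F := by
    ext n
    rw [sub_mul, one_mul, map_sub, map_sub]
    cases n with
    | zero => simp [ht, hF, h0, tailSum_zero h1 h0]
    | succ n =>
      rw [coeff_succ_X_mul, coeff_one, if_neg (Nat.succ_ne_zero n)]
      simp only [ht, hF, coeff_mk]
      rw [tailSum_succ h1.summable n]
      push_cast; ring
  have e2 : U = B + F * U := by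
    ext n
    rw [map_add, coeff_mul]
    simp only [hU, hB, hF, coeff_mk]
    rw [hu n]
    push_cast
    rfl
  -- The increments of u are the coefficients of the absolutely convergent product B v. Hence u
  -- converges to B(1) v(1) = B(1) / t(1).
  have e3 : (1 - PowerSeries.X) * U = B * v := by
    have : (1 - F) * U = B := by linear_combination e2
    rw [← this, ← e1]
    linear_combination (-(1 - PowerSeries.X) * U) * hv
  have e4 : ∀ n, ∑ k ∈ range (n + 1), coeff k (B * v) = (u n : ℂ) := by
    intro n
    rw [← e3]
    induction n with
    | zero => simp [hU, sub_mul]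
    | succ n ih =>
      rw [sum_range_succ, ih, sub_mul, one_mul, map_sub, coeff_succ_X_mul]
      simp [hU]
  have hBs : Summable fun n => ‖coeff n B * (1 : ℂ) ^ n‖ := by
    simpa [hB] using hb
  obtain ⟨-, hBv⟩ := hasSum_coeff_mul hBs (b := v) (by simpa using hvs)
  simp only [one_pow, mul_one] at hBv
  obtain ⟨-, htv⟩ := hasSum_coeff_mul (a := t) (b := v) (z := 1)
    (by simpa [ht, abs_of_nonneg (tailSum_nonneg hf _)] using hs1) (by simpa using hvs)
  simp only [one_pow, mul_one] at htv
  have h2 : (∑' n, coeff n t) * ∑' n, coeff n v = 1 := by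
    rw [hv] at htv
    refine htv.unique ?_
    refine (hasSum_ite_eq 0 (1 : ℂ)).congr_fun fun n => ?_
    rw [coeff_one]
  have h3 : (∑' n, coeff n t) = ((∑' n, tailSum f n : ℝ) : ℂ) := by
    simp [ht, Complex.ofReal_tsum]
  have h4 : (∑' n, coeff n B) = ((∑' n, b n : ℝ) : ℂ) := by
    simp [hB, Complex.ofReal_tsum]
  have hlim : (∑' n, coeff n B) * ∑' n, coeff n v =
      (((∑' n, b n) / ∑' n, tailSum f n : ℝ) : ℂ) := by
    have hne : ((∑' n, tailSum f n : ℝ) : ℂ) ≠ 0 := by exact_mod_cast hpos.ne'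
    rw [h3] at h2
    rw [h4, Complex.ofReal_div, eq_div_iff hne, mul_assoc, mul_comm (∑' n, coeff n v), h2, mul_one]
  have h5 : Tendsto (fun n => (u n : ℂ)) atTop
      (𝓝 (((∑' n, b n) / ∑' n, tailSum f n : ℝ) : ℂ)) := by
    rw [← hlim]
    refine (hBv.tendsto_sum_nat.comp (tendsto_add_atTop_nat 1)).congr fun n => ?_
    exact e4 n
  have := (Complex.continuous_re.tendsto _).comp h5
  simpa [Function.comp_def] using this

end Renewal

/-- The limit of the convolution of a summable sequence with a convergent one. -/
lemma tendsto_convolution {a u : ℕ → ℝ} {L : ℝ} (ha : Summable fun n => ‖a n‖)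
    (hu : Tendsto u atTop (𝓝 L)) :
    Tendsto (fun n => ∑ p ∈ antidiagonal n, a p.1 * u p.2) atTop (𝓝 ((∑' n, a n) * L)) := by
  obtain ⟨C, hC⟩ := hu.norm.bddAbove_range
  have hC' : ∀ n, ‖u n‖ ≤ C := fun n => hC ⟨n, rfl⟩
  have h := tendsto_tsum_of_dominated_convergence (𝓕 := atTop)
    (f := fun n k => if k ≤ n then a k * u (n - k) else 0) (g := fun k => a k * L)
    (bound := fun k => ‖a k‖ * C) (ha.mul_right C) ?_ ?_
  · rw [tsum_mul_right] at h
    refine h.congr fun n => ?_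
    rw [tsum_eq_sum (s := range (n + 1))]
    · rw [Finset.Nat.sum_antidiagonal_eq_sum_range_succ (fun i j => a i * u j)]
      refine sum_congr rfl fun k hk => ?_
      rw [if_pos (by rw [Finset.mem_range] at hk; omega)]
    · intro k hk
      rw [if_neg (by rw [Finset.mem_range] at hk; omega)]
  · intro k
    have h1 : Tendsto (fun n => a k * u (n - k)) atTop (𝓝 (a k * L)) :=
      (hu.comp (tendsto_sub_atTop_nat k)).const_mul _
    refine h1.congr' ?_
    filter_upwards [eventually_ge_atTop k] with n hn
    rw [if_pos hn]
  · refine Filter.Eventually.of_forall fun n k => ?_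
    split_ifs
    · rw [norm_mul]
      gcongr
      exact hC' _
    · rw [norm_zero]
      exact mul_nonneg (norm_nonneg _) ((norm_nonneg _).trans (hC' 0))

end QSD

namespace QSD

open PowerSeries Finset

/-! ### The quasi-stationary distribution -/

section Tilt

/-- The exponentially tilted sequence of coefficients. -/
noncomputable def tilt (ρ : ℝ) (a : PowerSeries ℝ≥0∞) (n : ℕ) : ℝ :=
  Real.exp (ρ * n) * (coeff n a).toReal

lemma tilt_nonneg (ρ : ℝ) (a : PowerSeries ℝ≥0∞) (n : ℕ) : 0 ≤ tilt ρ a n := by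
  unfold tilt; positivity

/-- The factor exp(ρn) splits along convolutions, so tilting turns a renewal equation over [0,∞]
into one with real terms, with a proper kernel if ρ is the root. -/
lemma tilt_add_mul {ρ : ℝ} {a b c d : PowerSeries ℝ≥0∞} (h : a = b + c * d)
    (hb : ∀ n, coeff n b ≠ ⊤) (hc : ∀ n, coeff n c ≠ ⊤) (hd : ∀ n, coeff n d ≠ ⊤) (n : ℕ) :
    tilt ρ a n = tilt ρ b n + ∑ p ∈ antidiagonal n, tilt ρ c p.1 * tilt ρ d p.2 := by
  have h1 : ∀ p ∈ antidiagonal n, coeff p.1 c * coeff p.2 d ≠ ⊤ := fun p _ =>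
    ENNReal.mul_ne_top (hc _) (hd _)
  unfold tilt
  rw [h, map_add, coeff_mul, ENNReal.toReal_add (hb n) (ENNReal.sum_ne_top.2 h1),
    ENNReal.toReal_sum h1, mul_add, mul_sum]
  congr 1
  refine sum_congr rfl fun p hp => ?_
  rw [ENNReal.toReal_mul, ← HasAntidiagonal.mem_antidiagonal.1 hp, Nat.cast_add, mul_add,
    Real.exp_add]
  ring

lemma hasSum_tilt {ρ : ℝ} {a : PowerSeries ℝ≥0∞} (h : mom ρ 0 a ≠ ⊤) :
    HasSum (tilt ρ a) (mom ρ 0 a).toReal := by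
  rw [toReal_mom_zero h]
  refine Summable.hasSum ((summable_toReal_mom (r := 0) h).congr fun n => ?_)
  simp [tilt]

lemma summable_norm_tilt {ρ : ℝ} {a : PowerSeries ℝ≥0∞} (h : mom ρ 0 a ≠ ⊤) :
    Summable fun n => ‖tilt ρ a n‖ :=
  (hasSum_tilt h).summable.norm

end Tilt

variable {N : ℕ} {T : TransitionLaw N} (X : MarkovRenewalProcess.{u} T)

lemma survival_ne_zero (T : TransitionLaw N) (s : Fin (N + 1)) : survival T s ≠ 0 := by
  intro h
  have h1 := congrArg (coeff 0) h
  simp only [survival, coeff_mk, map_zero, ENNReal.tsum_eq_zero, sum_eq_zero_iff, mem_univ,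
    true_implies] at h1
  have h2 : ∀ l, T.p s l = 0 := by
    intro l
    by_contra hl
    refine (qSeries_ne_zero_iff s l).2 hl ?_
    ext n
    cases n with
    | zero => exact coeff_zero_qSeries T s l
    | succ n =>
      have := h1 n l
      rw [zero_add, add_comm] at this
      simpa [qSeries] using this
  have h3 := T.p_sum s
  rw [sum_eq_zero fun l _ => h2 l] at h3
  exact zero_ne_one h3

lemma mom_hSeries_ne_top (hT : Communicates T) {ρ : ℝ} {i : Fin (N + 1)} (hi : i ≠ 0)
    (hφ : mom ρ 0 (gSeries T i i) ≠ ⊤) {s : Fin (N + 1)} (hS : mom ρ 0 (survival T s) ≠ ⊤)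
    (l : Fin (N + 1)) : mom ρ 0 (hSeries T i s l) ≠ ⊤ := by
  rw [mom_hSeries]
  exact ENNReal.mul_ne_top (hT.green_ne_top hi hφ l s) hS

/-- Prefixing a taboo path from i to l of positive weight bounds a multiple of the moment from l by
the moment from i. -/
lemma mom_gSeries_ne_top (hT : Communicates T) {ρ : ℝ} {i : Fin (N + 1)} (hi : i ≠ 0)
    (hφ : mom ρ 0 (gSeries T i i) ≠ ⊤) {l : Fin (N + 1)} (hl : l ≠ 0) :
    mom ρ 0 (gSeries T i l) ≠ ⊤ := by
  obtain ⟨a, ha⟩ := exists_path_from ρ (hT i l hi hl)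
  rw [mom_gSeries, ← tsum_pow_mulVec] at hφ ⊢
  intro htop
  have h1 : (tabooMom T ρ i ^ a) i l * ∑' m : ℕ, (tabooMom T ρ i ^ m *ᵥ entranceMom T ρ i) l ≤
      ∑' m : ℕ, (tabooMom T ρ i ^ m *ᵥ entranceMom T ρ i) i := by
    rw [← ENNReal.tsum_mul_left]
    refine le_trans (ENNReal.tsum_le_tsum fun m => ?_)
      (ENNReal.tsum_comp_le_tsum_of_injective (add_right_injective a)
      (fun m => (tabooMom T ρ i ^ m *ᵥ entranceMom T ρ i) i))
    rw [pow_add, ← Matrix.mulVec_mulVec]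
    exact single_le_sum
      (f := fun x => (tabooMom T ρ i ^ a) i x * (tabooMom T ρ i ^ m *ᵥ entranceMom T ρ i) x)
      (fun _ _ => zero_le) (mem_univ l)
  rw [htop, ENNReal.mul_top ha] at h1
  exact hφ (top_le_iff.1 h1)

lemma coeff_hSeries_ne_top (X : MarkovRenewalProcess.{u} T) {i : Fin (N + 1)} (hi : i ≠ 0)
    (j s : Fin (N + 1)) (n : ℕ) : coeff n (hSeries T j s i) ≠ ⊤ := by
  rw [← X.h_eq hi]
  exact measure_ne_top _ _

/-- Asymptotics of the probabilities of survival in the state `j`. -/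
lemma tendsto_tilt (X : MarkovRenewalProcess.{u} T) (hT : Communicates T) {i : Fin (N + 1)}
    (hi : i ≠ 0) (hper : NonPeriodic fun n => coeff n (gSeries T i i)) {ρ ρ' : ℝ}
    (hφ : mom ρ 0 (gSeries T i i) = 1) (hρ : ρ < ρ') (hφ' : mom ρ' 0 (gSeries T i i) ≠ ⊤) :
    ∃ m : ℝ, 0 < m ∧ ∀ l s : Fin (N + 1), l ≠ 0 → mom ρ 0 (survival T s) ≠ ⊤ →
      Tendsto (tilt ρ (hSeries T 0 s l)) atTop
        (𝓝 ((mom ρ 0 (gSeries T i l)).toReal * ((mom ρ 0 (hSeries T i s i)).toReal / m))) := by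
  have hg : mom ρ 0 (gSeries T i i) ≠ ⊤ := by rw [hφ]; simp
  have hgc : ∀ l, l ≠ 0 → ∀ n, coeff n (gSeries T i l) ≠ ⊤ := fun l hl =>
    coeff_ne_top_of_mom (mom_gSeries_ne_top hT hi hg hl)
  have h1 : HasSum (tilt ρ (gSeries T i i)) 1 := by
    have := hasSum_tilt hg
    rwa [hφ, ENNReal.toReal_one] at this
  have hper' : ∀ d : ℕ, (∀ n, tilt ρ (gSeries T i i) n ≠ 0 → d ∣ n) → d = 1 := by
    intro d hd
    refine hper d fun n hn => hd n ?_
    exact mul_ne_zero (Real.exp_pos _).ne' (ENNReal.toReal_ne_zero.2 ⟨hn, hgc i hi n⟩)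
  -- The gap between ρ and ρ' becomes a radius of convergence above 1 for the tilted distribution.
  have hR : Summable fun n => tilt ρ (gSeries T i i) n * Real.exp (ρ' - ρ) ^ n := by
    refine (hasSum_tilt hφ').summable.congr fun n => ?_
    unfold tilt
    rw [← Real.exp_nat_mul, mul_right_comm, ← Real.exp_add]
    ring_nf
  obtain ⟨hm, hren⟩ := renewal_tendsto (tilt_nonneg ρ _)
    (by simp [tilt, coeff_zero_gSeries]) h1 hper'
    (Real.one_lt_exp_iff.2 (sub_pos.2 hρ)) hR
  refine ⟨_, hm, fun l s hl hS => ?_⟩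
  have hh := mom_hSeries_ne_top hT hi hg hS
  have hu : Tendsto (tilt ρ (hSeries T 0 s i)) atTop
      (𝓝 ((mom ρ 0 (hSeries T i s i)).toReal / ∑' n, tailSum (tilt ρ (gSeries T i i)) n)) := by
    have := hren (tilt ρ (hSeries T i s i)) (tilt ρ (hSeries T 0 s i))
      (summable_norm_tilt (hh i)) (tilt_add_mul (hSeries_zero_eq T hi s i)
        (coeff_hSeries_ne_top X hi i s) (hgc i hi) (coeff_hSeries_ne_top X hi 0 s))
    rwa [(hasSum_tilt (hh i)).tsum_eq] at this
  -- From another starting state l the process first travels to i. The part without a visit to i is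
  -- summable, hence vanishes in the limit.
  have h2 := tendsto_convolution (summable_norm_tilt (mom_gSeries_ne_top hT hi hg hl)) hu
  rw [(hasSum_tilt (mom_gSeries_ne_top hT hi hg hl)).tsum_eq] at h2
  have h3 := ((hasSum_tilt (hh l)).summable.tendsto_atTop_zero).add h2
  rw [zero_add] at h3
  refine h3.congr fun n => ?_
  exact (tilt_add_mul (hSeries_zero_eq T hi s l)
        (coeff_hSeries_ne_top X hl i s) (hgc l hl) (coeff_hSeries_ne_top X hi 0 s) n).symm

namespace MarkovRenewalProcess

lemma measurableSet_survivors (s : Fin (N + 1)) (n : ℕ) :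
    MeasurableSet {ω | X.ξ n ω = s ∧ (n : ℕ∞) < X.μ 0 ω} := by
  have : {ω | X.ξ n ω = s ∧ (n : ℕ∞) < X.μ 0 ω} =
      ⋃ m, {ω | X.Avoids 0 m ω ∧ X.η m ω = s ∧ X.τ m ω ≤ n ∧ n < X.τ (m + 1) ω} := by
    ext ω
    rw [Set.mem_iUnion]
    have := X.occupation_iff 0 s n ω
    rwa [min_self] at this
  rw [this]
  exact MeasurableSet.iUnion fun m => X.measurableSet_occupation 0 s n m

lemma survivors_eq (n : ℕ) : {ω | (n : ℕ∞) < X.μ 0 ω} =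
    ⋃ s ∈ (univ : Finset (Fin (N + 1))), {ω | X.ξ n ω = s ∧ (n : ℕ∞) < X.μ 0 ω} := by
  ext ω
  simp

lemma measure_survivors_zero {i : Fin (N + 1)} (hi : i ≠ 0) (n : ℕ) :
    X.P i {ω | X.ξ n ω = 0 ∧ (n : ℕ∞) < X.μ 0 ω} = 0 := by
  have h0 : X.P i {ω | X.η 0 ω = 0} = 0 := by rw [measure_initial, if_neg hi]
  refine measure_mono_null ?_ h0
  rintro ω ⟨h1, h2⟩
  rw [lt_μ_iff] at h2
  obtain ⟨h4, -⟩ := (X.ξ_eq_iff n _ ω).1 rfl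
  unfold ξ at h1
  rcases Nat.eq_zero_or_pos (Nat.findGreatest (fun m => X.τ m ω ≤ n) n) with h | h
  · rw [h] at h1
    exact h1
  · exact absurd (h2 _ h h1) (not_lt.2 h4)

lemma measure_survivors {i : Fin (N + 1)} (hi : i ≠ 0) (n : ℕ) :
    X.P i {ω | (n : ℕ∞) < X.μ 0 ω} = ∑ s : Fin N, coeff n (hSeries T 0 s.succ i) := by
  rw [survivors_eq, measure_biUnion_finset, Fin.sum_univ_succ, X.measure_survivors_zero hi,
    zero_add]
  · refine sum_congr rfl fun s _ => ?_
    rw [← X.h_eq hi]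
    simp [h]
  · intro s _ s' _ hne
    refine Set.disjoint_left.2 ?_
    rintro ω ⟨h, -⟩ ⟨h', -⟩
    exact hne (h.symm.trans h')
  · exact fun s _ => X.measurableSet_survivors s n

/-- The tilting factor cancels in the quotient; it is inserted because only the tilted terms have
non-trivial limits. -/
lemma condProb_eq {i : Fin (N + 1)} (hi : i ≠ 0) (j : Fin (N + 1)) (ρ : ℝ) (n : ℕ) :
    X.condProb i j n =
      tilt ρ (hSeries T 0 j i) n / ∑ s : Fin N, tilt ρ (hSeries T 0 s.succ i) n := by
  have hm : MeasurableSet {ω | (n : ℕ∞) < X.μ 0 ω} := by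
    rw [survivors_eq]
    exact Finset.measurableSet_biUnion _ fun s _ => X.measurableSet_survivors s n
  have h1 : X.P i ({ω | (n : ℕ∞) < X.μ 0 ω} ∩ {ω | X.ξ n ω = j}) =
      coeff n (hSeries T 0 j i) := by
    rw [← X.h_eq hi, h]
    simp only [min_self]
    congr 1
    ext ω
    exact and_comm
  rw [condProb, Measure.real, ProbabilityTheory.cond_apply hm, h1, X.measure_survivors hi,
    ENNReal.toReal_mul, ENNReal.toReal_inv,
    ENNReal.toReal_sum fun s _ => coeff_hSeries_ne_top X hi 0 _ n]
  unfold tilt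
  rw [← mul_sum, mul_div_mul_left _ _ (Real.exp_pos _).ne', div_eq_inv_mul]

/-- The quasi-stationary distribution and its representation by a ratio of functionals. -/
theorem isQuasiStationary (hT : Communicates T) {i : Fin (N + 1)} (hi : i ≠ 0)
    (hper : NonPeriodic fun n => coeff n (gSeries T i i)) {ρ ρ' : ℝ}
    (hφ : mom ρ 0 (gSeries T i i) = 1) (hρ : ρ < ρ') (hφ' : mom ρ' 0 (gSeries T i i) ≠ ⊤)
    (hS : ∀ s, s ≠ 0 → mom ρ 0 (survival T s) ≠ ⊤) :
    X.IsQuasiStationary (fun j => (X.omega i i j ρ 0).toReal /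
      ∑ s : Fin N, (X.omega i i s.succ ρ 0).toReal) := by
  have hg : mom ρ 0 (gSeries T i i) ≠ ⊤ := by rw [hφ]; simp
  obtain ⟨m, hm, hlim⟩ := tendsto_tilt X hT hi hper hφ hρ hφ'
  have hsum : 0 < ∑ s : Fin N, (X.omega i i s.succ ρ 0).toReal := by
    obtain ⟨t, rfl⟩ := Fin.exists_succ_eq.2 hi
    refine sum_pos' (fun _ _ => ENNReal.toReal_nonneg) ⟨t, mem_univ t, ?_⟩
    rw [X.omega_eq hi]
    refine ENNReal.toReal_pos ?_ (mom_hSeries_ne_top hT hi hg (hS _ hi) _)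
    rw [mom_hSeries, green_self, one_mul, Ne, mom_eq_zero_iff]
    exact survival_ne_zero T _
  intro l hl
  set c := (mom ρ 0 (gSeries T i l)).toReal with hc
  have hcpos : 0 < c :=
    ENNReal.toReal_pos (hT.gSeries_pos ρ hi hl) (mom_gSeries_ne_top hT hi hg hl)
  have hden : Tendsto (fun n => ∑ s : Fin N, tilt ρ (hSeries T 0 s.succ l) n) atTop
      (𝓝 (∑ s : Fin N, c * ((X.omega i i s.succ ρ 0).toReal / m))) := by
    refine tendsto_finsetSum _ fun s _ => ?_
    rw [X.omega_eq hi]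
    exact hlim l s.succ hl (hS _ (Fin.succ_ne_zero s))
  have hdeneq : ∑ s : Fin N, c * ((X.omega i i s.succ ρ 0).toReal / m) =
      c / m * ∑ s : Fin N, (X.omega i i s.succ ρ 0).toReal := by
    rw [mul_sum]
    exact sum_congr rfl fun s _ => by ring
  rw [hdeneq] at hden
  have hcm : 0 < c / m := div_pos hcpos hm
  constructor
  · intro n h0
    -- The tilted survival probabilities have a positive limit, so survival up to some later time
    -- has positive probability, and hence also survival up to n.
    have hev := hden.eventually_ne (mul_pos hcm hsum).ne'
    obtain ⟨n', hn', hne⟩ := ((eventually_ge_atTop n).and hev).exists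
    refine hne (sum_eq_zero fun s _ => ?_)
    have h1 : X.P l {ω | (n' : ℕ∞) < X.μ 0 ω} = 0 := by
      refine measure_mono_null (fun ω hω => ?_) h0
      exact (show (n : ℕ∞) ≤ n' by exact_mod_cast hn').trans_lt hω
    rw [X.measure_survivors hl, sum_eq_zero_iff] at h1
    simp [tilt, h1 s (mem_univ s)]
  · intro j hj
    have hnum := hlim l j hl (hS j hj)
    rw [← X.omega_eq hi] at hnum
    have := hnum.div hden (mul_pos hcm hsum).ne'
    have heq : c * ((X.omega i i j ρ 0).toReal / m) /
        (c / m * ∑ s : Fin N, (X.omega i i s.succ ρ 0).toReal) =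
        (X.omega i i j ρ 0).toReal / ∑ s : Fin N, (X.omega i i s.succ ρ 0).toReal := by
      field_simp
    rw [← hc, heq] at this
    refine this.congr fun n => ?_
    exact (X.condProb_eq hl j ρ n).symm

/-- At the root, changing the reference state multiplies all functionals by one positive Green
value. -/
lemma omega_ratio_eq (hT : Communicates T) {i i' : Fin (N + 1)} (hi : i ≠ 0) (hi' : i' ≠ 0)
    {ρ : ℝ} (hφ : mom ρ 0 (gSeries T i i) = 1) (j : Fin (N + 1)) :
    (X.omega i i j ρ 0).toReal / ∑ s : Fin N, (X.omega i i s.succ ρ 0).toReal =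
      (X.omega i' i' j ρ 0).toReal / ∑ s : Fin N, (X.omega i' i' s.succ ρ 0).toReal := by
  have h1 : ∀ s, (X.omega i i s ρ 0).toReal =
      (green (tabooMom T ρ i) i i').toReal * (X.omega i' i' s ρ 0).toReal := by
    intro s
    rw [X.omega_eq hi, X.omega_eq hi', mom_hSeries, mom_hSeries,
      (hT.solidarity hi hi' hφ).2 s, mul_assoc, ENNReal.toReal_mul]
  simp only [h1]
  rw [← mul_sum, mul_div_mul_left]
  exact ENNReal.toReal_ne_zero.2 ⟨hT.green_pos ρ hi hi',
    hT.green_ne_top hi (by rw [hφ]; simp) i i'⟩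

end MarkovRenewalProcess

end QSD

namespace QSD

open PowerSeries Finset Asymptotics

/-! ### Asymptotic expansions -/

section Expansions

/-- `x ε` is given by the formal power series `p` up to `o(ε ^ m)` as `0 < ε → 0`. -/
def Expands (x : ℝ≥0 → ℝ) (p : PowerSeries ℝ) (m : ℕ) : Prop :=
  (fun ε : ℝ≥0 => x ε - ∑ n ∈ range (m + 1), coeff n p * (ε : ℝ) ^ n)
      =o[𝓝[>] (0 : ℝ≥0)] fun ε : ℝ≥0 => (ε : ℝ) ^ m

lemma hasExpansion_iff {x : ℝ≥0 → ℝ} {c : ℕ → ℝ} {m : ℕ} :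
    HasExpansion x c m ↔ x 0 = c 0 ∧ Expands x (mk c) m := by
  simp [HasExpansion, Expands]

lemma tendsto_coe_zero : Tendsto (fun ε : ℝ≥0 => (ε : ℝ)) (𝓝[>] 0) (𝓝 0) :=
  (NNReal.continuous_coe.tendsto 0).mono_left nhdsWithin_le_nhds

lemma eventually_coe_pos : ∀ᶠ ε : ℝ≥0 in 𝓝[>] 0, (0 : ℝ) < ε := by
  filter_upwards [self_mem_nhdsWithin] with ε hε
  exact_mod_cast hε

lemma isBigO_eval (P : Polynomial ℝ) :
    (fun ε : ℝ≥0 => P.eval (ε : ℝ)) =O[𝓝[>] 0] fun _ => (1 : ℝ) :=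
  ((P.continuous.tendsto 0).comp tendsto_coe_zero).isBigO_one ℝ

lemma isBigO_pow {m m' : ℕ} (h : m' ≤ m) :
    (fun ε : ℝ≥0 => (ε : ℝ) ^ m) =O[𝓝[>] 0] fun ε : ℝ≥0 => (ε : ℝ) ^ m' := by
  have : (fun ε : ℝ≥0 => (ε : ℝ) ^ (m - m') * (ε : ℝ) ^ m') =O[𝓝[>] 0]
      fun ε : ℝ≥0 => 1 * (ε : ℝ) ^ m' := by
    refine IsBigO.mul ?_ (isBigO_refl _ _)
    simpa using isBigO_eval (Polynomial.X ^ (m - m'))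
  refine this.congr (fun ε => ?_) (fun ε => one_mul _)
  rw [← pow_add]; congr 1; omega

lemma isLittleO_eval {P : Polynomial ℝ} {m : ℕ} (h : ∀ n ≤ m, P.coeff n = 0) :
    (fun ε : ℝ≥0 => P.eval (ε : ℝ)) =o[𝓝[>] 0] fun ε : ℝ≥0 => (ε : ℝ) ^ m := by
  obtain ⟨Q, rfl⟩ := Polynomial.X_pow_dvd_iff.2 fun n (hn : n < m + 1) => h n (by omega)
  have h1 : (fun ε : ℝ≥0 => ((ε : ℝ) * Q.eval (ε : ℝ)) * (ε : ℝ) ^ m) =o[𝓝[>] 0]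
      fun ε : ℝ≥0 => (1 : ℝ) * (ε : ℝ) ^ m := by
    refine IsLittleO.mul_isBigO ?_ (isBigO_refl _ _)
    have := (isLittleO_one_iff ℝ).2 tendsto_coe_zero
    simpa using this.mul_isBigO (isBigO_eval Q)
  refine h1.congr (fun ε => ?_) fun ε => one_mul _
  simp only [Polynomial.eval_mul, Polynomial.eval_pow, Polynomial.eval_X]
  ring

lemma eval_trunc (p : PowerSeries ℝ) (m : ℕ) (t : ℝ) :
    (trunc (m + 1) p).eval t = ∑ n ∈ range (m + 1), coeff n p * t ^ n := by
  rw [← Polynomial.eval₂_id, eval₂_trunc_eq_sum_range]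
  simp

/-- Coefficients of P above degree m do not matter, so sums and products of truncations can be used
without truncating again. -/
lemma expands_of_eval {x : ℝ≥0 → ℝ} {p : PowerSeries ℝ} {m : ℕ} {P : Polynomial ℝ}
    (h : (fun ε : ℝ≥0 => x ε - P.eval (ε : ℝ)) =o[𝓝[>] 0] fun ε : ℝ≥0 => (ε : ℝ) ^ m)
    (hP : ∀ n ≤ m, P.coeff n = coeff n p) : Expands x p m := by
  have h1 : (fun ε : ℝ≥0 => (P - trunc (m + 1) p).eval (ε : ℝ)) =o[𝓝[>] 0]
      fun ε : ℝ≥0 => (ε : ℝ) ^ m := by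
    refine isLittleO_eval fun n hn => ?_
    rw [Polynomial.coeff_sub, coeff_trunc, if_pos (by omega), hP n hn, sub_self]
  refine (h.add h1).congr_left fun ε => ?_
  rw [Polynomial.eval_sub, eval_trunc]
  ring

lemma Expands.eval {x : ℝ≥0 → ℝ} {p : PowerSeries ℝ} {m : ℕ} (h : Expands x p m) :
    (fun ε : ℝ≥0 => x ε - (trunc (m + 1) p).eval (ε : ℝ)) =o[𝓝[>] 0]
      fun ε : ℝ≥0 => (ε : ℝ) ^ m := by
  refine IsLittleO.congr_left h fun ε => ?_
  rw [eval_trunc]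

lemma expands_trunc (p : PowerSeries ℝ) (m : ℕ) :
    Expands (fun ε => (trunc (m + 1) p).eval (ε : ℝ)) p m := by
  unfold Expands
  simp only [eval_trunc, sub_self]
  exact isLittleO_zero _ _

variable {x y : ℝ≥0 → ℝ} {p q : PowerSeries ℝ} {m m' : ℕ}

lemma Expands.congr_series (h : Expands x p m) (hpq : ∀ n ≤ m, coeff n p = coeff n q) :
    Expands x q m := by
  refine expands_of_eval h.eval fun n hn => ?_
  rw [coeff_trunc, if_pos (by omega), hpq n hn]

lemma Expands.mono (h : Expands x p m) (hm : m' ≤ m) : Expands x p m' := by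
  refine expands_of_eval (h.eval.trans_isBigO (isBigO_pow hm)) fun n hn => ?_
  rw [coeff_trunc, if_pos (by omega)]

lemma Expands.congr (h : Expands x p m) (hxy : ∀ᶠ ε in 𝓝[>] 0, x ε = y ε) : Expands y p m := by
  refine IsLittleO.congr' h ?_ (EventuallyEq.refl _ _)
  filter_upwards [hxy] with ε hε
  rw [hε]

lemma Expands.isBigO_one (h : Expands x p m) : x =O[𝓝[>] 0] fun _ => (1 : ℝ) := by
  have h1 : (fun ε : ℝ≥0 => (ε : ℝ) ^ m) =O[𝓝[>] 0] fun _ => (1 : ℝ) := by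
    simpa using isBigO_pow (Nat.zero_le m)
  refine ((h.eval.isBigO.trans h1).add (isBigO_eval (trunc (m + 1) p))).congr_left fun ε => ?_
  ring

lemma Expands.add (h : Expands x p m) (h' : Expands y q m) :
    Expands (fun ε => x ε + y ε) (p + q) m := by
  refine expands_of_eval (P := trunc (m + 1) p + trunc (m + 1) q) ?_ fun n hn => ?_
  · refine (IsLittleO.add h.eval h'.eval).congr_left fun ε => ?_
    rw [Polynomial.eval_add]; ring
  · rw [Polynomial.coeff_add, coeff_trunc, coeff_trunc, if_pos (by omega), if_pos (by omega),
      map_add]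

lemma Expands.mul (h : Expands x p m) (h' : Expands y q m) :
    Expands (fun ε => x ε * y ε) (p * q) m := by
  refine expands_of_eval (P := trunc (m + 1) p * trunc (m + 1) q) ?_ fun n hn => ?_
  · have h1 := h.eval.mul_isBigO h'.isBigO_one
    have h2 := (isBigO_eval (trunc (m + 1) p)).mul_isLittleO h'.eval
    simp only [mul_one] at h1
    simp only [one_mul] at h2
    refine (h1.add h2).congr_left fun ε => ?_
    rw [Polynomial.eval_mul]; ring
  · rw [coeff_mul_eq_coeff_trunc_mul_trunc p q (show n < m + 1 by omega), ← Polynomial.coe_mul,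
      Polynomial.coeff_coe]

lemma expands_const (c : ℝ) (m : ℕ) : Expands (fun _ => c) (C c) m := by
  refine expands_of_eval (P := Polynomial.C c) ?_ fun n _ => ?_
  · simp only [Polynomial.eval_C, sub_self]; exact isLittleO_zero _ _
  · rw [Polynomial.coeff_C, coeff_C]

lemma Expands.const_mul (h : Expands x p m) (c : ℝ) : Expands (fun ε => c * x ε) (C c * p) m :=
  (expands_const c m).mul h

lemma Expands.sub (h : Expands x p m) (h' : Expands y q m) :
    Expands (fun ε => x ε - y ε) (p - q) m := by
  have := h.add (h'.const_mul (-1))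
  convert this using 1
  · funext ε; ring
  · simp [sub_eq_add_neg]

lemma Expands.sum {ι : Type*} {s : Finset ι} {x : ι → ℝ≥0 → ℝ} {p : ι → PowerSeries ℝ}
    (h : ∀ i ∈ s, Expands (x i) (p i) m) :
    Expands (fun ε => ∑ i ∈ s, x i ε) (∑ i ∈ s, p i) m := by
  classical
  induction s using Finset.induction_on with
  | empty => simpa using expands_const 0 m
  | insert i s hi ih =>
    simp only [sum_insert hi]
    exact (h i (mem_insert_self i s)).add (ih fun j hj => h j (mem_insert_of_mem hj))

lemma Expands.pow (h : Expands x p m) (r : ℕ) : Expands (fun ε => x ε ^ r) (p ^ r) m := by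
  induction r with
  | zero => simpa using expands_const 1 m
  | succ r ih => simpa only [pow_succ] using ih.mul h

lemma Expands.X_pow_mul (h : Expands x p m) (r : ℕ) :
    Expands (fun ε => (ε : ℝ) ^ r * x ε) (PowerSeries.X ^ r * p) (m + r) := by
  refine expands_of_eval (P := Polynomial.X ^ r * trunc (m + 1) p) ?_ fun n hn => ?_
  · have := (isBigO_refl (fun ε : ℝ≥0 => (ε : ℝ) ^ r) (𝓝[>] 0)).mul_isLittleO h.eval
    refine this.congr (fun ε => ?_) fun ε => by ring
    simp only [Polynomial.eval_mul, Polynomial.eval_pow, Polynomial.eval_X]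
    ring
  · rw [Polynomial.coeff_X_pow_mul', coeff_X_pow_mul']
    split_ifs with h'
    · rw [coeff_trunc, if_pos (by omega)]
    · rfl

lemma Expands.div_X (h : Expands x (PowerSeries.X * p) (m + 1)) :
    Expands (fun ε => x ε / ε) p m := by
  refine expands_of_eval (P := trunc (m + 1) p) ?_ fun n hn => ?_
  · have h2 := (isBigO_refl (fun ε : ℝ≥0 => (ε : ℝ)⁻¹) (𝓝[>] 0)).mul_isLittleO h.eval
    refine h2.congr' ?_ ?_
    · filter_upwards [eventually_coe_pos] with ε hε
      rw [eval_trunc, eval_trunc, sum_range_succ', coeff_zero_X_mul]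
      simp only [coeff_succ_X_mul, pow_succ, ← mul_assoc, ← sum_mul]
      field_simp
      ring
    · filter_upwards [eventually_coe_pos] with ε hε
      field_simp
      ring
  · rw [coeff_trunc, if_pos (by omega)]

lemma expands_zero_iff : Expands x p 0 ↔ Tendsto x (𝓝[>] 0) (𝓝 (coeff 0 p)) := by
  simp only [Expands, zero_add, range_one, sum_singleton, pow_zero, mul_one]
  rw [isLittleO_one_iff, tendsto_sub_nhds_zero_iff]

lemma Expands.tendsto (h : Expands x p m) : Tendsto x (𝓝[>] 0) (𝓝 (coeff 0 p)) :=
  expands_zero_iff.1 (h.mono (Nat.zero_le m))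

lemma expands_of_isLittleO
    (h : x =o[𝓝[>] 0] fun ε : ℝ≥0 => (ε : ℝ) ^ m) : Expands x 0 m := by
  simpa [Expands] using h

/-- The first differing coefficient would leave a term of exact order ε^n. This uniqueness produces
the recursions for the root and for the quotient. -/
lemma Expands.coeff_eq (h : Expands x p m) (h' : Expands x q m) :
    ∀ n ≤ m, coeff n p = coeff n q := by
  have h0 : Expands (fun _ => 0) (p - q) m :=
    (h.sub h').congr (Filter.Eventually.of_forall fun ε => by ring)
  suffices hs : ∀ n ≤ m, coeff n (p - q) = 0 by
    intro n hn
    have := hs n hn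
    rwa [map_sub, sub_eq_zero] at this
  intro n
  induction n using Nat.strong_induction_on with
  | _ n ih =>
    intro hn
    have h1 := h0.mono hn
    simp only [Expands, sum_range_succ] at h1
    have h2 : ∀ ε : ℝ≥0, (0 : ℝ) - (∑ k ∈ range n, coeff k (p - q) * (ε : ℝ) ^ k +
        coeff n (p - q) * (ε : ℝ) ^ n) = -coeff n (p - q) * (ε : ℝ) ^ n := by
      intro ε
      rw [sum_eq_zero fun k hk => by
        rw [ih k (Finset.mem_range.1 hk) (by have := Finset.mem_range.1 hk; omega), zero_mul]]
      ring
    simp only [h2] at h1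
    by_contra hne
    rw [isLittleO_const_mul_left_iff (neg_ne_zero.2 hne)] at h1
    have h3 := (isLittleO_irrefl' (f' := fun ε : ℝ≥0 => (ε : ℝ) ^ n) (l := 𝓝[>] 0) ?_) h1
    · exact h3
    · refine Filter.Eventually.frequently ?_
      filter_upwards [eventually_coe_pos] with ε hε
      exact norm_ne_zero_iff.2 (pow_pos hε n).ne'

/-- The truncated formal inverse differs from 1/x by the bounded factor 1/x times 1 - x ·
(truncation), which is negligible because p p⁻¹ = 1. -/
lemma Expands.inv (h : Expands x p m) (hp : coeff 0 p ≠ 0) :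
    Expands (fun ε => (x ε)⁻¹) p⁻¹ m := by
  have hp' : constantCoeff p ≠ 0 := by rwa [← coeff_zero_eq_constantCoeff_apply]
  have h1 : Expands (fun ε => 1 - x ε * (trunc (m + 1) p⁻¹).eval (ε : ℝ)) (C 1 - p * p⁻¹) m :=
    (expands_const 1 m).sub (h.mul (expands_trunc p⁻¹ m))
  rw [PowerSeries.mul_inv_cancel p hp', map_one, sub_self] at h1
  have h2 : (fun ε => (x ε)⁻¹) =O[𝓝[>] 0] fun _ => (1 : ℝ) :=
    (h.tendsto.inv₀ hp).isBigO_one ℝ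
  have h1' : (fun ε => 1 - x ε * (trunc (m + 1) p⁻¹).eval (ε : ℝ)) =o[𝓝[>] 0]
      fun ε : ℝ≥0 => (ε : ℝ) ^ m := by simpa [Expands] using h1
  have h3 := h2.mul_isLittleO h1'
  refine expands_of_eval (P := trunc (m + 1) p⁻¹) (h3.congr' ?_ ?_) fun n hn => ?_
  · filter_upwards [h.tendsto.eventually_ne hp] with ε hε
    field_simp
  · exact Filter.Eventually.of_forall fun ε => one_mul _
  · rw [coeff_trunc, if_pos (by omega)]

end Expansions

/-! ### Expansions of solutions of linear systems -/

section LinearSystems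

variable {ι : Type*} [Fintype ι]

lemma Expands.mulVec {A : ℝ≥0 → Matrix ι ι ℝ} {v : ℝ≥0 → ι → ℝ}
    {A' : Matrix ι ι (PowerSeries ℝ)} {v' : ι → PowerSeries ℝ} {m : ℕ}
    (hA : ∀ a b, Expands (fun ε => A ε a b) (A' a b) m)
    (hv : ∀ a, Expands (fun ε => v ε a) (v' a) m) (l : ι) :
    Expands (fun ε => (A ε *ᵥ v ε) l) ((A' *ᵥ v') l) m := by
  simp only [Matrix.mulVec, dotProduct]
  exact Expands.sum fun a _ => (hA l a).mul (hv a)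

variable [DecidableEq ι]

/-- The truncated formal solution leaves a residual o(ε^m), and the inverse matrix, adjugate over
determinant, stays bounded. No prior information on the size of x is needed. -/
lemma expands_of_linear {A : ℝ≥0 → Matrix ι ι ℝ} {x b : ℝ≥0 → ι → ℝ}
    {A' : Matrix ι ι (PowerSeries ℝ)} {x' b' : ι → PowerSeries ℝ} {m : ℕ}
    (hA : ∀ a c, Expands (fun ε => A ε a c) (A' a c) m)
    (hb : ∀ a, Expands (fun ε => b ε a) (b' a) m)
    (hdet : IsUnit (A'.map (coeff 0)).det)
    (hx : ∀ᶠ ε in 𝓝[>] 0, A ε *ᵥ x ε = b ε) (hx' : A' *ᵥ x' = b') (l : ι) :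
    Expands (fun ε => x ε l) (x' l) m := by
  set X : ℝ≥0 → ι → ℝ := fun ε a => (trunc (m + 1) (x' a)).eval (ε : ℝ) with hX
  have h1 : ∀ a, Expands (fun ε => b ε a - (A ε *ᵥ X ε) a) 0 m := by
    intro a
    have := (hb a).sub (Expands.mulVec hA (fun c => expands_trunc (x' c) m) a)
    rwa [hx', sub_self] at this
  have hlim : Tendsto A (𝓝[>] 0) (𝓝 (A'.map (coeff 0))) := by
    exact tendsto_pi_nhds.2 fun a => tendsto_pi_nhds.2 fun c => (hA a c).tendsto
  have hd : Tendsto (fun ε => (A ε).det) (𝓝[>] 0) (𝓝 (A'.map (coeff 0)).det) :=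
    ((continuous_id.matrix_det).tendsto _).comp hlim
  have hadj : Tendsto (fun ε => (A ε).adjugate) (𝓝[>] 0) (𝓝 (A'.map (coeff 0)).adjugate) :=
    ((continuous_id.matrix_adjugate).tendsto _).comp hlim
  have hO : ∀ a c, (fun ε => (A ε).det⁻¹ * (A ε).adjugate a c) =O[𝓝[>] 0] fun _ => (1 : ℝ) := by
    intro a c
    have h2 : Tendsto (fun ε => (A ε).adjugate a c) (𝓝[>] 0)
        (𝓝 ((A'.map (coeff 0)).adjugate a c)) :=
      tendsto_pi_nhds.1 (tendsto_pi_nhds.1 hadj a) c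
    exact ((hd.inv₀ hdet.ne_zero).mul h2).isBigO_one ℝ
  have h3 : (fun ε => ∑ c, ((A ε).det⁻¹ * (A ε).adjugate l c) * (b ε c - (A ε *ᵥ X ε) c))
      =o[𝓝[>] 0] fun ε : ℝ≥0 => (ε : ℝ) ^ m := by
    refine IsLittleO.fun_sum fun c _ => ?_
    have h4 : (fun ε => b ε c - (A ε *ᵥ X ε) c) =o[𝓝[>] 0] fun ε : ℝ≥0 => (ε : ℝ) ^ m := by
      simpa [Expands] using h1 c
    simpa using (hO l c).mul_isLittleO h4
  refine expands_of_eval (P := trunc (m + 1) (x' l)) (h3.congr' ?_ (EventuallyEq.refl _ _))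
    fun n hn => by rw [coeff_trunc, if_pos (by omega)]
  filter_upwards [hx, hd.eventually_ne hdet.ne_zero] with ε hε hne
  have h5 : (A ε).adjugate *ᵥ (b ε - A ε *ᵥ X ε) = (A ε).det • (x ε - X ε) := by
    rw [← hε, ← Matrix.mulVec_sub, Matrix.mulVec_mulVec, Matrix.adjugate_mul,
      Matrix.smul_mulVec, Matrix.one_mulVec]
  have h6 := congrFun h5 l
  simp only [Matrix.mulVec, dotProduct, Pi.sub_apply, Pi.smul_apply, smul_eq_mul] at h6
  simp only [mul_assoc, ← mul_sum, Matrix.mulVec, dotProduct]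
  rw [h6, inv_mul_cancel_left₀ hne]

end LinearSystems

/-! ### The linear recursions of the algorithm as identities of formal series -/

section Algorithm

variable {N : ℕ}

lemma sum_range_sub_eq_antidiagonal {M : Type*} [AddCommMonoid M] (F : ℕ → ℕ → M) (n : ℕ) :
    ∑ q ∈ range (n + 1), F (n - q) q = ∑ p ∈ antidiagonal n, F p.1 p.2 := by
  rw [← Finset.Nat.sum_antidiagonal_swap,
    ← Finset.Nat.sum_antidiagonal_eq_sum_range_succ (fun i j => F j i)]
  rfl

/-- The matrix of formal power series with given matrices of coefficients. -/
noncomputable def matSeries (M : ℕ → Matrix (Fin (N + 1)) (Fin (N + 1)) ℝ) :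
    Matrix (Fin (N + 1)) (Fin (N + 1)) (PowerSeries ℝ) :=
  Matrix.of fun a b => mk fun n => M n a b

/-- The vector of formal power series with given vectors of coefficients. -/
noncomputable def vecSeries (v : ℕ → Fin (N + 1) → ℝ) (a : Fin (N + 1)) : PowerSeries ℝ :=
  mk fun n => v n a

lemma matSeries_mulVec (M : ℕ → Matrix (Fin (N + 1)) (Fin (N + 1)) ℝ)
    (v : ℕ → Fin (N + 1) → ℝ) :
    matSeries M *ᵥ vecSeries v = vecSeries fun n => ∑ q ∈ range (n + 1), M (n - q) *ᵥ v q := by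
  ext a n
  simp only [matSeries, vecSeries, Matrix.mulVec, dotProduct, Matrix.of_apply, map_sum, coeff_mul,
    coeff_mk, Finset.sum_apply]
  rw [sum_comm, sum_range_sub_eq_antidiagonal (fun i j => ∑ x, M i a x * v j x)]

/-- The recursion for the inverse is exactly the vanishing of the coefficients of positive order in
this product. -/
lemma one_sub_mul_inverseCoeff (M : ℕ → Matrix (Fin (N + 1)) (Fin (N + 1)) ℝ)
    (h : IsUnit (1 - M 0).det) : (1 - matSeries M) * matSeries (inverseCoeff M) = 1 := by
  have key : ∀ n, inverseCoeff M n - ∑ p ∈ antidiagonal n, M p.1 * inverseCoeff M p.2 =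
      if n = 0 then 1 else 0 := by
    intro n
    rw [← sum_range_sub_eq_antidiagonal (fun i j => M i * inverseCoeff M j)]
    cases n with
    | zero =>
      simp only [zero_add, range_one, sum_singleton, Nat.sub_zero, if_true]
      rw [inverseCoeff, ← one_sub_mul]
      exact Matrix.mul_nonsing_inv _ h
    | succ n =>
      rw [sum_range_succ, Nat.sub_self, if_neg (Nat.succ_ne_zero n)]
      have h1 : inverseCoeff M (n + 1) = (1 - M 0)⁻¹ *
          ∑ q ∈ range (n + 1), M (n + 1 - q) * inverseCoeff M q := by
        rw [inverseCoeff, ← Fin.sum_univ_eq_sum_range (fun q => M (n + 1 - q) * inverseCoeff M q)]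
      have h2 : (1 - M 0) * inverseCoeff M (n + 1) =
          ∑ q ∈ range (n + 1), M (n + 1 - q) * inverseCoeff M q := by
        rw [h1, ← mul_assoc, Matrix.mul_nonsing_inv _ h, one_mul]
      rw [← h2, sub_mul, one_mul]
      abel
  ext a b n
  have h1 := congrFun (congrFun (key n) a) b
  rw [sub_mul, one_mul, Matrix.sub_apply, map_sub, Matrix.mul_apply, map_sum]
  simp only [matSeries, Matrix.of_apply, coeff_mul, coeff_mk]
  rw [sum_comm]
  rw [Matrix.sub_apply, Matrix.sum_apply] at h1
  simp only [Matrix.mul_apply] at h1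
  rw [h1]
  by_cases hn : n = 0
  · rw [if_pos hn, Matrix.one_apply, Matrix.one_apply]
    split_ifs <;> simp [coeff_one, hn]
  · rw [if_neg hn, Matrix.one_apply]
    split_ifs <;> simp [coeff_one, hn]

/-- The solution series of the algorithm solve the linear systems formally. -/
lemma one_sub_mulVec_solutionCoeff (M : ℕ → ℕ → Matrix (Fin (N + 1)) (Fin (N + 1)) ℝ)
    (θ : ℕ → ℕ → Fin (N + 1) → ℝ) (h : IsUnit (1 - M 0 0).det) (r : ℕ) :
    (1 - matSeries (M 0)) *ᵥ vecSeries (solutionCoeff M θ r) =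
      vecSeries (θ r) + ∑ m ∈ range r, (C (r.choose m : ℝ)) •
        (matSeries (M (r - m)) *ᵥ vecSeries (solutionCoeff M θ m)) := by
  have h1 : vecSeries (θ r) + ∑ m ∈ range r, (C (r.choose m : ℝ)) •
        (matSeries (M (r - m)) *ᵥ vecSeries (solutionCoeff M θ m)) =
      vecSeries fun q => (θ r q + ∑ m : Fin r, (r.choose m : ℝ) •
      ∑ s ∈ range (q + 1), M (r - m) (q - s) *ᵥ solutionCoeff M θ m s) := by
    simp only [matSeries_mulVec]
    ext a n
    simp only [Pi.add_apply, Finset.sum_apply, Pi.smul_apply, map_add, map_sum, smul_eq_mul,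
      coeff_C_mul, vecSeries, coeff_mk]
    rw [Fin.sum_univ_eq_sum_range (fun m => (r.choose m : ℝ) *
      ∑ s ∈ range (n + 1), (M (r - m) (n - s) *ᵥ solutionCoeff M θ m s) a)]
  have h2 : vecSeries (solutionCoeff M θ r) = matSeries (inverseCoeff (M 0)) *ᵥ
      (vecSeries (θ r) + ∑ m ∈ range r, (C (r.choose m : ℝ)) •
        (matSeries (M (r - m)) *ᵥ vecSeries (solutionCoeff M θ m))) := by
    rw [h1, matSeries_mulVec]
    congr 1
    funext n
    rw [solutionCoeff]
  rw [h2, Matrix.mulVec_mulVec, one_sub_mul_inverseCoeff (M 0) h, Matrix.one_mulVec]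

/-- Solutions of linear systems have the expansions computed by the algorithm. -/
theorem expands_solution {M : ℕ → ℕ → Matrix (Fin (N + 1)) (Fin (N + 1)) ℝ}
    {θ : ℕ → ℕ → Fin (N + 1) → ℝ} (h : IsUnit (1 - M 0 0).det) {K : ℕ}
    {A : ℕ → ℝ≥0 → Matrix (Fin (N + 1)) (Fin (N + 1)) ℝ} {b x : ℕ → ℝ≥0 → Fin (N + 1) → ℝ}
    (hA : ∀ r ≤ K, ∀ a c, Expands (fun ε => A r ε a c) (matSeries (M r) a c) (K - r))
    (hb : ∀ r ≤ K, ∀ a, Expands (fun ε => b r ε a) (vecSeries (θ r) a) (K - r))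
    (hx : ∀ r ≤ K, ∀ᶠ ε in 𝓝[>] 0, x r ε = b r ε +
      ∑ m ∈ range (r + 1), (r.choose m : ℝ) • (A (r - m) ε *ᵥ x m ε)) :
    ∀ r ≤ K, ∀ a, Expands (fun ε => x r ε a) (vecSeries (solutionCoeff M θ r) a) (K - r) := by
  intro r
  induction r using Nat.strong_induction_on with
  | _ r ih =>
    intro hr
    refine expands_of_linear (A := fun ε => 1 - A 0 ε) (A' := 1 - matSeries (M 0))
      (b := fun ε => b r ε + ∑ m ∈ range r, (r.choose m : ℝ) • (A (r - m) ε *ᵥ x m ε))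
      ?_ ?_ ?_ ?_ (one_sub_mulVec_solutionCoeff M θ h r)
    · intro a c
      have h1 := (expands_const ((1 : Matrix (Fin (N + 1)) (Fin (N + 1)) ℝ) a c) (K - r)).sub
        ((hA 0 (Nat.zero_le K) a c).mono (show K - r ≤ K - 0 by omega))
      convert h1 using 1
      · rfl
      · rw [Matrix.sub_apply, Matrix.one_apply, Matrix.one_apply]
        split_ifs <;> simp
    · intro a
      simp only [Pi.add_apply, Finset.sum_apply, Pi.smul_apply, smul_eq_mul]
      refine (hb r hr a).add (Expands.sum fun m hm => ?_)
      have hm' := Finset.mem_range.1 hm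
      refine Expands.const_mul ?_ _
      exact Expands.mulVec (fun c d => (hA (r - m) (by omega) c d).mono (by omega))
        (fun c => (ih m hm' (by omega) c).mono (by omega)) a
    · convert h using 2
      ext a c
      simp only [Matrix.map_apply, Matrix.sub_apply, map_sub, matSeries, Matrix.of_apply, coeff_mk]
      congr 1
      rw [Matrix.one_apply, Matrix.one_apply]
      split_ifs <;> simp
    · filter_upwards [hx r hr] with ε hε
      rw [sum_range_succ, Nat.sub_self, Nat.choose_self, Nat.cast_one, one_smul] at hε
      rw [Matrix.sub_mulVec, Matrix.one_mulVec]
      nth_rw 1 [hε]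
      abel

end Algorithm

end QSD

namespace QSD

open PowerSeries Finset Asymptotics

/-! ### Composition of expansions -/

section Composition

/-- The formal series `c 1 * X + c 2 * X ^ 2 + ⋯`. -/
noncomputable def incrementSeries (c : ℕ → ℝ) : PowerSeries ℝ :=
  mk fun n => if n = 0 then 0 else c n

lemma X_dvd_incrementSeries (c : ℕ → ℝ) : (PowerSeries.X : PowerSeries ℝ) ∣ incrementSeries c := by
  rw [X_dvd_iff, ← coeff_zero_eq_constantCoeff_apply]
  simp [incrementSeries]

/-- Multinomial theorem: the exponent vectors of total m and weighted total q form D_{m,q}, and the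
multinomial coefficient is m! over the product of the n_p!. -/
lemma coeff_sum_pow (c : ℕ → ℝ) (m q : ℕ) :
    coeff q ((∑ p ∈ Icc 1 (q - 1), C (c p) * PowerSeries.X ^ p) ^ m) =
      (m.factorial : ℝ) * sumD c m q := by
  rw [sum_pow_eq_sum_piAntidiag, map_sum, sumD, mul_sum, sum_filter]
  refine sum_congr rfl fun k hk => ?_
  rw [mem_piAntidiag] at hk
  have h1 : ∏ p ∈ Icc 1 (q - 1), (C (c p) * PowerSeries.X ^ p) ^ k p =
      C (∏ p ∈ Icc 1 (q - 1), c p ^ k p) *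
        (PowerSeries.X : PowerSeries ℝ) ^ (∑ p ∈ Icc 1 (q - 1), p * k p) := by
    simp only [mul_pow, prod_mul_distrib, ← pow_mul, prod_pow_eq_pow_sum, map_prod, map_pow]
  have h2 : ((Nat.multinomial (Icc 1 (q - 1)) k : ℕ) : ℝ) * ∏ p ∈ Icc 1 (q - 1), c p ^ k p =
      m.factorial * ∏ p ∈ Icc 1 (q - 1), c p ^ k p / ((k p).factorial : ℝ) := by
    have h3 := Nat.multinomial_spec (Icc 1 (q - 1)) k
    rw [hk.1] at h3
    rw [prod_div_distrib, ← h3]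
    have h4 : (∏ p ∈ Icc 1 (q - 1), ((k p).factorial : ℝ)) ≠ 0 :=
      prod_ne_zero_iff.2 fun p _ => by exact_mod_cast Nat.factorial_ne_zero _
    push_cast
    field_simp
  rw [h1, ← map_natCast (C (R := ℝ)), ← mul_assoc, ← map_mul, coeff_C_mul, coeff_X_pow, h2]
  by_cases hq : ∑ p ∈ Icc 1 (q - 1), p * k p = q
  · rw [if_pos hq, if_pos hq.symm, mul_one]
  · rw [if_neg hq, if_neg (Ne.symm hq), mul_zero]

/-- Terms of degree q and more may be cut off: since m ≥ 2, such a term always meets another factor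
of positive order. This is why D_{m,q} involves c_1, …, c_{q-1} only. -/
lemma coeff_incrementSeries_pow (c : ℕ → ℝ) {m : ℕ} (hm : 2 ≤ m) (q : ℕ) :
    coeff q (incrementSeries c ^ m) = (m.factorial : ℝ) * sumD c m q := by
  rw [← coeff_sum_pow]
  set P : PowerSeries ℝ := ∑ p ∈ Icc 1 (q - 1), C (c p) * PowerSeries.X ^ p with hP
  have hXP : (PowerSeries.X : PowerSeries ℝ) ∣ P :=
    dvd_sum fun p hp => (dvd_pow_self _ (by have := (mem_Icc.1 hp).1; omega)).mul_left _
  have hX := X_dvd_incrementSeries c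
  have hdiff : (PowerSeries.X : PowerSeries ℝ) ^ q ∣ incrementSeries c - P := by
    rw [X_pow_dvd_iff]
    intro n hn
    rw [map_sub, hP, map_sum]
    simp only [coeff_C_mul, coeff_X_pow, mul_ite, mul_one, mul_zero, incrementSeries, coeff_mk]
    rw [sum_ite_eq]
    by_cases h0 : n = 0
    · simp [h0]
    · rw [if_neg h0, if_pos (mem_Icc.2 ⟨by omega, by omega⟩), sub_self]
  have hdvd : (PowerSeries.X : PowerSeries ℝ) ^ (q + 1) ∣ incrementSeries c ^ m - P ^ m := by
    rw [← (Commute.all (incrementSeries c) P).geom_sum₂_mul m, pow_succ, mul_comm]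
    refine mul_dvd_mul ?_ hdiff
    refine dvd_sum fun i _ => ?_
    rcases Nat.eq_zero_or_pos i with hi | hi
    · exact (dvd_pow hXP (by omega)).mul_left _
    · exact (dvd_pow hX (by omega)).mul_right _
  have := (X_pow_dvd_iff.1 hdvd) q (by omega)
  rwa [map_sub, sub_eq_zero] at this

/-- The formal Taylor series of a functional along the increment `c`. -/
noncomputable def taylorSeries (a : ℕ → ℕ → ℝ) (c : ℕ → ℝ) (K : ℕ) : PowerSeries ℝ :=
  ∑ r ∈ range (K + 1), C ((r.factorial : ℝ)⁻¹) * (incrementSeries c ^ r * mk (a r))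

lemma coeff_incrementSeries_pow_of_lt (c : ℕ → ℝ) {r q : ℕ} (h : q < r) :
    coeff q (incrementSeries c ^ r) = 0 :=
  (X_pow_dvd_iff.1 (pow_dvd_pow_of_dvd (X_dvd_incrementSeries c) r)) q h

/-- The powers r = 0, r = 1 and r ≥ 2 of the increment give the three groups of terms; powers r > n
do not reach the degree n. -/
lemma coeff_taylorSeries (a : ℕ → ℕ → ℝ) (c : ℕ → ℝ) {K n : ℕ} (hn : n ≤ K) :
    coeff n (taylorSeries a c K) = omegaStep a c n := by
  have hterm : ∀ r, coeff n (C ((r.factorial : ℝ)⁻¹) * (incrementSeries c ^ r * mk (a r))) =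
      ∑ q ∈ range (n + 1), (r.factorial : ℝ)⁻¹ * (coeff q (incrementSeries c ^ r) * a r (n - q)) := by
    intro r
    rw [coeff_C_mul, coeff_mul, mul_sum, Finset.Nat.sum_antidiagonal_eq_sum_range_succ
      (fun i j => (r.factorial : ℝ)⁻¹ * (coeff i (incrementSeries c ^ r) * coeff j (mk (a r))))]
    simp only [coeff_mk]
  have h0 : ∑ q ∈ range (n + 1), (Nat.factorial 0 : ℝ)⁻¹ *
      (coeff q (incrementSeries c ^ 0) * a 0 (n - q)) = a 0 n := by
    rw [sum_eq_single 0]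
    · simp
    · intro q _ hq
      simp [coeff_one, hq]
    · simp
  have h1 : ∑ q ∈ range (n + 1), (Nat.factorial 1 : ℝ)⁻¹ *
      (coeff q (incrementSeries c ^ 1) * a 1 (n - q)) = ∑ q ∈ Icc 1 n, a 1 (n - q) * c q := by
    symm
    refine sum_subset_zero_on_sdiff (fun q hq => ?_) (fun q hq => ?_) fun q hq => ?_
    · rw [mem_Icc] at hq; rw [Finset.mem_range]; omega
    · rw [Finset.mem_sdiff, Finset.mem_range, mem_Icc] at hq
      have : q = 0 := by omega
      simp [incrementSeries, this]
    · rw [mem_Icc] at hq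
      have : q ≠ 0 := by omega
      simp [incrementSeries, this, mul_comm]
  have h2 : ∀ r ∈ Icc 2 n, ∑ q ∈ range (n + 1), (r.factorial : ℝ)⁻¹ *
      (coeff q (incrementSeries c ^ r) * a r (n - q)) =
        ∑ q ∈ Icc r n, a r (n - q) * sumD c r q := by
    intro r hr
    rw [mem_Icc] at hr
    symm
    refine sum_subset_zero_on_sdiff (fun q hq => ?_) (fun q hq => ?_) fun q hq => ?_
    · rw [mem_Icc] at hq; rw [Finset.mem_range]; omega
    · rw [Finset.mem_sdiff, Finset.mem_range, mem_Icc] at hq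
      rw [coeff_incrementSeries_pow_of_lt c (by omega)]
      ring
    · rw [coeff_incrementSeries_pow c hr.1]
      have : (r.factorial : ℝ) ≠ 0 := by exact_mod_cast Nat.factorial_ne_zero r
      field_simp
  rw [taylorSeries, map_sum, omegaStep]
  simp only [hterm]
  have hsub : ∑ r ∈ range (K + 1), ∑ q ∈ range (n + 1), (r.factorial : ℝ)⁻¹ *
      (coeff q (incrementSeries c ^ r) * a r (n - q)) =
      ∑ r ∈ range (n + 2), ∑ q ∈ range (n + 1), (r.factorial : ℝ)⁻¹ *
        (coeff q (incrementSeries c ^ r) * a r (n - q)) := by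
    have hz : ∀ r, n < r → ∑ q ∈ range (n + 1), (r.factorial : ℝ)⁻¹ *
        (coeff q (incrementSeries c ^ r) * a r (n - q)) = 0 := by
      intro r hr
      refine sum_eq_zero fun q hq => ?_
      rw [Finset.mem_range] at hq
      rw [coeff_incrementSeries_pow_of_lt c (by omega)]
      ring
    rw [sum_range_succ _ (n + 1), hz (n + 1) (by omega), add_zero]
    symm
    refine sum_subset (fun r hr => ?_) fun r _ hr => hz r ?_
    · rw [Finset.mem_range] at *; omega
    · rw [Finset.mem_range] at hr; omega
  rw [hsub, sum_range_succ', sum_range_succ', h0]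
  rw [show ∑ k ∈ range n, ∑ q ∈ range (n + 1), (((k + 1 + 1).factorial : ℕ) : ℝ)⁻¹ *
      (coeff q (incrementSeries c ^ (k + 1 + 1)) * a (k + 1 + 1) (n - q)) =
      ∑ r ∈ Icc 2 n, ∑ q ∈ Icc r n, a r (n - q) * sumD c r q from ?_]
  · rw [zero_add, h1]; ring
  · rw [← sum_congr rfl h2]
    rcases Nat.eq_zero_or_pos n with hn0 | hn0
    · subst hn0; simp
    · obtain ⟨n', rfl⟩ : ∃ n', n = n' + 1 := ⟨n - 1, by omega⟩
      rw [sum_range_succ, sum_eq_zero (s := range (n' + 1 + 1)) (f := fun q =>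
        (((n' + 1 + 1).factorial : ℕ) : ℝ)⁻¹ * (coeff q (incrementSeries c ^ (n' + 1 + 1)) *
          a (n' + 1 + 1) (n' + 1 - q))), add_zero, ← Finset.Ico_add_one_right_eq_Icc,
          sum_Ico_eq_sum_range]
      · refine sum_congr (by congr 1) fun k _ => ?_
        rw [show 2 + k = k + 1 + 1 by ring]
      · intro q hq
        rw [Finset.mem_range] at hq
        rw [coeff_incrementSeries_pow_of_lt c (by omega)]
        ring

variable {Δ F : ℝ≥0 → ℝ} {Fr : ℕ → ℝ≥0 → ℝ} {a : ℕ → ℕ → ℝ} {K : ℕ}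

lemma Expands.pow_isLittleO {p : PowerSeries ℝ} (hΔ : Expands Δ p K)
    (hp : (PowerSeries.X : PowerSeries ℝ) ∣ p) :
    (fun ε => Δ ε ^ (K + 1)) =o[𝓝[>] 0] fun ε : ℝ≥0 => (ε : ℝ) ^ K := by
  have h1 : Expands (fun ε => Δ ε ^ (K + 1)) 0 K := by
    refine (hΔ.pow (K + 1)).congr_series fun n hn => ?_
    rw [(X_pow_dvd_iff.1 (pow_dvd_pow_of_dvd hp (K + 1))) n (by omega), map_zero]
  simpa [Expands] using h1

/-- Writing Δ^r = ε^r (Δ/ε)^r, the factor ε^r gains r orders. Hence the r-th moment is needed to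
order K - r only. -/
lemma Expands.pow_mul {p q : PowerSeries ℝ} {x : ℝ≥0 → ℝ} {r j : ℕ} (hΔ : Expands Δ p (j + 1))
    (hp : (PowerSeries.X : PowerSeries ℝ) ∣ p) (hx : Expands x q (j + 1 - r)) (hr : 1 ≤ r)
    (hrj : r ≤ j + 1) : Expands (fun ε => Δ ε ^ r * x ε) (p ^ r * q) (j + 1) := by
  obtain ⟨s, rfl⟩ := hp
  have h1 := (((hΔ.div_X.mono (show j + 1 - r ≤ j by omega)).pow r).mul hx).X_pow_mul r
  rw [show j + 1 - r + r = j + 1 by omega] at h1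
  rw [mul_pow, mul_assoc]
  refine h1.congr ?_
  filter_upwards [eventually_coe_pos] with ε hε
  rw [div_pow]
  field_simp

/-- Taylor expansion of a functional along an expansion of its argument. -/
theorem expands_taylor {c : ℕ → ℝ} (hFr : ∀ r ≤ K, Expands (Fr r) (mk (a r)) (K - r))
    (hΔ : Expands Δ (incrementSeries c) K)
    (hrem : (fun ε => F ε - ∑ r ∈ range (K + 1), (r.factorial : ℝ)⁻¹ * (Δ ε ^ r * Fr r ε))
      =O[𝓝[>] 0] fun ε => Δ ε ^ (K + 1)) :
    Expands F (taylorSeries a c K) K := by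
  have hX := X_dvd_incrementSeries c
  have h1 : Expands (fun ε => ∑ r ∈ range (K + 1), (r.factorial : ℝ)⁻¹ * (Δ ε ^ r * Fr r ε))
      (taylorSeries a c K) K := by
    refine Expands.sum fun r hr => Expands.const_mul ?_ _
    rw [Finset.mem_range] at hr
    rcases Nat.eq_zero_or_pos r with h0 | h0
    · subst h0
      simpa using hFr 0 (Nat.zero_le K)
    · obtain ⟨j, rfl⟩ : ∃ j, K = j + 1 := ⟨K - 1, by omega⟩
      exact hΔ.pow_mul hX (hFr r (by omega)) h0 (by omega)
  have h2 := h1.add (expands_of_isLittleO (hrem.trans_isLittleO (hΔ.pow_isLittleO hX)))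
  rw [add_zero] at h2
  refine h2.congr (Filter.Eventually.of_forall fun ε => ?_)
  ring

/-- Existence of an expansion of the increment of a root of an equation. -/
theorem exists_expands_root (hFr : ∀ r ≤ K, Expands (Fr r) (mk (a r)) (K - r))
    (h0 : a 0 0 = 1) (h1 : a 1 0 ≠ 0) (hΔ : Tendsto Δ (𝓝[>] 0) (𝓝 0))
    (hrem : (fun ε => 1 - ∑ r ∈ range (K + 1), (r.factorial : ℝ)⁻¹ * (Δ ε ^ r * Fr r ε))
      =O[𝓝[>] 0] fun ε => Δ ε ^ (K + 1)) :
    ∃ p : PowerSeries ℝ, (PowerSeries.X : PowerSeries ℝ) ∣ p ∧ Expands Δ p K := by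
  rcases Nat.eq_zero_or_pos K with hK | hK
  · subst hK
    exact ⟨0, dvd_zero _, expands_zero_iff.2 (by simpa using hΔ)⟩
  obtain ⟨J, rfl⟩ : ∃ J, K = J + 1 := ⟨K - 1, by omega⟩
  set R : ℝ≥0 → ℝ := fun ε =>
    1 - ∑ r ∈ range (J + 1 + 1), (r.factorial : ℝ)⁻¹ * (Δ ε ^ r * Fr r ε) with hR
  -- The equation is factored as Δ Ψ = 1 - F_0, so Δ/ε is a known expansion divided by Ψ.
  set Ψ : ℝ≥0 → ℝ := fun ε => Fr 1 ε + ∑ r ∈ range J,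
    ((r + 2).factorial : ℝ)⁻¹ * (Δ ε ^ (r + 1) * Fr (r + 2) ε) + R ε / Δ ε with hΨ
  have hW : (fun ε => R ε / Δ ε) =O[𝓝[>] 0] fun ε => Δ ε ^ (J + 1) := by
    obtain ⟨B, hB⟩ := hrem.bound
    refine IsBigO.of_bound B ?_
    filter_upwards [hB] with ε hε
    -- Where Δ vanishes the quotient is 0 by convention, so the bound holds without assuming Δ ≠ 0.
    by_cases h : Δ ε = 0
    · simp [h]
    · rw [norm_div, div_le_iff₀ (norm_pos_iff.2 h)]
      refine hε.trans_eq ?_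
      rw [norm_pow, norm_pow]; ring
  have hy : Expands (fun ε => (1 - Fr 0 ε) / ε) (mk fun n => -a 0 (n + 1)) J := by
    have h2 : Expands (fun ε => 1 - Fr 0 ε) (C 1 - mk (a 0)) (J + 1) :=
      (expands_const 1 _).sub (hFr 0 (Nat.zero_le _))
    refine Expands.div_X (h2.congr_series fun n _ => ?_)
    cases n with
    | zero => simp [h0]
    | succ n => rw [coeff_succ_X_mul, map_sub, coeff_C]; simp
  have heq : ∀ᶠ ε in 𝓝[>] (0 : ℝ≥0), (1 - Fr 0 ε) / ε = Δ ε / ε * Ψ ε := by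
    obtain ⟨B, hB⟩ := hrem.bound
    filter_upwards [hB] with ε hε
    have h3 : Δ ε * Ψ ε = 1 - Fr 0 ε := by
      have h4 : Δ ε * (R ε / Δ ε) = R ε := by
        by_cases h : Δ ε = 0
        · rw [h] at hε
          have : R ε = 0 := by simpa [h, hR] using hε
          rw [this]; simp
        · field_simp
      have h5 : R ε = 1 - Fr 0 ε - Δ ε * (Fr 1 ε + ∑ r ∈ range J,
          ((r + 2).factorial : ℝ)⁻¹ * (Δ ε ^ (r + 1) * Fr (r + 2) ε)) := by
        simp only [hR]
        rw [sum_range_succ', sum_range_succ', mul_add, mul_sum]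
        simp only [zero_add, Nat.factorial_zero, Nat.factorial_one, Nat.cast_one, inv_one, one_mul,
          pow_zero, pow_one]
        rw [sum_congr rfl fun r _ => show (((r + 1 + 1).factorial : ℕ) : ℝ)⁻¹ *
          (Δ ε ^ (r + 1 + 1) * Fr (r + 1 + 1) ε) = Δ ε * (((r + 2).factorial : ℝ)⁻¹ *
            (Δ ε ^ (r + 1) * Fr (r + 2) ε)) by ring]
        ring
      simp only [hΨ]
      rw [mul_add, h4, h5]
      ring
    rw [← h3]
    ring
  have hstep : ∀ j ≤ J, ∀ q : PowerSeries ℝ, Expands Ψ q j → coeff 0 q ≠ 0 →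
      ∃ s, Expands (fun ε => Δ ε / ε) s j := by
    intro j hj q hq hq0
    refine ⟨_, ((hy.mono hj).mul (hq.inv hq0)).congr ?_⟩
    filter_upwards [heq, hq.tendsto.eventually_ne hq0] with ε hε hne
    rw [hε, mul_inv_cancel_right₀ hne]
  -- Bootstrap: each Δ inside Ψ carries a factor ε, so knowing Δ/ε to order j gives Ψ to order j +
  -- 1, and then Δ/ε to order j + 1.
  have hmain : ∀ j ≤ J, ∃ s, Expands (fun ε => Δ ε / ε) s j := by
    intro j
    induction j with
    | zero =>
      intro hj
      refine hstep 0 hj (C (a 1 0)) (expands_zero_iff.2 ?_) (by simpa using h1)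
      have h2 : Tendsto (Fr 1) (𝓝[>] 0) (𝓝 (a 1 0)) := by
        simpa using (hFr 1 (by omega)).tendsto
      have h3 : Tendsto (fun ε => ∑ r ∈ range J, ((r + 2).factorial : ℝ)⁻¹ *
          (Δ ε ^ (r + 1) * Fr (r + 2) ε)) (𝓝[>] 0) (𝓝 0) := by
        have : Tendsto (fun ε => ∑ r ∈ range J, ((r + 2).factorial : ℝ)⁻¹ *
          (Δ ε ^ (r + 1) * Fr (r + 2) ε)) (𝓝[>] 0) (𝓝 (∑ r ∈ range J, ((r + 2).factorial : ℝ)⁻¹ *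
          (0 ^ (r + 1) * coeff 0 (PowerSeries.mk (a (r + 2)))))) := by
          refine tendsto_finsetSum _ fun r hr => ?_
          rw [Finset.mem_range] at hr
          exact ((hΔ.pow _).mul (hFr (r + 2) (by omega)).tendsto).const_mul _
        simpa using this
      have h4 : Tendsto (fun ε => R ε / Δ ε) (𝓝[>] 0) (𝓝 0) := by
        refine hW.trans_tendsto ?_
        simpa using hΔ.pow (J + 1)
      simpa [hΨ] using (h2.add h3).add h4
    | succ j ih =>
      intro hj
      obtain ⟨s, hs⟩ := ih (by omega)
      have hΔ' : Expands Δ (PowerSeries.X * s) (j + 1) := by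
        have := hs.X_pow_mul 1
        rw [pow_one] at this
        refine this.congr ?_
        filter_upwards [eventually_coe_pos] with ε hε
        field_simp
      refine hstep (j + 1) hj (PowerSeries.mk (a 1) + ∑ r ∈ range J, C (((r + 2).factorial : ℝ)⁻¹) *
        ((PowerSeries.X * s) ^ (r + 1) * PowerSeries.mk (a (r + 2))) + 0) ?_ ?_
      · refine (((hFr 1 (by omega)).mono (by omega)).add (Expands.sum fun r hr => ?_)).add ?_
        · rw [Finset.mem_range] at hr
          refine Expands.const_mul ?_ _
          by_cases hrj : r + 1 ≤ j + 1
          · exact hΔ'.pow_mul (dvd_mul_right _ _) ((hFr (r + 2) (by omega)).mono (by omega))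
              (by omega) hrj
          -- Here ε^(r+1) alone exceeds the required order, so the leading terms of the other
          -- factors suffice.
          · have hsm := hs.mono (Nat.zero_le j)
            have h5 := ((hsm.pow (r + 1)).mul
              ((hFr (r + 2) (by omega)).mono (Nat.zero_le _))).X_pow_mul (r + 1)
            rw [← mul_assoc, ← mul_pow] at h5
            refine (h5.mono (by omega)).congr ?_
            filter_upwards [eventually_coe_pos] with ε hε
            rw [div_pow]
            field_simp
        · refine expands_of_isLittleO ?_
          have h6 : Δ =O[𝓝[>] 0] fun ε : ℝ≥0 => (ε : ℝ) := by
            have := (isBigO_refl (fun ε : ℝ≥0 => (ε : ℝ)) (𝓝[>] 0)).mul hs.isBigO_one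
            refine this.congr' ?_ (Filter.Eventually.of_forall fun ε => mul_one _)
            filter_upwards [eventually_coe_pos] with ε hε
            field_simp
          have h7 : (fun ε : ℝ≥0 => (ε : ℝ) ^ (J + 1)) =o[𝓝[>] 0]
              fun ε : ℝ≥0 => (ε : ℝ) ^ (j + 1) := by
            have := isLittleO_eval (P := Polynomial.X ^ (J + 1)) (m := j + 1) fun n hn => by
              rw [Polynomial.coeff_X_pow, if_neg (by omega)]
            simpa using this
          exact (hW.trans (h6.pow _)).trans_isLittleO h7
      · have h8 : ∀ r, coeff 0 ((PowerSeries.X * s) ^ (r + 1) * PowerSeries.mk (a (r + 2))) = 0 := by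
          intro r
          rw [pow_succ', mul_assoc, mul_assoc, coeff_zero_X_mul]
        rw [add_zero, map_add, map_sum, sum_eq_zero fun r _ => by rw [coeff_C_mul, h8, mul_zero]]
        simpa using h1
  obtain ⟨s, hs⟩ := hmain J le_rfl
  refine ⟨PowerSeries.X * s, dvd_mul_right _ _, ?_⟩
  have := hs.X_pow_mul 1
  rw [pow_one] at this
  refine this.congr ?_
  filter_upwards [eventually_coe_pos] with ε hε
  field_simp

/-- The coefficients of the expansion of a root satisfy the recursion of the algorithm. -/
theorem eq_rootStep {c : ℕ → ℝ} (hFr : ∀ r ≤ K, Expands (Fr r) (mk (a r)) (K - r))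
    (h1 : a 1 0 ≠ 0) (hΔ : Expands Δ (incrementSeries c) K)
    (hrem : (fun ε => 1 - ∑ r ∈ range (K + 1), (r.factorial : ℝ)⁻¹ * (Δ ε ^ r * Fr r ε))
      =O[𝓝[>] 0] fun ε => Δ ε ^ (K + 1)) {n : ℕ} (hn : n ∈ Icc 1 K) :
    c n = rootStep a c n := by
  rw [mem_Icc] at hn
  -- The functional is constantly 1 along the root, so its Taylor coefficients of positive order
  -- vanish. The top term a_{1,0} c_n is then isolated.
  have h2 := (expands_taylor (F := fun _ => 1) hFr hΔ hrem).coeff_eq (expands_const 1 K) n hn.2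
  rw [coeff_taylorSeries a c hn.2, coeff_C, if_neg (by omega), omegaStep] at h2
  obtain ⟨n', rfl⟩ : ∃ n', n = n' + 1 := ⟨n - 1, by omega⟩
  rw [sum_Icc_succ_top (by omega), Nat.sub_self] at h2
  rw [rootStep, Nat.add_sub_cancel]
  field_simp
  linarith

end Composition

end QSD

namespace QSD

open PowerSeries Finset

/-! ### Perturbation of the transition probabilities -/

section Perturbation

variable {N : ℕ} {T : ℝ≥0 → TransitionLaw N}

lemma CondB.communicates {X : ∀ ε : ℝ≥0, MarkovRenewalProcess.{u} (T ε)} (hB : CondB T X) :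
    Communicates (T 0) := fun i j hi hj =>
  transGen_of_gSeries_ne_zero hi hj ((X 0).gSeries_ne_zero_of_gTotal_pos hi hj (hB i j hi hj))

lemma CondA.eventually_communicates (hA : CondA T) (h0 : Communicates (T 0)) :
    ∀ᶠ ε in 𝓝 (0 : ℝ≥0), Communicates (T ε) := by
  have h1 : ∀ i j : Fin (N + 1), ∀ᶠ ε in 𝓝 (0 : ℝ≥0), Edge (T 0) i j → Edge (T ε) i j := by
    intro i j
    by_cases h : Edge (T 0) i j
    · filter_upwards [(hA.1 i j h.1).eventually_ne h.2.2] with ε hε _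
      exact ⟨h.1, h.2.1, hε⟩
    · exact Filter.Eventually.of_forall fun ε h' => absurd h' h
  filter_upwards [eventually_all.2 fun i => eventually_all.2 (h1 i)] with ε hε i j hi hj
  exact Relation.TransGen.mono (fun a b => hε a b) i j (h0 i j hi hj)

lemma CondA.tendsto_coeff_qSeries (hA : CondA T) {i : Fin (N + 1)} (hi : i ≠ 0)
    (j : Fin (N + 1)) (n : ℕ) : Tendsto (fun ε => coeff n (qSeries (T ε) i j)) (𝓝 0)
      (𝓝 (coeff n (qSeries (T 0) i j))) := by
  simp only [qSeries, coeff_mk, TransitionLaw.Q]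
  exact ENNReal.tendsto_ofReal ((hA.1 i j hi).mul (hA.2 i j n hi))

lemma coeff_qSeries_ne_top (S : TransitionLaw N) (i j : Fin (N + 1)) (n : ℕ) :
    coeff n (qSeries S i j) ≠ ⊤ := by
  simp [qSeries]

/-- For a fixed number of steps only finite sums and products occur. Finiteness is carried along
because multiplication on [0,∞] is not continuous at (0, ∞). -/
lemma CondA.tendsto_coeff_pow (hA : CondA T) (i : Fin (N + 1)) (m n : ℕ) (l : Fin (N + 1)) :
    Tendsto (fun ε => coeff n ((tabooKernel (T ε) i ^ m *ᵥ entrance (T ε) i) l)) (𝓝 0)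
      (𝓝 (coeff n ((tabooKernel (T 0) i ^ m *ᵥ entrance (T 0) i) l))) ∧
    coeff n ((tabooKernel (T 0) i ^ m *ᵥ entrance (T 0) i) l) ≠ ⊤ := by
  induction m generalizing n l with
  | zero =>
    simp only [pow_zero, Matrix.one_mulVec, entrance]
    by_cases hl : l = 0
    · simp [hl]
    · simp only [hl, if_false]
      exact ⟨hA.tendsto_coeff_qSeries hl i n, coeff_qSeries_ne_top _ _ _ _⟩
  | succ m ih =>
    simp only [pow_succ', ← Matrix.mulVec_mulVec]
    simp only [coeff_mulVec (tabooKernel _ i)]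
    have hK : ∀ a k, Tendsto (fun ε => coeff k (tabooKernel (T ε) i l a)) (𝓝 0)
        (𝓝 (coeff k (tabooKernel (T 0) i l a))) ∧ coeff k (tabooKernel (T 0) i l a) ≠ ⊤ := by
      intro a k
      simp only [tabooKernel, Matrix.of_apply]
      by_cases h : l = 0 ∨ a = 0 ∨ a = i
      · simp [h]
      · simp only [h, if_false]
        push Not at h
        exact ⟨hA.tendsto_coeff_qSeries h.1 a k, coeff_qSeries_ne_top _ _ _ _⟩
    constructor
    · refine tendsto_finsetSum _ fun a _ => tendsto_finsetSum _ fun p _ => ?_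
      exact ENNReal.Tendsto.mul (hK a p.1).1 (Or.inr (ih p.2 a).2) (ih p.2 a).1
        (Or.inr (hK a p.1).2)
    · refine ENNReal.sum_ne_top.2 fun a _ => ENNReal.sum_ne_top.2 fun p _ => ?_
      exact ENNReal.mul_ne_top (hK a p.1).2 (ih p.2 a).2

/-- Lower semicontinuity as in Fatou's lemma: a finite partial sum already exceeds a. -/
lemma eventually_lt_tsum {α ι : Type*} {l : Filter α} {F : α → ι → ℝ≥0∞} {G : ι → ℝ≥0∞}
    (h : ∀ i, Tendsto (fun ε => F ε i) l (𝓝 (G i))) {a : ℝ≥0∞} (ha : a < ∑' i, G i) :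
    ∀ᶠ ε in l, a < ∑' i, F ε i := by
  rw [ENNReal.tsum_eq_iSup_sum, lt_iSup_iff] at ha
  obtain ⟨s, hs⟩ := ha
  have h1 : Tendsto (fun ε => ∑ i ∈ s, F ε i) l (𝓝 (∑ i ∈ s, G i)) :=
    tendsto_finsetSum s fun i _ => h i
  filter_upwards [h1.eventually_const_lt hs] with ε hε
  exact hε.trans_le (ENNReal.sum_le_tsum s)

lemma CondA.eventually_lt_mom (hA : CondA T) {i : Fin (N + 1)} {ρ : ℝ} {a : ℝ≥0∞}
    (ha : a < mom ρ 0 (gSeries (T 0) i i)) :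
    ∀ᶠ ε in 𝓝 (0 : ℝ≥0), a < mom ρ 0 (gSeries (T ε) i i) := by
  have h1 : ∀ ε, mom ρ 0 (gSeries (T ε) i i) = ∑' nm : ℕ × ℕ, weight ρ 0 nm.1 *
      coeff nm.1 ((tabooKernel (T ε) i ^ nm.2 *ᵥ entrance (T ε) i) i) := by
    intro ε
    rw [ENNReal.tsum_prod', mom_eq]
    refine tsum_congr fun n => ?_
    simp only [gSeries, coeff_resolvent, ENNReal.tsum_mul_left]
  simp only [h1] at ha ⊢
  refine eventually_lt_tsum (fun nm => ?_) ha
  exact ENNReal.Tendsto.const_mul (hA.tendsto_coeff_pow i nm.2 nm.1 i).1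
    (Or.inr (weight_ne_top _ _ _))

/-- A common divisor divides one chosen n₀ > 0, so one further element per divisor of n₀ other than
1 suffices. A finite witness persists under small perturbations. -/
lemma NonPeriodic.exists_finset {a : ℕ → ℝ≥0∞} (h : NonPeriodic a) (h0 : a 0 = 0) :
    ∃ s : Finset ℕ, (∀ n ∈ s, a n ≠ 0) ∧ ∀ d : ℕ, (∀ n ∈ s, d ∣ n) → d = 1 := by
  obtain ⟨n₀, hn₀⟩ : ∃ n, a n ≠ 0 := by
    by_contra! hall
    have := h 2 fun n hn => absurd (hall n) hn
    omega
  have hpos : 0 < n₀ := by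
    rcases Nat.eq_zero_or_pos n₀ with h' | h'
    · rw [h'] at hn₀; exact absurd h0 hn₀
    · exact h'
  have hex : ∀ d : ℕ, d ≠ 1 → ∃ n, a n ≠ 0 ∧ ¬ d ∣ n := by
    intro d hd
    by_contra! hall
    exact hd (h d hall)
  choose! f hf using hex
  refine ⟨insert n₀ ((n₀.divisors.erase 1).image f), ?_, ?_⟩
  · intro n hn
    rw [Finset.mem_insert, Finset.mem_image] at hn
    rcases hn with rfl | ⟨d, hd, rfl⟩
    · exact hn₀
    · exact (hf d (Finset.ne_of_mem_erase hd)).1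
  · intro d hd
    by_contra hne
    have h1 : d ∣ n₀ := hd n₀ (Finset.mem_insert_self _ _)
    refine (hf d hne).2 (hd (f d) ?_)
    exact Finset.mem_insert_of_mem (Finset.mem_image_of_mem f
      (Finset.mem_erase.2 ⟨hne, Nat.mem_divisors.2 ⟨h1, hpos.ne'⟩⟩))

lemma CondA.eventually_nonPeriodic (hA : CondA T) {i : Fin (N + 1)}
    (h : NonPeriodic fun n => coeff n (gSeries (T 0) i i)) :
    ∀ᶠ ε in 𝓝 (0 : ℝ≥0), NonPeriodic fun n => coeff n (gSeries (T ε) i i) := by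
  obtain ⟨s, hs, hd⟩ := h.exists_finset (coeff_zero_gSeries i i)
  have h1 : ∀ n ∈ s, ∀ᶠ ε in 𝓝 (0 : ℝ≥0), coeff n (gSeries (T ε) i i) ≠ 0 := by
    intro n hn
    have h2 := pos_iff_ne_zero.2 (hs n hn)
    simp only [gSeries, coeff_resolvent] at h2 ⊢
    filter_upwards [eventually_lt_tsum (fun m => (hA.tendsto_coeff_pow i m n i).1) h2] with ε hε
    exact hε.ne'
  filter_upwards [(Finset.eventually_all s).2 h1] with ε hε d hdvd
  exact hd d fun n hn => hdvd n (hε n hn)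

/-- Splitting of an exponential moment into a finite sum and a small tail. -/
lemma mom_le_sum_add {ρ β' β : ℝ} (hρ : ρ ≤ β') (hβ : β' ≤ β) (L : ℕ) (a : PowerSeries ℝ≥0∞) :
    mom ρ 0 a ≤ ∑ n ∈ range L, weight ρ 0 n * coeff n a +
      ENNReal.ofReal (Real.exp (-(β - β') * L)) * mom β 0 a := by
  have h1 : ∑ n ∈ range L, weight ρ 0 n * coeff n a =
      ∑' n, if n ∈ range L then weight ρ 0 n * coeff n a else 0 := by
    rw [tsum_eq_sum (s := range L) fun n hn => if_neg hn]
    exact sum_congr rfl fun n hn => (if_pos hn).symm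
  rw [h1, mom_eq, mom_eq, ← ENNReal.tsum_mul_left, ← ENNReal.tsum_add]
  refine ENNReal.tsum_le_tsum fun n => ?_
  by_cases hn : n ∈ range L
  · rw [if_pos hn]; exact le_self_add
  · rw [if_neg hn, zero_add, ← mul_assoc]
    gcongr
    unfold weight
    rw [← ENNReal.ofReal_mul (Real.exp_pos _).le, pow_zero, one_mul, one_mul, ← Real.exp_add]
    refine ENNReal.ofReal_le_ofReal (Real.exp_le_exp.2 ?_)
    rw [Finset.mem_range, not_lt] at hn
    have hn' : (L : ℝ) ≤ n := by exact_mod_cast hn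
    have hn0 : (0 : ℝ) ≤ n := Nat.cast_nonneg n
    nlinarith

lemma exists_eventually_mom_le {β : ℝ} (h : ∀ i j : Fin (N + 1), i ≠ 0 →
      limsup (fun ε => (T ε).pMoment i j β 0) (𝓝 (0 : ℝ≥0)) < ⊤) :
    ∃ B : ℝ≥0, ∀ᶠ ε in 𝓝 (0 : ℝ≥0), ∀ i j : Fin (N + 1), i ≠ 0 →
      mom β 0 (qSeries (T ε) i j) ≤ B := by
  have h1 : ∀ i j : Fin (N + 1), ∃ B : ℝ≥0, i ≠ 0 → ∀ᶠ ε in 𝓝 (0 : ℝ≥0),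
      mom β 0 (qSeries (T ε) i j) ≤ B := by
    intro i j
    by_cases hi : i = 0
    · exact ⟨0, fun h' => absurd hi h'⟩
    · obtain ⟨B, hB1, hB2⟩ := ENNReal.lt_iff_exists_nnreal_btwn.1 (h i j hi)
      refine ⟨B, fun _ => ?_⟩
      filter_upwards [eventually_lt_of_limsup_lt hB1] with ε hε
      rw [mom_qSeries]
      exact hε.le
  choose B hB using h1
  refine ⟨∑ i, ∑ j, B i j, ?_⟩
  have h2 : ∀ i j : Fin (N + 1), ∀ᶠ ε in 𝓝 (0 : ℝ≥0), i ≠ 0 →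
      mom β 0 (qSeries (T ε) i j) ≤ B i j := by
    intro i j
    by_cases hi : i = 0
    · exact Filter.Eventually.of_forall fun ε h' => absurd hi h'
    · filter_upwards [hB i j hi] with ε hε _ using hε
  filter_upwards [eventually_all.2 fun i => eventually_all.2 (h2 i)] with ε hε i j hi
  refine (hε i j hi).trans (ENNReal.coe_le_coe.2 ?_)
  exact (single_le_sum (f := fun j => B i j) (fun _ _ => zero_le) (mem_univ j)).trans
    (single_le_sum (f := fun i => ∑ j, B i j) (fun _ _ => zero_le) (mem_univ i))

/-- Upper semicontinuity: the bound at β makes the tails beyond L uniformly small, and the finite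
part is continuous jointly in the exponent and ε. -/
lemma CondA.exists_mom_le_add (hA : CondA T) {β : ℝ} {B : ℝ≥0}
    (hB : ∀ᶠ ε in 𝓝 (0 : ℝ≥0), ∀ i j : Fin (N + 1), i ≠ 0 → mom β 0 (qSeries (T ε) i j) ≤ B)
    {ρ : ℝ} (hρ : ρ < β) {δ : ℝ≥0} (hδ : 0 < δ) :
    ∃ ρ', ρ < ρ' ∧ ρ' < β ∧ ∀ᶠ ε in 𝓝 (0 : ℝ≥0), ∀ i j : Fin (N + 1), i ≠ 0 →
      mom ρ' 0 (qSeries (T ε) i j) ≤ mom ρ 0 (qSeries (T 0) i j) + δ := by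
  obtain ⟨β', hβ1, hβ2⟩ := exists_between hρ
  have hδ2 : (0 : ℝ≥0∞) < (δ / 2 : ℝ≥0) := by exact_mod_cast half_pos hδ
  obtain ⟨L, hL⟩ : ∃ L : ℕ, ENNReal.ofReal (Real.exp (-(β - β') * L)) * B ≤ (δ / 2 : ℝ≥0) := by
    have h1 : Tendsto (fun L : ℕ => ENNReal.ofReal (Real.exp (-(β - β') * L)) * B) atTop
        (𝓝 (ENNReal.ofReal 0 * B)) := by
      refine ENNReal.Tendsto.mul_const (ENNReal.tendsto_ofReal ?_) (Or.inr ENNReal.coe_ne_top)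
      refine Real.tendsto_exp_atBot.comp ?_
      exact tendsto_natCast_atTop_atTop.const_mul_atTop_of_neg (by linarith)
    rw [ENNReal.ofReal_zero, zero_mul] at h1
    obtain ⟨L, hL⟩ := (h1.eventually_lt_const hδ2).exists
    exact ⟨L, hL.le⟩
  have h2 : ∀ i j : Fin (N + 1), ∀ᶠ z : ℝ × ℝ≥0 in 𝓝[>] ρ ×ˢ 𝓝 (0 : ℝ≥0), i ≠ 0 →
      ∑ n ∈ range L, weight z.1 0 n * coeff n (qSeries (T z.2) i j) ≤
        mom ρ 0 (qSeries (T 0) i j) + (δ / 2 : ℝ≥0) := by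
    intro i j
    by_cases hi : i = 0
    · exact Filter.Eventually.of_forall fun ε h' => absurd hi h'
    have h3 : Tendsto (fun z : ℝ × ℝ≥0 =>
        ∑ n ∈ range L, weight z.1 0 n * coeff n (qSeries (T z.2) i j))
        (𝓝[>] ρ ×ˢ 𝓝 (0 : ℝ≥0))
        (𝓝 (∑ n ∈ range L, weight ρ 0 n * coeff n (qSeries (T 0) i j))) := by
      refine tendsto_finsetSum _ fun n _ => ?_
      refine ENNReal.Tendsto.mul ?_ (Or.inr (coeff_qSeries_ne_top _ _ _ _))
        ((hA.tendsto_coeff_qSeries hi j n).comp tendsto_snd) (Or.inr (weight_ne_top _ _ _))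
      have hw : Continuous fun x : ℝ => weight x 0 n := by
        unfold weight
        exact ENNReal.continuous_ofReal.comp (by fun_prop)
      exact ((hw.tendsto ρ).mono_left nhdsWithin_le_nhds).comp tendsto_fst
    have h4 : ∑ n ∈ range L, weight ρ 0 n * coeff n (qSeries (T 0) i j) <
        mom ρ 0 (qSeries (T 0) i j) + (δ / 2 : ℝ≥0) := by
      refine lt_of_lt_of_le (ENNReal.lt_add_right ?_ hδ2.ne') ?_
      · exact ENNReal.sum_ne_top.2 fun n _ =>
          ENNReal.mul_ne_top (weight_ne_top _ _ _) (coeff_qSeries_ne_top _ _ _ _)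
      · gcongr
        exact ENNReal.sum_le_tsum (range L)
    filter_upwards [h3.eventually_lt_const h4] with z hz _ using hz.le
  -- Currying fixes the exponent before the neighbourhood of ε = 0 is chosen.
  have h5 := (eventually_all.2 fun i => eventually_all.2 (h2 i)).curry
  have h6 : ∀ᶠ x in 𝓝[>] ρ, ρ < x ∧ x < β' :=
    Ioo_mem_nhdsGT hβ1
  obtain ⟨ρ', h7, h8, h9⟩ := (h5.and h6).exists
  refine ⟨ρ', h8, h9.trans hβ2, ?_⟩
  filter_upwards [h7, hB] with ε h7 hB i j hi
  calc mom ρ' 0 (qSeries (T ε) i j) ≤ _ := mom_le_sum_add h9.le hβ2.le L _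
    _ ≤ (mom ρ 0 (qSeries (T 0) i j) + (δ / 2 : ℝ≥0)) + (δ / 2 : ℝ≥0) := by
        refine add_le_add (h7 i j hi) (le_trans ?_ hL)
        gcongr
        exact hB i j hi
    _ = mom ρ 0 (qSeries (T 0) i j) + δ := by
        rw [add_assoc, ← ENNReal.coe_add, add_halves]

/-- The Green functions of the taboo kernels are bounded slightly to the right of the root. -/
lemma CondA.exists_green_le (hA : CondA T) (hT : Communicates (T 0)) {β : ℝ} {B : ℝ≥0}
    (hB : ∀ᶠ ε in 𝓝 (0 : ℝ≥0), ∀ i j : Fin (N + 1), i ≠ 0 → mom β 0 (qSeries (T ε) i j) ≤ B)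
    {ρ : ℝ} (hρ : ρ < β) (hφ : ∀ i : Fin (N + 1), i ≠ 0 → mom ρ 0 (gSeries (T 0) i i) ≠ ⊤) :
    ∃ ρ', ρ < ρ' ∧ ρ' < β ∧ ∃ D : ℝ≥0, ∀ᶠ ε in 𝓝 (0 : ℝ≥0), ∀ i : Fin (N + 1), i ≠ 0 →
      ∀ l l', green (tabooMom (T ε) ρ' i) l l' ≤ D := by
  have hv : ∃ v : Fin (N + 1) → Fin (N + 1) → ℝ≥0, ∀ i, i ≠ 0 → ∀ l,
      (v i l : ℝ≥0∞) = ∑ l', green (tabooMom (T 0) ρ i) l l' := by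
    refine ⟨fun i l => (∑ l', green (tabooMom (T 0) ρ i) l l').toNNReal, fun i hi l => ?_⟩
    exact ENNReal.coe_toNNReal
      (ENNReal.sum_ne_top.2 fun l' _ => hT.green_ne_top hi (hφ i hi) l l')
  obtain ⟨v, hv⟩ := hv
  set S : ℝ≥0 := ∑ i, ∑ l, v i l with hS
  -- The row sums v of the limiting Green function satisfy v = 1 + K v. Raising the entries of K by
  -- this δ costs at most 1/2, so v stays strictly superharmonic for the perturbed kernels.
  obtain ⟨ρ', h1, h2, h3⟩ := hA.exists_mom_le_add hB hρ (δ := 1 / 2 / (1 + S)) (by positivity)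
  refine ⟨ρ', h1, h2, 2 * S, ?_⟩
  filter_upwards [h3] with ε hε i hi l l'
  have hsuper : ∀ l, ((1 / 2 : ℝ≥0) : ℝ≥0∞) +
      (tabooMom (T ε) ρ' i *ᵥ fun a => (v i a : ℝ≥0∞)) l ≤ v i l := by
    intro l
    have hentry : ∀ a, tabooMom (T ε) ρ' i l a ≤ tabooMom (T 0) ρ i l a +
        (1 / 2 / (1 + S) : ℝ≥0) := by
      intro a
      rw [tabooMom_apply, tabooMom_apply]
      split_ifs with h
      · exact zero_le
      · push Not at h
        exact hε l a h.1
    have hharm : (v i l : ℝ≥0∞) = 1 + ∑ a, tabooMom (T 0) ρ i l a * v i a := by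
      rw [hv i hi l, sum_congr rfl fun l' _ => green_eq_left _ l l', sum_add_distrib]
      congr 1
      · simp [Matrix.one_apply]
      · rw [sum_comm]
        refine sum_congr rfl fun a _ => ?_
        rw [hv i hi a, mul_sum]
    have hsmall : ∑ a, ((1 / 2 / (1 + S) : ℝ≥0) : ℝ≥0∞) * v i a ≤ (1 / 2 : ℝ≥0) := by
      rw [← mul_sum]
      have : ∑ a, v i a ≤ S :=
        single_le_sum (f := fun i => ∑ a, v i a) (fun _ _ => zero_le) (mem_univ i)
      have h4 : 1 / 2 / (1 + S) * ∑ a, v i a ≤ 1 / 2 := by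
        rw [div_mul_eq_mul_div, div_le_iff₀ (by positivity)]
        gcongr
        exact this.trans le_add_self
      exact_mod_cast h4
    calc ((1 / 2 : ℝ≥0) : ℝ≥0∞) + (tabooMom (T ε) ρ' i *ᵥ fun a => (v i a : ℝ≥0∞)) l
        ≤ (1 / 2 : ℝ≥0) + ∑ a, (tabooMom (T 0) ρ i l a + (1 / 2 / (1 + S) : ℝ≥0)) * v i a := by
          simp only [Matrix.mulVec, dotProduct]
          gcongr with a
          exact hentry a
      _ ≤ (1 / 2 : ℝ≥0) + (∑ a, tabooMom (T 0) ρ i l a * v i a + (1 / 2 : ℝ≥0)) := by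
          simp only [add_mul, sum_add_distrib]
          gcongr
      _ = v i l := by
          rw [hharm, add_comm _ ((1 / 2 : ℝ≥0) : ℝ≥0∞), ← add_assoc, ← ENNReal.coe_add,
            add_halves, ENNReal.coe_one]
  have h5 := green_le_of_superharmonic hsuper l l'
  have h6 : (v i l : ℝ≥0∞) ≤ S := by
    refine ENNReal.coe_le_coe.2 ?_
    exact (single_le_sum (f := fun l => v i l) (fun _ _ => zero_le) (mem_univ l)).trans
      (single_le_sum (f := fun i => ∑ l, v i l) (fun _ _ => zero_le) (mem_univ i))
  calc green (tabooMom (T ε) ρ' i) l l'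
      = 2 * (((1 / 2 : ℝ≥0) : ℝ≥0∞) * green (tabooMom (T ε) ρ' i) l l') := by
        rw [← mul_assoc, show (2 : ℝ≥0∞) * ((1 / 2 : ℝ≥0) : ℝ≥0∞) = 1 by
          rw [show (2 : ℝ≥0∞) = ((2 : ℝ≥0) : ℝ≥0∞) by rfl, ← ENNReal.coe_mul]
          norm_num, one_mul]
    _ ≤ 2 * S := by gcongr; exact h5.trans h6
    _ = ((2 * S : ℝ≥0) : ℝ≥0∞) := by push_cast; rfl

lemma coeff_survival (S : TransitionLaw N) (s : Fin (N + 1)) (n : ℕ) :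
    coeff n (survival S s) = ∑' t : ℕ, ∑ l, coeff (n + 1 + t) (qSeries S s l) := by
  simp [survival, qSeries]

/-- Markov's inequality bounds exp(βn) P{κ_1 > n} by the moment at β; the remaining geometric factor
is summed into D. -/
lemma exists_mom_survival_le {ρ β : ℝ} (hρ : ρ < β) (hβ : 0 ≤ β) :
    ∃ D : ℝ≥0, ∀ (S : TransitionLaw N) (s : Fin (N + 1)),
      mom ρ 0 (survival S s) ≤ D * ∑ l, mom β 0 (qSeries S s l) := by
  have hsum : Summable fun n : ℕ => Real.exp (ρ - β) ^ n :=
    summable_geometric_of_lt_one (Real.exp_pos _).le (by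
      rw [← Real.exp_zero]; exact Real.exp_lt_exp.2 (by linarith))
  refine ⟨(∑' n : ℕ, ENNReal.ofReal (Real.exp (ρ - β) ^ n)).toNNReal, fun S s => ?_⟩
  rw [ENNReal.coe_toNNReal hsum.tsum_ofReal_ne_top, mom_eq, ← ENNReal.tsum_mul_right]
  refine ENNReal.tsum_le_tsum fun n => ?_
  have h1 : weight ρ 0 n = ENNReal.ofReal (Real.exp (ρ - β) ^ n) * weight β 0 n := by
    unfold weight
    rw [← ENNReal.ofReal_mul (by positivity), pow_zero, one_mul, one_mul, ← Real.exp_nat_mul,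
      ← Real.exp_add]
    ring_nf
  rw [h1, mul_assoc]
  gcongr
  rw [coeff_survival, ← ENNReal.tsum_mul_left]
  calc ∑' t : ℕ, weight β 0 n * ∑ l, coeff (n + 1 + t) (qSeries S s l)
      ≤ ∑' t : ℕ, weight β 0 (n + 1 + t) * ∑ l, coeff (n + 1 + t) (qSeries S s l) := by
        refine ENNReal.tsum_le_tsum fun t => ?_
        gcongr
        unfold weight
        refine ENNReal.ofReal_le_ofReal ?_
        rw [pow_zero, one_mul, pow_zero, one_mul]
        refine Real.exp_le_exp.2 (mul_le_mul_of_nonneg_left ?_ hβ)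
        exact_mod_cast (by omega : n ≤ n + 1 + t)
    _ ≤ ∑' k : ℕ, weight β 0 k * ∑ l, coeff k (qSeries S s l) :=
        ENNReal.tsum_comp_le_tsum_of_injective (add_right_injective (n + 1))
          fun k => weight β 0 k * ∑ l, coeff k (qSeries S s l)
    _ = ∑ l, mom β 0 (qSeries S s l) := by
        simp only [mom_eq, mul_sum]
        rw [Summable.tsum_finsetSum fun _ _ => ENNReal.summable]

/-- Properties that hold for all small perturbations, with uniform bounds slightly to the right
of the limiting root `ρ`. -/
structure RegularPerturbation (T : ℝ≥0 → TransitionLaw N) (ρ ρ' : ℝ) (D : ℝ≥0) : Prop where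
  lt : ρ < ρ'
  communicates : ∀ᶠ ε in 𝓝 (0 : ℝ≥0), Communicates (T ε)
  root : ∀ i : Fin (N + 1), i ≠ 0 → mom ρ 0 (gSeries (T 0) i i) = 1
  q_le : ∀ᶠ ε in 𝓝 (0 : ℝ≥0), ∀ i j : Fin (N + 1), i ≠ 0 → mom ρ' 0 (qSeries (T ε) i j) ≤ D
  survival_le : ∀ᶠ ε in 𝓝 (0 : ℝ≥0), ∀ s : Fin (N + 1), s ≠ 0 → mom ρ' 0 (survival (T ε) s) ≤ D
  g_le : ∀ᶠ ε in 𝓝 (0 : ℝ≥0), ∀ i l : Fin (N + 1), i ≠ 0 → mom ρ' 0 (gSeries (T ε) i l) ≤ D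
  h_le : ∀ᶠ ε in 𝓝 (0 : ℝ≥0), ∀ i s l : Fin (N + 1), i ≠ 0 → s ≠ 0 →
    mom ρ' 0 (hSeries (T ε) i s l) ≤ D

/-- The uniform Green bound, multiplied by the bounds on transitions and sojourn tails, controls g
and h. The final constant is a sum merely to dominate all of them. -/
theorem exists_regularPerturbation {X : ∀ ε : ℝ≥0, MarkovRenewalProcess.{u} (T ε)}
    (hA : CondA T) (hB : CondB T X) (hC : CondC T X) :
    ∃ ρ' D, RegularPerturbation T (X 0).charRoot ρ' D := by
  obtain ⟨β, hβ, hlim, i, hi, βi, hβi, h1, htop⟩ := hC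
  have hT := hB.communicates
  rw [(X 0).φ_eq hi hi] at h1 htop
  obtain ⟨ρ, hρ0, hρβ, hρ⟩ := exists_mom_eq_one ((X 0).mom_gSeries_zero_le_one hi hi) h1 htop.ne
  obtain ⟨hroot, hchar, -⟩ := hT.charRoot_spec (X 0) hi hρ0 hρ
  rw [hchar]
  have hφ : ∀ i : Fin (N + 1), i ≠ 0 → mom ρ 0 (gSeries (T 0) i i) = 1 := fun i' hi' =>
    (hT.solidarity hi hi' hρ).1
  obtain ⟨B, hB'⟩ := exists_eventually_mom_le hlim
  obtain ⟨ρ', hρ1, hρ2, G, hG⟩ := hA.exists_green_le hT hB' (hρβ.trans_le hβi)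
    fun i' hi' => by rw [hφ i' hi']; exact ENNReal.one_ne_top
  obtain ⟨D, hD⟩ := exists_mom_survival_le (N := N) hρ2 hβ.le
  set D1 : ℝ≥0 := D * ((N + 1 : ℕ) * B) with hD1
  set D2 : ℝ≥0 := (N + 1 : ℕ) * (G * B) with hD2
  have hq : ∀ᶠ ε in 𝓝 (0 : ℝ≥0), ∀ i j : Fin (N + 1), i ≠ 0 →
      mom ρ' 0 (qSeries (T ε) i j) ≤ B := by
    filter_upwards [hB'] with ε hε i j hi'
    exact (mom_mono hρ2.le 0 _).trans (hε i j hi')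
  have hs : ∀ᶠ ε in 𝓝 (0 : ℝ≥0), ∀ s : Fin (N + 1), s ≠ 0 →
      mom ρ' 0 (survival (T ε) s) ≤ D1 := by
    filter_upwards [hB'] with ε hε s hs
    refine (hD (T ε) s).trans ?_
    have : ∑ l, mom β 0 (qSeries (T ε) s l) ≤ ((N + 1 : ℕ) : ℝ≥0∞) * B := by
      refine (sum_le_card_nsmul _ _ (B : ℝ≥0∞) fun l _ => hε s l hs).trans ?_
      simp
    calc _ ≤ (D : ℝ≥0∞) * (((N + 1 : ℕ) : ℝ≥0∞) * B) := by gcongr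
      _ = D1 := by rw [hD1]; push_cast; rfl
  refine ⟨ρ', B + D1 + D2 + G * D1, hρ1, hA.eventually_communicates hT, hφ, ?_, ?_, ?_, ?_⟩
  · filter_upwards [hq] with ε hε i j hi'
    refine (hε i j hi').trans (ENNReal.coe_le_coe.2 ?_)
    rw [add_assoc, add_assoc]; exact le_self_add
  · filter_upwards [hs] with ε hε s hs'
    refine (hε s hs').trans (ENNReal.coe_le_coe.2 ?_)
    rw [add_assoc, add_assoc, add_left_comm]; exact le_self_add
  · filter_upwards [hq, hG] with ε hε hG i l hi'
    have h2 : mom ρ' 0 (gSeries (T ε) i l) ≤ D2 := by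
      rw [mom_gSeries]
      have : ∀ a ∈ (univ : Finset (Fin (N + 1))), green (tabooMom (T ε) ρ' i) l a *
          entranceMom (T ε) ρ' i a ≤ (G : ℝ≥0∞) * B := by
        intro a _
        refine mul_le_mul' (hG i hi' l a) ?_
        rw [entranceMom_apply]
        split_ifs with ha
        · exact zero_le
        · exact hε a i ha
      refine (sum_le_card_nsmul _ _ _ this).trans ?_
      rw [hD2]
      simp
    refine h2.trans (ENNReal.coe_le_coe.2 ?_)
    rw [add_assoc, add_left_comm]; exact le_self_add
  · filter_upwards [hs, hG] with ε hε hG i s l hi' hs'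
    have h2 : mom ρ' 0 (hSeries (T ε) i s l) ≤ ((G * D1 : ℝ≥0) : ℝ≥0∞) := by
      rw [mom_hSeries, ENNReal.coe_mul]
      exact mul_le_mul' (hG i hi' l s) (hε s hs')
    exact h2.trans (ENNReal.coe_le_coe.2 le_add_self)

/-- Existence of the perturbed roots. -/
theorem RegularPerturbation.eventually_root {ρ ρ' : ℝ} {D : ℝ≥0}
    (h : RegularPerturbation T ρ ρ' D) (hA : CondA T)
    (X : ∀ ε : ℝ≥0, MarkovRenewalProcess.{u} (T ε)) {i : Fin (N + 1)} (hi : i ≠ 0) :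
    ∀ᶠ ε in 𝓝 (0 : ℝ≥0), 0 ≤ (X ε).charRoot ∧ (X ε).charRoot < ρ' ∧
      mom (X ε).charRoot 0 (gSeries (T ε) i i) = 1 := by
  have h1 := one_lt_mom h.lt (coeff_zero_gSeries i i) (h.root i hi)
  filter_upwards [h.communicates, h.g_le, hA.eventually_lt_mom h1] with ε hT hg h2
  obtain ⟨r, hr0, hr1, hr2⟩ := exists_mom_eq_one ((X ε).mom_gSeries_zero_le_one hi hi) h2
    (ne_top_of_le_ne_top ENNReal.coe_ne_top (hg i i hi))
  obtain ⟨-, hchar, -⟩ := hT.charRoot_spec (X ε) hi hr0 hr2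
  rw [hchar]
  exact ⟨hr0, hr1, hr2⟩

end Perturbation

end QSD

namespace QSD

open PowerSeries Finset

/-! ### Moments of sojourn times -/

section Sojourn

variable {N : ℕ} (S : TransitionLaw N) (s : Fin (N + 1))

lemma tsum_sum_coeff_qSeries :
    ∑' n : ℕ, ∑ l, coeff n (qSeries S s l) = 1 := by
  rw [Summable.tsum_finsetSum fun _ _ => ENNReal.summable]
  have h : ∀ l, ∑' n : ℕ, coeff n (qSeries S s l) = ENNReal.ofReal (S.p s l) := by
    intro l
    simp only [qSeries, coeff_mk, TransitionLaw.Q, ENNReal.ofReal_mul (S.p_nonneg s l)]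
    rw [ENNReal.tsum_mul_left, ← ENNReal.ofReal_tsum_of_nonneg (S.f_nonneg s l)
      (S.f_hasSum s l).summable, (S.f_hasSum s l).tsum_eq, ENNReal.ofReal_one, mul_one]
  simp only [h]
  rw [← ENNReal.ofReal_sum_of_nonneg fun l _ => S.p_nonneg s l, S.p_sum, ENNReal.ofReal_one]

/-- The relation (z - 1) S(z) = Q(z) - 1 between tails and distribution, rearranged so that no
subtraction occurs. -/
lemma X_mul_survival_add_one :
    PowerSeries.X * survival S s + 1 = survival S s + ∑ j, qSeries S s j := by
  ext n
  have hq : ∀ n, coeff n (∑ j, qSeries S s j) = ∑ l, coeff n (qSeries S s l) := fun n => by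
    rw [map_sum]
  rw [map_add, map_add, hq]
  cases n with
  | zero =>
    rw [coeff_zero_X_mul, coeff_survival, zero_add, coeff_one, if_pos rfl,
      ← tsum_sum_coeff_qSeries S s, tsum_eq_zero_add' ENNReal.summable, add_comm]
    simp only [zero_add, add_comm 1]
  | succ n =>
    rw [coeff_succ_X_mul, coeff_survival, coeff_survival, coeff_one, if_neg (by omega), add_zero,
      tsum_eq_zero_add' ENNReal.summable, add_zero, add_comm]
    congr 1
    exact tsum_congr fun t => by rw [show n + 1 + (t + 1) = n + 1 + 1 + t by omega]

lemma mom_one (ρ : ℝ) (r : ℕ) : mom ρ r 1 = if r = 0 then 1 else 0 := by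
  rw [mom_eq, tsum_eq_single 0]
  · by_cases hr : r = 0 <;> simp [weight, hr]
  · intro n hn
    simp [coeff_one, hn]

lemma mom_X (ρ : ℝ) (r : ℕ) : mom ρ r PowerSeries.X = ENNReal.ofReal (Real.exp ρ) := by
  rw [mom_eq, tsum_eq_single 1]
  · simp [weight]
  · intro n hn
    simp [coeff_X, hn]

variable {S s}

/-- Take moments of the previous identity. Every moment of X equals exp ρ, and collecting the terms
of order r leaves the factor exp ρ - 1, which vanishes only for ρ = 0. -/
lemma toReal_mom_survival_of_ne_zero {ρ : ℝ} (hρ : ρ ≠ 0) {r : ℕ}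
    (hS : ∀ m ≤ r, mom ρ m (survival S s) ≠ ⊤) (hq : ∀ j, mom ρ r (qSeries S s j) ≠ ⊤) :
    (mom ρ r (survival S s)).toReal =
      ((∑ j, (mom ρ r (qSeries S s j)).toReal) - (if r = 0 then 1 else 0)
        - Real.exp ρ * ∑ m : Fin r, (r.choose m : ℝ) * (mom ρ m (survival S s)).toReal)
        / (Real.exp ρ - 1) := by
  have h := congrArg (fun a => (mom ρ r a).toReal) (X_mul_survival_add_one S s)
  simp only [mom_add, mom_mul, mom_one, mom_X, mom_sum] at h
  have hfin : ∀ m ∈ range (r + 1), (r.choose m : ℝ≥0∞) *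
      (ENNReal.ofReal (Real.exp ρ) * mom ρ m (survival S s)) ≠ ⊤ := fun m hm =>
    ENNReal.mul_ne_top (ENNReal.natCast_ne_top _)
      (ENNReal.mul_ne_top ENNReal.ofReal_ne_top (hS m (by have := mem_range.1 hm; omega)))
  rw [ENNReal.toReal_add (ENNReal.sum_ne_top.2 hfin) (by split_ifs <;> simp),
    ENNReal.toReal_add (hS r le_rfl) (ENNReal.sum_ne_top.2 fun j _ => hq j),
    ENNReal.toReal_sum hfin, ENNReal.toReal_sum fun j _ => hq j] at h
  simp only [ENNReal.toReal_mul, ENNReal.toReal_natCast,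
    ENNReal.toReal_ofReal (Real.exp_pos ρ).le] at h
  rw [sum_range_succ, Nat.choose_self, Nat.cast_one, one_mul] at h
  have h2 : ∑ m ∈ range r, (r.choose m : ℝ) * (Real.exp ρ * (mom ρ m (survival S s)).toReal) =
      Real.exp ρ * ∑ m : Fin r, (r.choose m : ℝ) * (mom ρ m (survival S s)).toReal := by
    rw [Fin.sum_univ_eq_sum_range (fun m => (r.choose m : ℝ) * (mom ρ m (survival S s)).toReal),
      mul_sum]
    exact sum_congr rfl fun m _ => by ring
  have h3 : ((if r = 0 then (1 : ℝ≥0∞) else 0)).toReal = if r = 0 then 1 else 0 := by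
    split_ifs <;> simp
  rw [h2, h3] at h
  have h4 : Real.exp ρ - 1 ≠ 0 := by
    rw [sub_ne_zero]
    exact fun h => hρ (Real.exp_eq_one_iff ρ |>.1 h)
  rw [eq_div_iff h4]
  linarith

/-- Summation by parts: the moment of the tails is the mean of the sum of n^r over n < κ_1. -/
lemma mom_zero_survival (r : ℕ) : mom 0 r (survival S s) =
    ∑' M : ℕ, (∑ n ∈ range M, ENNReal.ofReal ((n : ℝ) ^ r)) * ∑ l, coeff M (qSeries S s l) := by
  have h := tsum_antidiagonal fun n t =>
    ENNReal.ofReal ((n : ℝ) ^ r) * ∑ l, coeff (n + 1 + t) (qSeries S s l)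
  rw [tsum_eq_zero_add' ENNReal.summable, range_zero, sum_empty, zero_mul, zero_add, mom_eq]
  simp only [coeff_survival, ← ENNReal.tsum_mul_left, weight, zero_mul, Real.exp_zero, mul_one]
  rw [← h]
  refine tsum_congr fun M => ?_
  rw [sum_mul, Finset.Nat.sum_antidiagonal_eq_sum_range_succ (fun n t =>
    ENNReal.ofReal ((n : ℝ) ^ r) * ∑ l, coeff (n + 1 + t) (qSeries S s l))]
  refine sum_congr rfl fun n hn => ?_
  have := mem_range.1 hn
  rw [show n + 1 + (M - n) = M + 1 by omega]

lemma hasSum_toReal_mom {ρ : ℝ} {r : ℕ} {a : PowerSeries ℝ≥0∞} (h : mom ρ r a ≠ ⊤) :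
    HasSum (fun n : ℕ => (n : ℝ) ^ r * Real.exp (ρ * n) * (coeff n a).toReal)
      (mom ρ r a).toReal := by
  have h1 : (mom ρ r a).toReal =
      ∑' n : ℕ, (n : ℝ) ^ r * Real.exp (ρ * n) * (coeff n a).toReal := by
    rw [mom_eq] at h ⊢
    rw [ENNReal.tsum_toReal_eq (ENNReal.ne_top_of_tsum_ne_top h)]
    refine tsum_congr fun n => ?_
    rw [ENNReal.toReal_mul, weight, ENNReal.toReal_ofReal (by positivity)]
  rw [h1]
  exact (summable_toReal_mom h).hasSum

/-- Faulhaber's formula for the inner power sum. It has degree r + 1 in κ_1, which is why moments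
one order higher are required when the root is 0. -/
lemma toReal_mom_zero_survival {r : ℕ}
    (hq : ∀ m ≤ r + 1, ∀ j, mom 0 m (qSeries S s j) ≠ ⊤) :
    (mom 0 r (survival S s)).toReal = ∑ t ∈ range (r + 1),
      (bernoulli t : ℝ) * ((r + 1).choose t : ℝ) / (r + 1 : ℝ) *
        ∑ j, (mom 0 (r + 1 - t) (qSeries S s j)).toReal := by
  have h1 : ∀ t, HasSum (fun n : ℕ => (bernoulli t : ℝ) * ((r + 1).choose t : ℝ) / (r + 1 : ℝ) *
      ∑ j, (n : ℝ) ^ (r + 1 - t) * (coeff n (qSeries S s j)).toReal)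
      ((bernoulli t : ℝ) * ((r + 1).choose t : ℝ) / (r + 1 : ℝ) *
        ∑ j, (mom 0 (r + 1 - t) (qSeries S s j)).toReal) := by
    intro t
    refine HasSum.mul_left _ (hasSum_sum fun j _ => ?_)
    simpa using hasSum_toReal_mom (hq (r + 1 - t) (by omega) j)
  have h2 := hasSum_sum fun t (_ : t ∈ range (r + 1)) => h1 t
  rw [mom_zero_survival, ENNReal.tsum_toReal_eq, ← h2.tsum_eq]
  · refine tsum_congr fun M => ?_
    have h3 : (∑ n ∈ range M, (n : ℝ) ^ r) = ∑ t ∈ range (r + 1),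
        (bernoulli t : ℝ) * ((r + 1).choose t : ℝ) * (M : ℝ) ^ (r + 1 - t) / (r + 1 : ℝ) := by
      have := congrArg (fun q : ℚ => (q : ℝ)) (sum_range_pow M r)
      push_cast at this
      exact this
    rw [ENNReal.toReal_mul, ENNReal.toReal_sum fun n _ => ENNReal.ofReal_ne_top,
      ENNReal.toReal_sum fun l _ => coeff_qSeries_ne_top _ _ _ _]
    simp only [ENNReal.toReal_ofReal (pow_nonneg (Nat.cast_nonneg _) r)]
    rw [h3, sum_mul]
    refine sum_congr rfl fun t _ => ?_
    rw [← mul_sum]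
    ring
  · intro M
    exact ENNReal.mul_ne_top (ENNReal.sum_ne_top.2 fun n _ => ENNReal.ofReal_ne_top)
      (ENNReal.sum_ne_top.2 fun l _ => coeff_qSeries_ne_top _ _ _ _)

end Sojourn

/-! ### Expansions with a value at zero -/

section HasExpansion

variable {x y : ℝ≥0 → ℝ} {a b : ℕ → ℝ} {m m' : ℕ}

lemma HasExpansion.mono (h : HasExpansion x a m) (hm : m' ≤ m) : HasExpansion x a m' := by
  rw [hasExpansion_iff] at h ⊢
  exact ⟨h.1, h.2.mono hm⟩

lemma HasExpansion.congr (h : HasExpansion x a m) (hxy : ∀ᶠ ε in 𝓝 0, x ε = y ε) :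
    HasExpansion y a m := by
  rw [hasExpansion_iff] at h ⊢
  exact ⟨hxy.self_of_nhds ▸ h.1, h.2.congr (hxy.filter_mono nhdsWithin_le_nhds)⟩

lemma HasExpansion.const_mul (h : HasExpansion x a m) (c : ℝ) :
    HasExpansion (fun ε => c * x ε) (fun n => c * a n) m := by
  rw [hasExpansion_iff] at h ⊢
  refine ⟨by rw [h.1], (h.2.const_mul c).congr_series fun n _ => ?_⟩
  simp

lemma HasExpansion.sub (h : HasExpansion x a m) (h' : HasExpansion y b m) :
    HasExpansion (fun ε => x ε - y ε) (fun n => a n - b n) m := by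
  rw [hasExpansion_iff] at h h' ⊢
  refine ⟨by rw [h.1, h'.1], (h.2.sub h'.2).congr_series fun n _ => ?_⟩
  simp

lemma HasExpansion.sum {ι : Type*} {s : Finset ι} {x : ι → ℝ≥0 → ℝ} {a : ι → ℕ → ℝ}
    (h : ∀ i ∈ s, HasExpansion (x i) (a i) m) :
    HasExpansion (fun ε => ∑ i ∈ s, x i ε) (fun n => ∑ i ∈ s, a i n) m := by
  simp only [hasExpansion_iff] at h ⊢
  refine ⟨sum_congr rfl fun i hi => (h i hi).1, (Expands.sum fun i hi => (h i hi).2).congr_series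
    fun n _ => ?_⟩
  simp

lemma hasExpansion_const (c : ℝ) (m : ℕ) :
    HasExpansion (fun _ => c) (fun n => if n = 0 then c else 0) m := by
  rw [hasExpansion_iff]
  refine ⟨by simp, (expands_const c m).congr_series fun n _ => ?_⟩
  rw [coeff_C, coeff_mk]

end HasExpansion

/-! ### Expansions of the sojourn time moments -/

section Functionals

variable {N : ℕ} {T : ℝ≥0 → TransitionLaw N}
  {pc : Fin (N + 1) → Fin (N + 1) → ℕ → ℕ → ℝ} {ρ : ℝ} {k : ℕ}

lemma CondP.hasExpansion_sum (hP : CondP T ρ (k + 1) pc) {s : Fin (N + 1)} (hs : s ≠ 0) {r : ℕ}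
    (hr : r ≤ k + 1) {m : ℕ} (hm : m ≤ k + 1 - r) :
    HasExpansion (fun ε => ∑ j, (mom ρ r (qSeries (T ε) s j)).toReal)
      (fun n => ∑ j, pc s j r n) m := by
  refine HasExpansion.sum fun j _ => ?_
  simp only [mom_qSeries]
  exact (hP r hr s j hs).mono hm

theorem CondP.hasExpansion_survival (hP : CondP T ρ (k + 1) pc)
    (hq : ∀ r, ∀ᶠ ε in 𝓝 (0 : ℝ≥0), ∀ l j : Fin (N + 1), l ≠ 0 → mom ρ r (qSeries (T ε) l j) ≠ ⊤)
    (hS : ∀ r, ∀ᶠ ε in 𝓝 (0 : ℝ≥0), ∀ s : Fin (N + 1), s ≠ 0 → mom ρ r (survival (T ε) s) ≠ ⊤)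
    {s : Fin (N + 1)} (hs : s ≠ 0) {r : ℕ} (hr : r ≤ k) :
    HasExpansion (fun ε => (mom ρ r (survival (T ε) s)).toReal) (sojournCoeff pc ρ s r) (k - r) := by
  induction r using Nat.strong_induction_on with
  | _ r ih =>
    by_cases hρ : ρ = 0
    · subst hρ
      have h1 : HasExpansion (fun ε => ∑ t ∈ range (r + 1),
          (bernoulli t : ℝ) * ((r + 1).choose t : ℝ) / (r + 1 : ℝ) *
            ∑ j, (mom 0 (r + 1 - t) (qSeries (T ε) s j)).toReal)
          (sojournCoeff pc 0 s r) (k - r) := by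
        have h2 : sojournCoeff pc 0 s r = fun n => ∑ t ∈ range (r + 1),
            (bernoulli t : ℝ) * ((r + 1).choose t : ℝ) / (r + 1 : ℝ) *
              ∑ j, pc s j (r + 1 - t) n := by
          funext n; rw [sojournCoeff, if_pos rfl]
        rw [h2]
        refine HasExpansion.sum fun t ht => HasExpansion.const_mul ?_ _
        exact hP.hasExpansion_sum hs (by omega) (by have := mem_range.1 ht; omega)
      refine h1.congr ?_
      filter_upwards [(Finset.eventually_all (range (r + 2))).2 fun m _ => hq m] with ε hε
      exact (toReal_mom_zero_survival fun m hm j =>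
        hε m (mem_range.2 (by omega)) s j hs).symm
    · have h1 : HasExpansion (fun ε => (Real.exp ρ - 1)⁻¹ *
          ((∑ j, (mom ρ r (qSeries (T ε) s j)).toReal) - (if r = 0 then 1 else 0)
            - Real.exp ρ * ∑ m : Fin r, (r.choose m : ℝ) * (mom ρ m (survival (T ε) s)).toReal))
          (sojournCoeff pc ρ s r) (k - r) := by
        have h2 : sojournCoeff pc ρ s r = fun n => (Real.exp ρ - 1)⁻¹ *
            ((∑ j, pc s j r n) - (if n = 0 then (if r = 0 then 1 else 0) else 0)
            - Real.exp ρ * ∑ m : Fin r, (r.choose m : ℝ) * sojournCoeff pc ρ s m n) := by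
          funext n
          rw [sojournCoeff, if_neg hρ, div_eq_inv_mul]
          by_cases hn : n = 0 <;> by_cases hr0 : r = 0 <;> simp [hn, hr0]
        rw [h2]
        refine HasExpansion.const_mul (HasExpansion.sub (HasExpansion.sub
          (hP.hasExpansion_sum hs (by omega) (by omega)) (hasExpansion_const _ _))
          (HasExpansion.const_mul (HasExpansion.sum fun m _ => HasExpansion.const_mul ?_ _) _)) _
        exact (ih m m.2 (by have := m.2; omega)).mono (by have := m.2; omega)
      refine h1.congr ?_
      filter_upwards [hq r, (Finset.eventually_all (range (r + 1))).2 fun m _ => hS m]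
        with ε hε hε'
      rw [toReal_mom_survival_of_ne_zero hρ (fun m hm => hε' m (mem_range.2 (by omega)) s hs)
        fun j => hε s j hs, div_eq_inv_mul]

end Functionals

end QSD

namespace QSD

open PowerSeries Finset

/-! ### Expansions of the functionals at the limiting root -/

section LinearSystem

variable {N : ℕ} {S : TransitionLaw N}

lemma tabooKernel_apply (i a c : Fin (N + 1)) :
    tabooKernel S i a c = if a = 0 ∨ c = 0 ∨ c = i then 0 else qSeries S a c := rfl

lemma mom_tabooKernel_ne_top {ρ : ℝ} {r : ℕ} (i : Fin (N + 1))
    (hq : ∀ l j : Fin (N + 1), l ≠ 0 → mom ρ r (qSeries S l j) ≠ ⊤) (a c : Fin (N + 1)) :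
    mom ρ r (tabooKernel S i a c) ≠ ⊤ := by
  rw [tabooKernel_apply]
  split_ifs with h
  · simp [mom_zero]
  · push Not at h
    exact hq a c h.1

/-- The linear system for the moments of a resolvent. Its component at `0` is arbitrary, since the
taboo kernel vanishes in the row and in the column of `0`. -/
lemma toReal_mom_resolvent {ρ : ℝ} {r : ℕ} (i : Fin (N + 1)) (B : Fin (N + 1) → PowerSeries ℝ≥0∞)
    (u : ℕ → ℝ)
    (hq : ∀ m ≤ r, ∀ l j : Fin (N + 1), l ≠ 0 → mom ρ m (qSeries S l j) ≠ ⊤)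
    (hx : ∀ m ≤ r, ∀ l, mom ρ m (resolvent (tabooKernel S i) B l) ≠ ⊤) :
    (fun a => if a = 0 then u r else (mom ρ r (resolvent (tabooKernel S i) B a)).toReal) =
      (fun a => if a = 0 then u r else (mom ρ r (B a)).toReal) +
        ∑ m ∈ range (r + 1), (r.choose m : ℝ) •
          ((Matrix.of fun a c => (mom ρ (r - m) (tabooKernel S i a c)).toReal) *ᵥ
            fun a => if a = 0 then u m else
              (mom ρ m (resolvent (tabooKernel S i) B a)).toReal) := by
  have hrow : ∀ (m : ℕ) (v : Fin (N + 1) → ℝ), ((Matrix.of fun a c =>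
      (mom ρ m (tabooKernel S i a c)).toReal) *ᵥ v) 0 = 0 := by
    intro m v
    simp [Matrix.mulVec, dotProduct, tabooKernel_apply, mom_zero]
  funext a
  rw [Pi.add_apply, Finset.sum_apply]
  simp only [Pi.smul_apply, smul_eq_mul]
  by_cases ha : a = 0
  · subst ha
    simp [hrow]
  simp only [ha, if_false]
  have h1 := congrArg (mom ρ r) (congrFun (resolvent_eq (tabooKernel S i) B) a)
  rw [Pi.add_apply, mom_add, mom_mulVec] at h1
  have hfin : ∀ l ∈ univ, ∀ m ∈ range (r + 1), (r.choose m : ℝ≥0∞) *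
      (mom ρ (r - m) (tabooKernel S i a l) *
        mom ρ m (resolvent (tabooKernel S i) B l)) ≠ ⊤ := fun l _ m hm =>
    ENNReal.mul_ne_top (ENNReal.natCast_ne_top _) (ENNReal.mul_ne_top
      (mom_tabooKernel_ne_top i (hq (r - m) (by omega)) a l)
      (hx m (by have := mem_range.1 hm; omega) l))
  have hB : mom ρ r (B a) ≠ ⊤ :=
    ne_top_of_le_ne_top (hx r le_rfl a) (h1 ▸ le_self_add)
  rw [h1, ENNReal.toReal_add hB
      (ENNReal.sum_ne_top.2 fun l hl => ENNReal.sum_ne_top.2 (hfin l hl)),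
    ENNReal.toReal_sum fun l hl => ENNReal.sum_ne_top.2 (hfin l hl),
    sum_congr rfl fun l hl => ENNReal.toReal_sum (hfin l hl), sum_comm]
  congr 1
  refine sum_congr rfl fun m _ => ?_
  rw [Matrix.mulVec, dotProduct, mul_sum]
  refine sum_congr rfl fun l _ => ?_
  rw [ENNReal.toReal_mul, ENNReal.toReal_mul, ENNReal.toReal_natCast, Matrix.of_apply]
  by_cases hl : l = 0
  · simp [hl, tabooKernel_apply, mom_zero]
  · rw [if_neg hl]

end LinearSystem

/-- `HasExpansion` also prescribes the value at ε = 0, which the limit from the right does not see;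
it is obtained from the linear systems at ε = 0. -/
lemma solutionCoeff_zero_eq {N : ℕ} {M : ℕ → ℕ → Matrix (Fin (N + 1)) (Fin (N + 1)) ℝ}
    {θ : ℕ → ℕ → Fin (N + 1) → ℝ} (h : IsUnit (1 - M 0 0).det) {K : ℕ}
    {x : ℕ → Fin (N + 1) → ℝ}
    (hx : ∀ r ≤ K, x r = θ r 0 + ∑ m ∈ range (r + 1), (r.choose m : ℝ) • (M (r - m) 0 *ᵥ x m)) :
    ∀ r ≤ K, solutionCoeff M θ r 0 = x r := by
  intro r
  induction r using Nat.strong_induction_on with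
  | _ r ih =>
    intro hr
    rw [solutionCoeff]
    simp only [zero_add, range_one, sum_singleton, Nat.sub_zero, inverseCoeff]
    have h1 : ∑ m : Fin r, (r.choose m : ℝ) • (M (r - m) 0 *ᵥ solutionCoeff M θ m 0) =
        ∑ m ∈ range r, (r.choose m : ℝ) • (M (r - m) 0 *ᵥ x m) := by
      rw [← Fin.sum_univ_eq_sum_range (fun m => (r.choose m : ℝ) • (M (r - m) 0 *ᵥ x m))]
      exact sum_congr rfl fun m _ => by rw [ih m m.2 (by have := m.2; omega)]
    have h2 := hx r hr
    rw [sum_range_succ, Nat.choose_self, Nat.cast_one, one_smul, Nat.sub_self] at h2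
    have h3 : θ r 0 + ∑ m ∈ range r, (r.choose m : ℝ) • (M (r - m) 0 *ᵥ x m) =
        (1 - M 0 0) *ᵥ x r := by
      rw [Matrix.sub_mulVec, Matrix.one_mulVec]
      rw [eq_sub_iff_add_eq, add_assoc]
      exact h2.symm
    rw [h1, h3, Matrix.mulVec_mulVec, Matrix.nonsing_inv_mul _ h, Matrix.one_mulVec]

section Functionals

variable {N : ℕ} {T : ℝ≥0 → TransitionLaw N}
  {pc : Fin (N + 1) → Fin (N + 1) → ℕ → ℕ → ℝ} {ρ : ℝ}

theorem hasExpansion_mom_resolvent {i : Fin (N + 1)}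
    (hdet : IsUnit (1 - tabooCoeff pc i 0 0).det) {K : ℕ}
    {B : ℝ≥0 → Fin (N + 1) → PowerSeries ℝ≥0∞} {θ : ℕ → ℕ → Fin (N + 1) → ℝ}
    (hP : CondP T ρ K pc)
    (hB : ∀ r ≤ K, ∀ l, l ≠ 0 →
      HasExpansion (fun ε => (mom ρ r (B ε l)).toReal) (fun n => θ r n l) (K - r))
    (hq : ∀ r, ∀ᶠ ε in 𝓝 (0 : ℝ≥0), ∀ l j : Fin (N + 1), l ≠ 0 → mom ρ r (qSeries (T ε) l j) ≠ ⊤)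
    (hx : ∀ r, ∀ᶠ ε in 𝓝 (0 : ℝ≥0), ∀ l,
      mom ρ r (resolvent (tabooKernel (T ε) i) (B ε) l) ≠ ⊤)
    {r : ℕ} (hr : r ≤ K) {l : Fin (N + 1)} (hl : l ≠ 0) :
    HasExpansion (fun ε => (mom ρ r (resolvent (tabooKernel (T ε) i) (B ε) l)).toReal)
      (fun n => solutionCoeff (tabooCoeff pc i) θ r n l) (K - r) := by
  -- The perturbation condition says nothing about transitions out of 0. The component at 0 is
  -- therefore replaced by a polynomial with the prescribed coefficients, which the other components
  -- never see.
  set u : ℕ → ℝ≥0 → ℝ := fun r ε =>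
    (trunc (K - r + 1) (vecSeries (θ r) 0)).eval (ε : ℝ) with hu
  set b : ℕ → ℝ≥0 → Fin (N + 1) → ℝ := fun r ε a =>
    if a = 0 then u r ε else (mom ρ r (B ε a)).toReal with hb
  set x : ℕ → ℝ≥0 → Fin (N + 1) → ℝ := fun r ε a => if a = 0 then u r ε else
    (mom ρ r (resolvent (tabooKernel (T ε) i) (B ε) a)).toReal with hxdef
  set A : ℕ → ℝ≥0 → Matrix (Fin (N + 1)) (Fin (N + 1)) ℝ := fun r ε =>
    Matrix.of fun a c => (mom ρ r (tabooKernel (T ε) i a c)).toReal with hA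
  have hlin : ∀ r ≤ K, ∀ᶠ ε in 𝓝 (0 : ℝ≥0), x r ε = b r ε +
      ∑ m ∈ range (r + 1), (r.choose m : ℝ) • (A (r - m) ε *ᵥ x m ε) := by
    intro r _
    filter_upwards [(Finset.eventually_all (range (r + 1))).2 fun m _ => hq m,
      (Finset.eventually_all (range (r + 1))).2 fun m _ => hx m] with ε h1 h2
    exact toReal_mom_resolvent i (B ε) (fun r => u r ε)
      (fun m hm => h1 m (mem_range.2 (by omega))) fun m hm => h2 m (mem_range.2 (by omega))
  have hAexp : ∀ r ≤ K, ∀ a c,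
      HasExpansion (fun ε => A r ε a c) (fun n => tabooCoeff pc i r n a c) (K - r) := by
    intro r hr a c
    simp only [hA, Matrix.of_apply, tabooCoeff, tabooKernel_apply]
    by_cases h : a = 0 ∨ c = 0 ∨ c = i
    · simpa [h, mom_zero] using hasExpansion_const 0 (K - r)
    · simp only [h, if_false, mom_qSeries]
      push Not at h
      exact hP r hr a c h.1
  have hbexp : ∀ r ≤ K, ∀ a,
      HasExpansion (fun ε => b r ε a) (fun n => θ r n a) (K - r) := by
    intro r hr a
    by_cases ha : a = 0
    · subst ha
      rw [hasExpansion_iff]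
      simp only [hb, if_true]
      refine ⟨?_, expands_trunc _ _⟩
      simp [hu, eval_trunc, vecSeries, sum_range_succ', zero_pow]
    · simp only [hb, ha, if_false]
      exact hB r hr a ha
  have hxr : (fun ε => (mom ρ r (resolvent (tabooKernel (T ε) i) (B ε) l)).toReal) =
      fun ε => x r ε l := by
    simp only [hxdef, hl, if_false]
  rw [hxr, hasExpansion_iff]
  constructor
  · refine (congrFun (solutionCoeff_zero_eq hdet (x := fun r => x r 0) (fun r hr => ?_) r hr) l).symm
    have h1 := (hlin r hr).self_of_nhds
    have h2 : b r 0 = θ r 0 := funext fun a => (hbexp r hr a).1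
    have h3 : ∀ r ≤ K, A r 0 = tabooCoeff pc i r 0 := fun r hr => by
      ext a c; exact (hAexp r hr a c).1
    rw [h1, h2]
    congr 1
    refine sum_congr rfl fun m _ => ?_
    rw [h3 (r - m) (by omega)]
  · exact expands_solution (θ := θ) hdet (fun r hr a c => (hasExpansion_iff.1 (hAexp r hr a c)).2)
      (fun r hr a => (hasExpansion_iff.1 (hbexp r hr a)).2)
      (fun r hr => (hlin r hr).filter_mono nhdsWithin_le_nhds) r hr l

variable {ρ' : ℝ} {D : ℝ≥0}

lemma eventually_mom_ne_top {ι : Type*} (hρ : ρ < ρ') {a : ℝ≥0 → ι → PowerSeries ℝ≥0∞}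
    {p : ι → Prop} (h : ∀ᶠ ε in 𝓝 (0 : ℝ≥0), ∀ i, p i → mom ρ' 0 (a ε i) ≤ D) (r : ℕ) :
    ∀ᶠ ε in 𝓝 (0 : ℝ≥0), ∀ i, p i → mom ρ r (a ε i) ≠ ⊤ := by
  obtain ⟨C, hC⟩ := exists_mom_le hρ r
  filter_upwards [h] with ε hε i hi
  exact ne_top_of_le_ne_top (ENNReal.mul_ne_top ENNReal.coe_ne_top
    (ne_top_of_le_ne_top ENNReal.coe_ne_top (hε i hi))) (hC _)

lemma CondP.mono {K K' : ℕ} (hP : CondP T ρ K pc) (h : K' ≤ K) : CondP T ρ K' pc :=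
  fun r hr i j hi => (hP r (hr.trans h) i j hi).mono (by omega)

lemma mom_zero_le_mom_one {a : PowerSeries ℝ≥0∞} (ha : coeff 0 a = 0) :
    mom ρ 0 a ≤ mom ρ 1 a := by
  rw [mom_eq, mom_eq]
  refine ENNReal.tsum_le_tsum fun n => ?_
  rcases Nat.eq_zero_or_pos n with hn | hn
  · simp [hn, ha]
  · gcongr
    unfold weight
    refine ENNReal.ofReal_le_ofReal ?_
    have : (1 : ℝ) ≤ n := by exact_mod_cast hn
    rw [pow_zero, pow_one]
    gcongr

namespace RegularPerturbation

lemma q_ne_top (h : RegularPerturbation T ρ ρ' D) (r : ℕ) :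
    ∀ᶠ ε in 𝓝 (0 : ℝ≥0), ∀ l j : Fin (N + 1), l ≠ 0 → mom ρ r (qSeries (T ε) l j) ≠ ⊤ := by
  have := eventually_mom_ne_top (ι := Fin (N + 1) × Fin (N + 1)) (p := fun z => z.1 ≠ 0) h.lt
    (a := fun ε z => qSeries (T ε) z.1 z.2) (h.q_le.mono fun ε hε z hz => hε z.1 z.2 hz) r
  exact this.mono fun ε hε l j hl => hε (l, j) hl

lemma survival_ne_top (h : RegularPerturbation T ρ ρ' D) (r : ℕ) :
    ∀ᶠ ε in 𝓝 (0 : ℝ≥0), ∀ s : Fin (N + 1), s ≠ 0 → mom ρ r (survival (T ε) s) ≠ ⊤ :=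
  eventually_mom_ne_top h.lt h.survival_le r

lemma g_ne_top (h : RegularPerturbation T ρ ρ' D) {i : Fin (N + 1)} (hi : i ≠ 0) (r : ℕ) :
    ∀ᶠ ε in 𝓝 (0 : ℝ≥0), ∀ l, mom ρ r (gSeries (T ε) i l) ≠ ⊤ := by
  have := eventually_mom_ne_top (p := fun _ => True) h.lt
    (h.g_le.mono fun ε hε l _ => hε i l hi) r
  exact this.mono fun ε hε l => hε l trivial

lemma h_ne_top (h : RegularPerturbation T ρ ρ' D) {i s : Fin (N + 1)} (hi : i ≠ 0) (hs : s ≠ 0)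
    (r : ℕ) : ∀ᶠ ε in 𝓝 (0 : ℝ≥0), ∀ l, mom ρ r (hSeries (T ε) i s l) ≠ ⊤ := by
  have := eventually_mom_ne_top (p := fun _ => True) h.lt
    (h.h_le.mono fun ε hε l _ => hε i s l hi hs) r
  exact this.mono fun ε hε l => hε l trivial

/-- The finite Green function of the limiting taboo kernel is a right inverse, by G = 1 + M G. -/
lemma isUnit_det (h : RegularPerturbation T ρ ρ' D) {K : ℕ} (hP : CondP T ρ K pc)
    {i : Fin (N + 1)} (hi : i ≠ 0) : IsUnit (1 - tabooCoeff pc i 0 0).det := by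
  have hT := h.communicates.self_of_nhds
  have hM : tabooCoeff pc i 0 0 = Matrix.of fun a l => (tabooMom (T 0) ρ i a l).toReal := by
    ext a l
    rw [tabooCoeff, Matrix.of_apply, Matrix.of_apply, tabooMom_apply]
    by_cases hal : a = 0 ∨ l = 0 ∨ l = i
    · simp [hal]
    · rw [if_neg hal, if_neg hal, mom_qSeries]
      push Not at hal
      exact (hP 0 (Nat.zero_le K) a l hal.1).1.symm
  refine Matrix.isUnit_det_of_right_inverse
    (B := Matrix.of fun a l => (green (tabooMom (T 0) ρ i) a l).toReal) ?_
  have hG : ∀ a l, green (tabooMom (T 0) ρ i) a l ≠ ⊤ := fun a l =>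
    hT.green_ne_top hi (by rw [h.root i hi]; simp) a l
  rw [sub_mul, one_mul, sub_eq_iff_eq_add, hM]
  ext a l
  rw [Matrix.add_apply, Matrix.mul_apply]
  simp only [Matrix.of_apply]
  have hmul : ∀ b ∈ univ, tabooMom (T 0) ρ i a b * green (tabooMom (T 0) ρ i) b l ≠ ⊤ :=
    fun b _ => ENNReal.mul_ne_top (mom_tabooKernel_ne_top i (h.q_ne_top 0).self_of_nhds a b)
      (hG b l)
  rw [green_eq_left, ENNReal.toReal_add (by rw [Matrix.one_apply]; split_ifs <;> simp)
    (ENNReal.sum_ne_top.2 hmul), ENNReal.toReal_sum hmul]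
  simp only [ENNReal.toReal_mul]
  congr 1
  rw [Matrix.one_apply, Matrix.one_apply]
  split_ifs <;> simp

theorem hasExpansion_φ (h : RegularPerturbation T ρ ρ' D) {K : ℕ} (hP : CondP T ρ K pc)
    {i : Fin (N + 1)} (hi : i ≠ 0) {r : ℕ} (hr : r ≤ K) :
    HasExpansion (fun ε => (mom ρ r (gSeries (T ε) i i)).toReal) (phiCoeff pc i r) (K - r) := by
  refine hasExpansion_mom_resolvent (h.isUnit_det hP hi) hP (fun r hr l hl => ?_) h.q_ne_top
    (h.g_ne_top hi) hr hi
  simp only [entrance, hl, if_false, mom_qSeries]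
  exact hP r hr l i hl

theorem hasExpansion_omega (h : RegularPerturbation T ρ ρ' D) {k : ℕ}
    (hP : CondP T ρ (k + 1) pc) {i j : Fin (N + 1)} (hi : i ≠ 0) (hj : j ≠ 0) {r : ℕ}
    (hr : r ≤ k) : HasExpansion (fun ε => (mom ρ r (hSeries (T ε) i j i)).toReal)
      (omegaCoeff pc ρ i j r) (k - r) := by
  refine hasExpansion_mom_resolvent (h.isUnit_det hP hi) (hP.mono k.le_succ)
    (fun r hr l hl => ?_) h.q_ne_top (h.h_ne_top hi hj) hr hi
  by_cases hlj : l = j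
  · simp only [sojourn, hlj, if_true]
    exact hP.hasExpansion_survival h.q_ne_top h.survival_ne_top hj hr
  · simpa [sojourn, hlj, mom_zero] using hasExpansion_const 0 (k - r)

lemma phiCoeff_zero_zero (h : RegularPerturbation T ρ ρ' D) {K : ℕ} (hP : CondP T ρ K pc)
    {i : Fin (N + 1)} (hi : i ≠ 0) : phiCoeff pc i 0 0 = 1 := by
  rw [← (h.hasExpansion_φ hP hi (Nat.zero_le K)).1]
  simp [h.root i hi]

/-- Since g vanishes at time 0, the first moment is at least the zeroth one, which is 1 at the root.
-/
lemma phiCoeff_one_zero (h : RegularPerturbation T ρ ρ' D) {k : ℕ} (hP : CondP T ρ (k + 1) pc)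
    {i : Fin (N + 1)} (hi : i ≠ 0) : phiCoeff pc i 1 0 ≠ 0 := by
  rw [← (h.hasExpansion_φ hP hi (r := 1) (by omega)).1]
  refine (ENNReal.toReal_pos ?_ ((h.g_ne_top hi 1).self_of_nhds i)).ne'
  refine (lt_of_lt_of_le ?_ (mom_zero_le_mom_one (coeff_zero_gSeries i i))).ne'
  rw [h.root i hi]
  exact one_pos

lemma omegaCoeff_pos (h : RegularPerturbation T ρ ρ' D) {k : ℕ} (hP : CondP T ρ (k + 1) pc)
    {i j : Fin (N + 1)} (hi : i ≠ 0) (hj : j ≠ 0) : 0 < omegaCoeff pc ρ i j 0 0 := by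
  rw [← (h.hasExpansion_omega hP hi hj (Nat.zero_le k)).1]
  refine ENNReal.toReal_pos ?_ ((h.h_ne_top hi hj 0).self_of_nhds i)
  rw [mom_hSeries]
  refine mul_ne_zero (h.communicates.self_of_nhds.green_pos ρ hi hj) ?_
  rw [Ne, mom_eq_zero_iff]
  exact survival_ne_zero _ _

end RegularPerturbation

end Functionals

/-! ### Taylor expansions of exponential moments -/

lemma abs_exp_sub_sum_le (x : ℝ) (n : ℕ) :
    |Real.exp x - ∑ r ∈ range n, x ^ r / r.factorial| ≤ |x| ^ n * Real.exp |x| := by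
  have := Complex.norm_exp_sub_sum_le_norm_mul_exp (x : ℂ) n
  rw [Complex.norm_real, Real.norm_eq_abs, ← Complex.ofReal_exp] at this
  have h2 : (Real.exp x : ℂ) - ∑ r ∈ range n, (x : ℂ) ^ r / r.factorial =
      ((Real.exp x - ∑ r ∈ range n, x ^ r / r.factorial : ℝ) : ℂ) := by push_cast; rfl
  rwa [h2, Complex.norm_real, Real.norm_eq_abs] at this

/-- Taylor's formula for exp(Δn), term by term; the factor exp(|Δ|n) of the remainder is absorbed by
the larger exponent ρ + δ. -/
lemma abs_toReal_mom_sub_le {ρ Δ δ : ℝ} (hΔ : |Δ| ≤ δ) (K : ℕ) {a : PowerSeries ℝ≥0∞}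
    (hfin : ∀ r ≤ K, mom (ρ + δ) r a ≠ ⊤) :
    |(mom (ρ + Δ) 0 a).toReal -
      ∑ r ∈ range K, ((r.factorial : ℝ)⁻¹ * (Δ ^ r * (mom ρ r a).toReal))| ≤
      |Δ| ^ K * (mom (ρ + δ) K a).toReal := by
  have hδ : 0 ≤ δ := (abs_nonneg Δ).trans hΔ
  have h1 : HasSum _ (mom (ρ + Δ) 0 a).toReal := hasSum_toReal_mom
    (ne_top_of_le_ne_top (hfin 0 (Nat.zero_le K))
      (mom_mono (by linarith [le_abs_self Δ]) 0 a))
  have h2 := hasSum_sum fun r (hr : r ∈ range K) => ((hasSum_toReal_mom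
    (ne_top_of_le_ne_top (hfin r (mem_range.1 hr).le)
      (mom_mono (show ρ ≤ ρ + δ by linarith) r a))).mul_left (Δ ^ r)).mul_left
        ((r.factorial : ℝ)⁻¹)
  have h3 := (hasSum_toReal_mom (hfin K le_rfl)).mul_left (|Δ| ^ K)
  rw [← Real.norm_eq_abs]
  refine (h1.sub h2).norm_le_of_bounded h3 fun n => ?_
  have h4 : (n : ℝ) ^ 0 * Real.exp ((ρ + Δ) * n) * (coeff n a).toReal -
      ∑ r ∈ range K, (r.factorial : ℝ)⁻¹ *
        (Δ ^ r * ((n : ℝ) ^ r * Real.exp (ρ * n) * (coeff n a).toReal)) =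
      (Real.exp (ρ * n) * (coeff n a).toReal) *
        (Real.exp (Δ * n) - ∑ r ∈ range K, (Δ * n) ^ r / r.factorial) := by
    rw [mul_sub, mul_sum, pow_zero, one_mul, add_mul, Real.exp_add]
    congr 1
    · ring
    · refine sum_congr rfl fun r _ => ?_
      rw [mul_pow, div_eq_mul_inv]
      ring
  rw [h4, norm_mul, Real.norm_eq_abs, Real.norm_eq_abs,
    abs_of_nonneg (mul_nonneg (Real.exp_pos _).le ENNReal.toReal_nonneg)]
  calc _ ≤ (Real.exp (ρ * n) * (coeff n a).toReal) * (|Δ * n| ^ K * Real.exp |Δ * n|) := by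
        gcongr
        exact abs_exp_sub_sum_le _ _
    _ ≤ (Real.exp (ρ * n) * (coeff n a).toReal) * ((|Δ| * n) ^ K * Real.exp (δ * n)) := by
        rw [abs_mul, Nat.abs_cast]
        gcongr
    _ = _ := by
        rw [mul_pow, add_mul, Real.exp_add]
        ring

end QSD

namespace QSD

open PowerSeries Finset Asymptotics

/-! ### Quotients of expansions -/

section Quotient

variable {x y : ℝ≥0 → ℝ} {a b p : ℕ → ℝ} {m : ℕ}

lemma HasExpansion.div (hx : HasExpansion x a m) (hy : HasExpansion y b m) (hb : b 0 ≠ 0) :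
    HasExpansion (fun ε => x ε / y ε)
      (fun n => coeff n (PowerSeries.mk a * (PowerSeries.mk b)⁻¹)) m := by
  rw [hasExpansion_iff] at hx hy ⊢
  constructor
  · rw [hx.1, hy.1]
    simp [div_eq_mul_inv]
  · refine ((hx.2.mul (hy.2.inv (by simpa using hb))).congr_series fun n _ => ?_).congr
      (Filter.Eventually.of_forall fun ε => (div_eq_mul_inv _ _).symm)
    rw [coeff_mk]

/-- Compare coefficients in x = y · (x/y). Any expansion of the quotient satisfies the recursion,
however it was obtained. -/
lemma HasExpansion.quotient_recursion (hx : HasExpansion x a m) (hy : HasExpansion y b m)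
    (hb : b 0 ≠ 0) (hq : HasExpansion (fun ε => x ε / y ε) p m) {n : ℕ} (hn : n ≤ m) :
    p n = 1 / b 0 * (a n - ∑ q ∈ range n, b (n - q) * p q) := by
  rw [hasExpansion_iff] at hx hy hq
  have hy0 : ∀ᶠ ε in 𝓝[>] 0, y ε ≠ 0 := hy.2.tendsto.eventually_ne (by simpa using hb)
  have h1 : Expands x (PowerSeries.mk b * PowerSeries.mk p) m := by
    refine (hy.2.mul hq.2).congr ?_
    filter_upwards [hy0] with ε hε
    field_simp
  have h2 := hx.2.coeff_eq h1 n hn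
  simp only [coeff_mul, coeff_mk] at h2
  rw [← sum_range_sub_eq_antidiagonal (fun i j => b i * p j), sum_range_succ, Nat.sub_self] at h2
  rw [h2]
  field_simp
  ring

end Quotient

/-! ### Expansions at the root of the characteristic equation -/

section Root

variable {ρ ρ' : ℝ} {D : ℝ≥0}

lemma isBigO_taylor_remainder (hρ : ρ < ρ') {a : ℝ≥0 → PowerSeries ℝ≥0∞}
    (ha : ∀ᶠ ε in 𝓝[>] (0 : ℝ≥0), mom ρ' 0 (a ε) ≤ D) {Δ : ℝ≥0 → ℝ}
    (hΔ : Tendsto Δ (𝓝[>] 0) (𝓝 0)) (K : ℕ) :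
    (fun ε => (mom (ρ + Δ ε) 0 (a ε)).toReal -
      ∑ r ∈ range K, (r.factorial : ℝ)⁻¹ * (Δ ε ^ r * (mom ρ r (a ε)).toReal))
      =O[𝓝[>] 0] fun ε => Δ ε ^ K := by
  set δ := (ρ' - ρ) / 2 with hδ
  have hδ0 : 0 < δ := by rw [hδ]; linarith
  have hδ' : ρ + δ < ρ' := by rw [hδ]; linarith
  obtain ⟨C, hC⟩ := exists_mom_le hδ' K
  refine IsBigO.of_bound (C * D : ℝ≥0) ?_
  have h1 : ∀ᶠ ε in 𝓝[>] 0, |Δ ε| < δ := by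
    have := hΔ.abs
    rw [abs_zero] at this
    exact this.eventually_lt_const hδ0
  filter_upwards [h1, ha] with ε h1 ha
  have hle : mom (ρ + δ) K (a ε) ≤ (C * D : ℝ≥0) := by
    rw [ENNReal.coe_mul]
    exact (hC (a ε)).trans (by gcongr)
  have hfin : ∀ r ≤ K, mom (ρ + δ) r (a ε) ≠ ⊤ := fun r _ => by
    obtain ⟨C', hC'⟩ := exists_mom_le hδ' r
    exact ne_top_of_le_ne_top (ENNReal.mul_ne_top ENNReal.coe_ne_top
      (ne_top_of_le_ne_top ENNReal.coe_ne_top ha)) (hC' (a ε))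
  rw [Real.norm_eq_abs, norm_pow, Real.norm_eq_abs, mul_comm]
  refine (abs_toReal_mom_sub_le h1.le K hfin).trans ?_
  gcongr
  exact ENNReal.toReal_mono ENNReal.coe_ne_top hle

variable {N : ℕ} {T : ℝ≥0 → TransitionLaw N} {X : ∀ ε : ℝ≥0, MarkovRenewalProcess.{u} (T ε)}
  {pc : Fin (N + 1) → Fin (N + 1) → ℕ → ℕ → ℝ} {k : ℕ}

namespace RegularPerturbation

/-- As φ grows at least like the exponential, the distance between the roots is at most |log
φ^(ε)(ρ)|, which tends to log 1 = 0. -/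
lemma tendsto_charRoot (h : RegularPerturbation T ρ ρ' D) (hA : CondA T)
    (hP : CondP T ρ (k + 1) pc) {i : Fin (N + 1)} (hi : i ≠ 0) :
    Tendsto (fun ε => (X ε).charRoot - ρ) (𝓝[>] 0) (𝓝 0) := by
  set φ : ℝ≥0 → ℝ := fun ε => (mom ρ 0 (gSeries (T ε) i i)).toReal with hφ
  have h1 : Tendsto φ (𝓝[>] 0) (𝓝 1) := by
    have := (hasExpansion_iff.1 (h.hasExpansion_φ hP hi (Nat.zero_le _))).2.tendsto
    rwa [coeff_mk, h.phiCoeff_zero_zero hP hi] at this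
  have h2 : Tendsto (fun ε => |Real.log (φ ε)|) (𝓝[>] 0) (𝓝 0) := by
    have := (h1.log one_ne_zero).abs
    rwa [Real.log_one, abs_zero] at this
  refine squeeze_zero_norm' ?_ h2
  filter_upwards [h1.eventually_const_lt one_pos,
    (h.eventually_root hA X hi).filter_mono nhdsWithin_le_nhds,
    (h.g_ne_top hi 0).filter_mono nhdsWithin_le_nhds] with ε hpos hroot hfin
  have hof : ENNReal.ofReal (φ ε) = mom ρ 0 (gSeries (T ε) i i) := ENNReal.ofReal_toReal (hfin i)
  rw [Real.norm_eq_abs]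
  rcases le_total ρ (X ε).charRoot with hle | hle
  · have h3 := exp_mul_mom_le hle (coeff_zero_gSeries (T := T ε) i i)
    rw [hroot.2.2, ← hof, ← ENNReal.ofReal_mul (Real.exp_pos _).le, ENNReal.ofReal_le_one] at h3
    have h4 := Real.log_le_log (by positivity) h3
    rw [Real.log_mul (Real.exp_pos _).ne' hpos.ne', Real.log_exp, Real.log_one] at h4
    rw [abs_of_nonneg (sub_nonneg.2 hle)]
    exact (by linarith : _ ≤ -Real.log (φ ε)).trans (neg_le_abs _)
  · have h3 := exp_mul_mom_le hle (coeff_zero_gSeries (T := T ε) i i)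
    rw [hroot.2.2, mul_one, ← hof, ENNReal.ofReal_le_ofReal_iff hpos.le] at h3
    have h4 := Real.log_le_log (Real.exp_pos _) h3
    rw [Real.log_exp] at h4
    rw [abs_of_nonpos (sub_nonpos.2 hle), neg_sub]
    exact h4.trans (le_abs_self _)

lemma expands_φ (h : RegularPerturbation T ρ ρ' D) (hP : CondP T ρ (k + 1) pc)
    {i : Fin (N + 1)} (hi : i ≠ 0) : ∀ r ≤ k,
    Expands (fun ε => (mom ρ r (gSeries (T ε) i i)).toReal) (PowerSeries.mk (phiCoeff pc i r))
      (k - r) := fun r hr =>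
  (hasExpansion_iff.1 (h.hasExpansion_φ hP hi (hr.trans k.le_succ))).2.mono (by omega)

lemma isBigO_φ_remainder (h : RegularPerturbation T ρ ρ' D) (hA : CondA T)
    (hP : CondP T ρ (k + 1) pc) {i : Fin (N + 1)} (hi : i ≠ 0) :
    (fun ε => 1 - ∑ r ∈ range (k + 1), (r.factorial : ℝ)⁻¹ * (((X ε).charRoot - ρ) ^ r *
      (mom ρ r (gSeries (T ε) i i)).toReal)) =O[𝓝[>] 0] fun ε => ((X ε).charRoot - ρ) ^ (k + 1) := by
  refine (isBigO_taylor_remainder h.lt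
    ((h.g_le.mono fun ε hε => hε i i hi).filter_mono nhdsWithin_le_nhds)
    (h.tendsto_charRoot (X := X) hA hP hi) (k + 1)).congr' ?_ (EventuallyEq.refl _ _)
  filter_upwards [(h.eventually_root hA X hi).filter_mono nhdsWithin_le_nhds] with ε hε
  rw [add_sub_cancel, hε.2.2, ENNReal.toReal_one]

/-- The coefficients of the expansion of the root. -/
theorem exists_hasExpansion_charRoot (h : RegularPerturbation T (X 0).charRoot ρ' D)
    (hA : CondA T) (hP : CondP T (X 0).charRoot (k + 1) pc) {i₀ : Fin (N + 1)} (hi₀ : i₀ ≠ 0) :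
    ∃ c : ℕ → ℝ, HasExpansion (fun ε => (X ε).charRoot) c k ∧
      Expands (fun ε => (X ε).charRoot - (X 0).charRoot) (incrementSeries c) k ∧
      ∀ i : Fin (N + 1), i ≠ 0 → ∀ n ∈ Icc 1 k, c n = rootStep (phiCoeff pc i) c n := by
  obtain ⟨p, hp, hΔ⟩ := exists_expands_root (h.expands_φ hP hi₀) (h.phiCoeff_zero_zero hP hi₀)
    (h.phiCoeff_one_zero hP hi₀) (h.tendsto_charRoot (X := X) hA hP hi₀)
    (h.isBigO_φ_remainder hA hP hi₀)
  have hp0 : coeff 0 p = 0 := by rwa [X_dvd_iff, ← coeff_zero_eq_constantCoeff_apply] at hp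
  -- The entry c 0 only records the limiting root; `incrementSeries` discards it.
  set c : ℕ → ℝ := fun n => if n = 0 then (X 0).charRoot else coeff n p with hc
  have hinc : incrementSeries c = p := by
    ext n
    rw [incrementSeries, coeff_mk]
    by_cases hn : n = 0
    · simp [hn, hp0]
    · simp [hn, hc]
  have hΔ' : Expands (fun ε => (X ε).charRoot - (X 0).charRoot) (incrementSeries c) k :=
    hinc ▸ hΔ
  refine ⟨c, ?_, hΔ', fun i hi n hn => ?_⟩
  · rw [hasExpansion_iff]
    refine ⟨by simp [hc], ((hΔ.add (expands_const (X 0).charRoot k)).congr_series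
      fun n _ => ?_).congr (Filter.Eventually.of_forall fun ε => sub_add_cancel _ _)⟩
    rw [map_add, coeff_mk, coeff_C]
    by_cases hn : n = 0
    · simp [hn, hp0, hc]
    · simp [hn, hc]
  -- The expansion was found with i₀, but the root is common to all states, so the same c solves the
  -- recursion for every i.
  · exact eq_rootStep (h.expands_φ hP hi) (h.phiCoeff_one_zero hP hi) hΔ'
      (h.isBigO_φ_remainder hA hP hi) hn

/-- The expansion of the functionals at the root. -/
theorem hasExpansion_omega_charRoot (h : RegularPerturbation T (X 0).charRoot ρ' D)
    (hA : CondA T) (hP : CondP T (X 0).charRoot (k + 1) pc) {c : ℕ → ℝ}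
    (hc : Expands (fun ε => (X ε).charRoot - (X 0).charRoot) (incrementSeries c) k)
    {i j : Fin (N + 1)} (hi : i ≠ 0) (hj : j ≠ 0) :
    HasExpansion (fun ε => (mom (X ε).charRoot 0 (hSeries (T ε) i j i)).toReal)
      (omegaStep (omegaCoeff pc (X 0).charRoot i j) c) k := by
  rw [hasExpansion_iff]
  constructor
  · refine (h.hasExpansion_omega hP hi hj (Nat.zero_le k)).1.trans ?_
    simp [omegaStep]
  · have h1 := expands_taylor (c := c)
      (F := fun ε => (mom (X ε).charRoot 0 (hSeries (T ε) i j i)).toReal)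
      (fun r hr => (hasExpansion_iff.1 (h.hasExpansion_omega hP hi hj hr)).2) hc ?_
    · refine h1.congr_series fun n hn => ?_
      rw [coeff_taylorSeries _ c hn, coeff_mk]
    · have h2 := isBigO_taylor_remainder h.lt
        ((h.h_le.mono fun ε hε => hε i j i hi hj).filter_mono nhdsWithin_le_nhds)
        (h.tendsto_charRoot (X := X) hA hP hi) (k + 1)
      simpa only [add_sub_cancel] using h2

lemma omega_charRoot_ne_top (h : RegularPerturbation T ρ ρ' D) (hA : CondA T)
    {i j : Fin (N + 1)} (hi : i ≠ 0) (hj : j ≠ 0) :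
    ∀ᶠ ε in 𝓝 (0 : ℝ≥0), mom (X ε).charRoot 0 (hSeries (T ε) i j i) ≠ ⊤ := by
  filter_upwards [h.eventually_root hA X hi, h.h_le] with ε h1 h2
  exact ne_top_of_le_ne_top ENNReal.coe_ne_top
    ((mom_mono h1.2.1.le 0 _).trans (h2 i j i hi hj))

/-- The quasi-stationary distribution as a ratio of functionals. -/
theorem eventually_isQuasiStationary (h : RegularPerturbation T ρ ρ' D) (hA : CondA T)
    {i₀ : Fin (N + 1)} (hi₀ : i₀ ≠ 0) (hper : NonPeriodic ((X 0).g i₀ i₀)) :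
    ∀ᶠ ε in 𝓝 (0 : ℝ≥0), (X ε).IsQuasiStationary (fun j =>
        ((X ε).omega i₀ i₀ j (X ε).charRoot 0).toReal /
          ∑ s : Fin N, ((X ε).omega i₀ i₀ s.succ (X ε).charRoot 0).toReal) ∧
      ∀ i j : Fin (N + 1), i ≠ 0 →
        ((X ε).omega i₀ i₀ j (X ε).charRoot 0).toReal /
          ∑ s : Fin N, ((X ε).omega i₀ i₀ s.succ (X ε).charRoot 0).toReal =
        ((X ε).omega i i j (X ε).charRoot 0).toReal /
          ∑ s : Fin N, ((X ε).omega i i s.succ (X ε).charRoot 0).toReal := by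
  have hper' : NonPeriodic fun n => coeff n (gSeries (T 0) i₀ i₀) := by
    have : (X 0).g i₀ i₀ = fun n => coeff n (gSeries (T 0) i₀ i₀) :=
      funext fun n => (X 0).g_eq hi₀ hi₀ n
    rwa [← this]
  filter_upwards [h.eventually_root hA X hi₀, h.g_le, h.survival_le, h.communicates,
    hA.eventually_nonPeriodic hper'] with ε hroot hg hS hT hnp
  refine ⟨(X ε).isQuasiStationary hT hi₀ hnp hroot.2.2 hroot.2.1
    (ne_top_of_le_ne_top ENNReal.coe_ne_top (hg i₀ i₀ hi₀)) fun s hs =>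
      ne_top_of_le_ne_top ENNReal.coe_ne_top ((mom_mono hroot.2.1.le 0 _).trans (hS s hs)),
    fun i j hi => (X ε).omega_ratio_eq hT hi₀ hi hroot.2.2 j⟩

end RegularPerturbation

end Root

end QSD

/-! ### Assembly of the theorem -/

theorem theorem1 {N : ℕ} (T : ℝ≥0 → QSD.TransitionLaw N)
    (X : ∀ ε : ℝ≥0, QSD.MarkovRenewalProcess.{u} (T ε)) (k : ℕ)
    (pc : Fin (N + 1) → Fin (N + 1) → ℕ → ℕ → ℝ)
    (hA : QSD.CondA T) (hB : QSD.CondB T X) (hC : QSD.CondC T X) (hD : QSD.CondD T X)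
    (hP : QSD.CondP T (X 0).charRoot (k + 1) pc) :
    -- the root of the characteristic equation exists and is unique, for each reference state
    (∀ᶠ ε in 𝓝 (0 : ℝ≥0), (X ε).IsCharRoot (X ε).charRoot ∧
      ∀ i : Fin (N + 1), i ≠ 0 → ∀ ρ : ℝ, 0 ≤ ρ → (X ε).φ i i ρ 0 = 1 → ρ = (X ε).charRoot) ∧
    -- the functionals at the limiting root are finite and have expansions
    -- with coefficients computed from those of the perturbation condition
    (∀ i : Fin (N + 1), i ≠ 0 →
      IsUnit (1 - QSD.tabooCoeff pc i 0 0).det ∧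
      ∀ r : ℕ, r ≤ k →
        ((∀ᶠ ε in 𝓝 (0 : ℝ≥0), (X ε).φ i i (X 0).charRoot r ≠ ⊤) ∧
          QSD.HasExpansion (fun ε => ((X ε).φ i i (X 0).charRoot r).toReal)
            (QSD.phiCoeff pc i r) (k - r)) ∧
        ∀ j : Fin (N + 1), j ≠ 0 →
          (∀ᶠ ε in 𝓝 (0 : ℝ≥0), (X ε).omega i i j (X 0).charRoot r ≠ ⊤) ∧
          QSD.HasExpansion (fun ε => ((X ε).omega i i j (X 0).charRoot r).toReal)
            (QSD.omegaCoeff pc (X 0).charRoot i j r) (k - r)) ∧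
    ∃ (π : ℝ≥0 → Fin (N + 1) → ℝ) (c : ℕ → ℝ) (d : Fin (N + 1) → Fin (N + 1) → ℕ → ℝ)
      (πc : Fin (N + 1) → ℕ → ℝ),
      -- `π ε` is the quasi-stationary distribution, and it is a ratio of the functionals
      (∀ᶠ ε in 𝓝 (0 : ℝ≥0), (X ε).IsQuasiStationary (π ε) ∧
        ∀ i j : Fin (N + 1), i ≠ 0 → j ≠ 0 →
          π ε j = ((X ε).omega i i j (X ε).charRoot 0).toReal /
            ∑ s : Fin N, ((X ε).omega i i s.succ (X ε).charRoot 0).toReal) ∧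
      -- expansion of the root
      (QSD.HasExpansion (fun ε => (X ε).charRoot) c k ∧
        ∀ i : Fin (N + 1), i ≠ 0 → QSD.phiCoeff pc i 1 0 ≠ 0) ∧
      (∀ i : Fin (N + 1), i ≠ 0 → ∀ n ∈ Finset.Icc 1 k,
        c n = QSD.rootStep (QSD.phiCoeff pc i) c n) ∧
      -- expansion of the functionals at the root
      (∀ i j : Fin (N + 1), i ≠ 0 → j ≠ 0 →
        (∀ᶠ ε in 𝓝 (0 : ℝ≥0), (X ε).omega i i j (X ε).charRoot 0 ≠ ⊤) ∧
        QSD.HasExpansion (fun ε => ((X ε).omega i i j (X ε).charRoot 0).toReal) (d i j) k ∧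
        d i j 0 = QSD.omegaCoeff pc (X 0).charRoot i j 0 0 ∧
        ∀ n ∈ Finset.Icc 1 k,
          d i j n = QSD.omegaStep (QSD.omegaCoeff pc (X 0).charRoot i j) c n) ∧
      -- expansion of the quasi-stationary distribution
      (∀ j : Fin (N + 1), j ≠ 0 → QSD.HasExpansion (fun ε => π ε j) (πc j) k) ∧
      (∀ i j : Fin (N + 1), i ≠ 0 → j ≠ 0 →
        (∑ s : Fin N, d i s.succ 0) ≠ 0 ∧
        ∀ n ∈ Finset.range (k + 1),
          πc j n = 1 / (∑ s : Fin N, d i s.succ 0) *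
            (d i j n - ∑ q ∈ Finset.range n, (∑ s : Fin N, d i s.succ (n - q)) * πc j q)) := by
  obtain ⟨ρ', D, h⟩ := QSD.exists_regularPerturbation hA hB hC
  obtain ⟨i₀, hi₀, hper⟩ := hD
  obtain ⟨c, hc, hΔ, hstep⟩ := h.exists_hasExpansion_charRoot hA hP hi₀
  have hω : ∀ i j : Fin (N + 1), i ≠ 0 → j ≠ 0 →
      QSD.HasExpansion (fun ε => ((X ε).omega i i j (X ε).charRoot 0).toReal)
        (QSD.omegaStep (QSD.omegaCoeff pc (X 0).charRoot i j) c) k := fun i j hi hj => by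
    simp only [fun ε => (X ε).omega_eq hi i j]
    exact h.hasExpansion_omega_charRoot hA hP hΔ hi hj
  have hd0 : ∀ i j : Fin (N + 1),
      QSD.omegaStep (QSD.omegaCoeff pc (X 0).charRoot i j) c 0 =
        QSD.omegaCoeff pc (X 0).charRoot i j 0 0 := fun i j => by simp [QSD.omegaStep]
  have hsum : ∀ i : Fin (N + 1), i ≠ 0 →
      QSD.HasExpansion
        (fun ε => ∑ s : Fin N, ((X ε).omega i i s.succ (X ε).charRoot 0).toReal)
        (fun n => ∑ s : Fin N,
          QSD.omegaStep (QSD.omegaCoeff pc (X 0).charRoot i s.succ) c n) k := fun i hi =>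
    QSD.HasExpansion.sum fun s _ => hω i s.succ hi s.succ_ne_zero
  have he0 : ∀ i : Fin (N + 1), i ≠ 0 →
      ∑ s : Fin N, QSD.omegaStep (QSD.omegaCoeff pc (X 0).charRoot i s.succ) c 0 ≠ 0 := by
    intro i hi
    -- A state i ≠ 0 exists, so the sum over the non-zero states is not empty.
    obtain ⟨t, -⟩ := Fin.exists_succ_eq.2 hi
    simp only [hd0]
    exact (Finset.sum_pos (fun s _ => h.omegaCoeff_pos hP hi s.succ_ne_zero)
      ⟨t, Finset.mem_univ t⟩).ne'
  have hπ := h.eventually_isQuasiStationary (X := X) hA hi₀ hper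
  refine ⟨?_, fun i hi => ⟨h.isUnit_det hP hi, fun r hr => ⟨⟨?_, ?_⟩, fun j hj => ⟨?_, ?_⟩⟩⟩,
    fun ε j => ((X ε).omega i₀ i₀ j (X ε).charRoot 0).toReal /
      ∑ s : Fin N, ((X ε).omega i₀ i₀ s.succ (X ε).charRoot 0).toReal, c,
    fun i j => QSD.omegaStep (QSD.omegaCoeff pc (X 0).charRoot i j) c,
    -- The coefficients are those of the formal quotient for i₀; the recursion is verified
    -- afterwards for each i.
    fun j n => PowerSeries.coeff n
      (PowerSeries.mk (QSD.omegaStep (QSD.omegaCoeff pc (X 0).charRoot i₀ j) c) *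
        (PowerSeries.mk fun n => ∑ s : Fin N,
          QSD.omegaStep (QSD.omegaCoeff pc (X 0).charRoot i₀ s.succ) c n)⁻¹),
    ?_, ⟨hc, fun i hi => h.phiCoeff_one_zero hP hi⟩, hstep, fun i j hi hj => ⟨?_, hω i j hi hj,
      hd0 i j, fun n _ => rfl⟩, fun j hj => (hω i₀ j hi₀ hj).div (hsum i₀ hi₀) (he0 i₀ hi₀),
    fun i j hi hj => ⟨he0 i hi, fun n hn => ?_⟩⟩
  · filter_upwards [h.eventually_root hA X hi₀, h.communicates] with ε hroot hT
    obtain ⟨h1, -, h3⟩ := hT.charRoot_spec (X ε) hi₀ hroot.1 hroot.2.2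
    exact ⟨h1, h3⟩
  · filter_upwards [h.g_ne_top hi r] with ε hε
    rw [(X ε).φ_eq hi hi]
    exact hε i
  · simp only [fun ε => (X ε).φ_eq hi hi]
    exact (h.hasExpansion_φ hP hi (hr.trans k.le_succ)).mono (by omega)
  · filter_upwards [h.h_ne_top hi hj r] with ε hε
    rw [(X ε).omega_eq hi]
    exact hε i
  · simp only [fun ε => (X ε).omega_eq hi i j]
    exact h.hasExpansion_omega hP hi hj hr
  · filter_upwards [hπ] with ε hε
    exact ⟨hε.1, fun i j hi _ => hε.2 i j hi⟩
  · filter_upwards [h.omega_charRoot_ne_top (X := X) hA hi hj] with ε hε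
    rwa [(X ε).omega_eq hi]
  -- For small ε the ratio does not depend on the reference state, so the expansion from i₀ is also
  -- one of the quotient for i and obeys the recursion of i.
  · have hquot := ((hω i₀ j hi₀ hj).div (hsum i₀ hi₀) (he0 i₀ hi₀)).congr
      (hπ.mono fun ε hε => hε.2 i j hi)
    exact (hω i j hi hj).quotient_recursion (hsum i hi) (he0 i hi) hquot
      (Nat.lt_succ_iff.1 (Finset.mem_range.1 hn))
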